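/- **Setting.** Call $\sigma:\mathbb R\to\mathbb R$ admissible if it is increasing, $\sigma(r)\to0$ as $r\to-\infty$ and $\sigma(r)\to\gamma\in(0,1]$ as $r\to+\infty$, both exponentially fast; $\sigma'$ denotes its Stieltjes measure and $(f^{T}\sigma' g)=\int_{\mathbb R} f(v)g(v)\,\sigma'(dv)$. For a real function $A$ and $s\in\mathbb R$ let $K_2=K_2(s)$ be the operator on $L^2(\mathbb R_+)$ with kernel $K_2(x,y)=\int_{\mathbb R}\sigma(r)A(x+s+r)A(y+s+r)\,dr$, and let $$q_0(t)=q_0(s,t)=\int_{\mathbb R_+}A(t+s+y)\,(I-K_2)^{-1}(y,0)\,dy,\qquad (I-K_2)^{-1}(y,0)=\delta(y)+\big[(I-K_2)^{-1}K_2(\cdot,0)\big](y).$$ Primes on $q_0$ are derivatives in $s$. For $\varepsilon\in\{1,-1\}$ a higher-order Airy function of sign $\varepsilon$ is a real $C^\infty$ function $A$ on $\mathbb R$ with $A''''(x)=\varepsilon\,x\,A(x)$ such that $A$ and all its derivatives vanish exponentially fast at $+\infty$. The standard one is $$\mathrm{Ai}_5(x)=\frac1\pi\int_0^\infty\cos\Big(\frac{k^5}5+kx\Big)dk=\frac1{2\pi}\int_{\operatorname{Im}k=1}e^{ik^5/5+ikx}\,dk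 .$$ Consider the equation, for all $t\in\mathbb R$, $$q_0''''=\varepsilon(s+t)q_0+8q_0'(q_0^T\sigma'q_0')+6q_0(q_0^T\sigma'q_0'')-6q_0(q_0^T\sigma'q_0)^2+2q_0((q_0')^T\sigma'q_0')+4q_0''(q_0^T\sigma'q_0).\tag{$E_\varepsilon$}$$ **Theorem.** (a) $\mathrm{Ai}_5$ is a higher-order Airy function of sign $-1$. Let $A=\mathrm{Ai}_5$ and let $\sigma$ be admissible. For every $j\ge 0$ and $s$ the operator with kernel $\sqrt{\sigma(r)}\,\mathrm{Ai}_5^{(j)}(r+x+s)$ from $L^2(\mathbb R_+)$ to $L^2(\mathbb R)$ is Hilbert–Schmidt; for every $s$, $K_2$ is a bounded operator, $K_2(\cdot,0)\in L^2(\mathbb R_+)$ and $I-K_2$ is invertible; for each $t$, $s\mapsto q_0(s,t)$ is $C^4$; the pairings $(\partial_s^iq_0^{T}\,\sigma'\,\partial_s^jq_0)$, $i,j\le2$, converge absolutely; and $q_0$ satisfies $(E_{-1})$ for all $s$. For fixed $t$, as $s\to+\infty$, $$q_0(s,t)=\mathrm{Ai}_5(s+t)+o\Big(\Big(\int_{s+t}^\infty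 \mathrm{Ai}_5(x)^2dx\Big)^{1/2}\Big).$$ If $\sigma'=\delta_0$, then $q(s)=q_0(s,0)$ satisfies $q''''=-s\,q+10q(q')^2+10q^2q''-6q^5$ for all $s$, i.e. $q(-s)$ solves the second member of the Painlevé II hierarchy. (b) More generally let $\varepsilon\in\{1,-1\}$, let $A$ be a higher-order Airy function of sign $\varepsilon$, and let $\sigma$ be admissible and such that for all $j\ge0$ and $s\in\mathbb R$ the operator with kernel $\sqrt{\sigma(r)}\,A^{(j)}(r+x+s)$ from $L^2(\mathbb R_+)$ to $L^2(\mathbb R)$ is Hilbert–Schmidt. Then, for every $s$, $K_2$ is bounded and $K_2(\cdot,0)\in L^2(\mathbb R_+)$; $I-K_2$ is invertible for all large $s$. At every $s$ at which $I-K_2$ is invertible, each $q_0(\cdot,t)$ is $C^4$ near $s$, the pairings above converge absolutely, $(E_\varepsilon)$ holds, and, if $\sigma'=\delta_0$, $q(s)=q_0(s,0)$ satisfies $q''''=\varepsilon s\,q+10q(q')^2+10q^2q''-6q^5$. For fixed $t$, as $s\to+\infty$, $q_0(s,t)=A(s+t)+o\big((\int_{s+t}^\infty A^2)^{1/2}\big)$,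 and if $\varepsilon=1$ then $q_0(s,t)\sim A(s+t)$. -/

import Mathlib

open MeasureTheory Set Filter Topology Asymptotics

noncomputable section

namespace PainleveHierarchy

/-! ### Higher-order Airy functions -/

/-- `A` is a (real) smooth solution of `A'''' = ε x A` on `ℝ` which, together with its derivatives,
vanishes exponentially fast at `+∞`. -/
structure IsHigherAiry (ε : ℝ) (A : ℝ → ℝ) : Prop where
  smooth : ContDiff ℝ ((⊤ : ℕ∞) : WithTop ℕ∞) A
  ode : ∀ x, iteratedDeriv 4 A x = ε * x * A x
  decay : ∀ j : ℕ, ∃ C c : ℝ, 0 < c ∧ ∀ x, 0 ≤ x → |iteratedDeriv j A x| ≤ C * Real.exp (-(c * x))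

/-- The function `Ai₅(x) = (1/2π) ∫ exp(i k⁵/5 + i k x) dk`, that is
`(1/π) ∫₀^∞ cos(k⁵/5 + k x) dk`. As is usual for Airy functions the contour is the line
`k = u + i` of the upper half plane, on which the integral converges absolutely (the integrand has
modulus `exp(-u⁴ + 2u² - 1/5 - x)`); the value of the integral is real, by the symmetry `u ↦ -u`. -/
def Ai5 (x : ℝ) : ℝ :=
  (1 / (2 * Real.pi)) *
    (∫ u : ℝ, Complex.exp (Complex.I * ((u : ℂ) + Complex.I) ^ 5 / 5
      + Complex.I * ((u : ℂ) + Complex.I) * (x : ℂ))).re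

/-! ### The weight `σ` and the measure `σ'` -/

/-- `σ` is increasing, with limits `0` at `-∞` and `γ ∈ (0,1]` at `+∞`, both attained exponentially
fast. (No smoothness is required: jumps, or worse, are allowed.) -/
structure IsAdmissible (σ : ℝ → ℝ) : Prop where
  mono : Monotone σ
  limits : ∃ γ C c : ℝ, 0 < γ ∧ γ ≤ 1 ∧ 0 < c ∧
    (∀ r, r ≤ 0 → |σ r| ≤ C * Real.exp (c * r)) ∧
    (∀ r, 0 ≤ r → |σ r - γ| ≤ C * Real.exp (-(c * r)))

/-- The measure `σ'`: the Stieltjes measure of the increasing function `σ`. -/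
def dσ {σ : ℝ → ℝ} (hσ : Monotone σ) : Measure ℝ := hσ.stieltjesFunction.measure

/-- The pairing `(fᵀ σ' g) = ∫ f(v) g(v) σ'(dv)`. -/
def pairing (m : Measure ℝ) (f g : ℝ → ℝ) : ℝ := ∫ v, f v * g v ∂m

/-! ### The operator `K₂` and the function `q₀` -/

/-- Lebesgue measure on the half line `ℝ₊`. -/
abbrev halfLine : Measure ℝ := volume.restrict (Ioi (0 : ℝ))

/-- The real Hilbert space `L²(ℝ₊)`. -/
abbrev L2pos : Type := Lp ℝ 2 halfLine

/-- For every `s` and `j` the operator `√σ A_s^{(j)} : L²(ℝ₊) → L²(ℝ)`, of kernel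
`√σ(r) A^{(j)}(r + x + s)`, is Hilbert–Schmidt. -/
def SqrtWeightHilbertSchmidt (A σ : ℝ → ℝ) : Prop :=
  ∀ (j : ℕ) (s : ℝ), Integrable
    (fun p : ℝ × ℝ => σ p.1 * (iteratedDeriv j A (p.1 + p.2 + s)) ^ 2) (volume.prod halfLine)

/-- The kernel `K₂(x,y) = ∫_ℝ σ(r) A(x+s+r) A(y+s+r) dr`. -/
def kernelK2 (A σ : ℝ → ℝ) (s x y : ℝ) : ℝ := ∫ r, σ r * A (x + s + r) * A (y + s + r)

/-- `T` is the bounded operator on `L²(ℝ₊)` with integral kernel `k`. -/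
def IsIntegralOperator (k : ℝ → ℝ → ℝ) (T : L2pos →L[ℝ] L2pos) : Prop :=
  ∀ f : L2pos, ∀ᵐ x ∂halfLine,
    Integrable (fun y => k x y * f y) halfLine ∧ (T f) x = ∫ y, k x y * f y ∂halfLine

open Classical in
/-- The bounded operator on `L²(ℝ₊)` with kernel `k` (there is at most one), or `0` if there is
none. -/
def integralOperator (k : ℝ → ℝ → ℝ) : L2pos →L[ℝ] L2pos :=
  if h : ∃ T, IsIntegralOperator k T then h.choose else 0

/-- The operator `K₂` on `L²(ℝ₊)`. -/
def opK2 (A σ : ℝ → ℝ) (s : ℝ) : L2pos →L[ℝ] L2pos := integralOperator (kernelK2 A σ s)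

open Classical in
/-- The function `y ↦ K₂(y,0)` as an element of `L²(ℝ₊)`. -/
def columnK2 (A σ : ℝ → ℝ) (s : ℝ) : L2pos :=
  if h : MemLp (fun y => kernelK2 A σ s y 0) 2 halfLine then h.toLp _ else 0

/-- The regular part `ρ` of the resolvent kernel `(I - K₂)⁻¹(y,0) = δ(y) + ρ(y)`, namely
`ρ = (I - K₂)⁻¹ K₂(·,0)`. -/
def resolventColumn (A σ : ℝ → ℝ) (s : ℝ) : L2pos :=
  Ring.inverse (1 - opK2 A σ s) (columnK2 A σ s)

/-- `q₀(t) = ∫_{ℝ₊} A(t+s+y) (I - K₂)⁻¹(y,0) dy`, as a function of `s` and `t`. -/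
def q0 (A σ : ℝ → ℝ) (s t : ℝ) : ℝ :=
  A (t + s) + ∫ y, A (t + s + y) * resolventColumn A σ s y ∂halfLine

/-- The `k`-th derivative of `q₀(t)` with respect to `s`. -/
def dq0 (A σ : ℝ → ℝ) (k : ℕ) (s t : ℝ) : ℝ := iteratedDeriv k (fun s' => q0 A σ s' t) s

/-- The objects entering `q₀` are what they should be: `K₂` is a genuine bounded integral operator,
and `K₂(·,0)` belongs to `L²(ℝ₊)`. -/
def K2WellDefined (A σ : ℝ → ℝ) (s : ℝ) : Prop :=
  IsIntegralOperator (kernelK2 A σ s) (opK2 A σ s) ∧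
    MemLp (fun y => kernelK2 A σ s y 0) 2 halfLine

/-! ### The equations -/

/-- At the point `s`: `q₀(t)` is four times continuously differentiable in `s`, all the pairings
below converge, and
`q₀'''' = ε(s+t)q₀ + 8q₀'(q₀ᵀσ'q₀') + 6q₀(q₀ᵀσ'q₀'') - 6q₀(q₀ᵀσ'q₀)² + 2q₀((q₀')ᵀσ'q₀')
  + 4q₀''(q₀ᵀσ'q₀)` for every `t`. -/
def SecondMemberAt (ε : ℝ) (A : ℝ → ℝ) {σ : ℝ → ℝ} (hσ : Monotone σ) (s : ℝ) : Prop :=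
  (∀ t, ContDiffAt ℝ 4 (fun s' => q0 A σ s' t) s) ∧
  (∀ i j : ℕ, i ≤ 2 → j ≤ 2 →
    Integrable (fun v => dq0 A σ i s v * dq0 A σ j s v) (dσ hσ)) ∧
  ∀ t,
    dq0 A σ 4 s t =
      ε * (s + t) * q0 A σ s t
      + 8 * dq0 A σ 1 s t * pairing (dσ hσ) (q0 A σ s) (dq0 A σ 1 s)
      + 6 * q0 A σ s t * pairing (dσ hσ) (q0 A σ s) (dq0 A σ 2 s)
      - 6 * q0 A σ s t * (pairing (dσ hσ) (q0 A σ s) (q0 A σ s)) ^ 2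
      + 2 * q0 A σ s t * pairing (dσ hσ) (dq0 A σ 1 s) (dq0 A σ 1 s)
      + 4 * dq0 A σ 2 s t * pairing (dσ hσ) (q0 A σ s) (q0 A σ s)

/-- The second member of the Painlevé II hierarchy (up to the sign of `s`), at the point `s`:
`q'''' = ε s q + 10 q (q')² + 10 q² q'' - 6 q⁵`. -/
def PainleveIISecondMemberAt (ε : ℝ) (q : ℝ → ℝ) (s : ℝ) : Prop :=
  iteratedDeriv 4 q s =
    ε * s * q s + 10 * q s * (iteratedDeriv 1 q s) ^ 2 + 10 * (q s) ^ 2 * iteratedDeriv 2 q s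
      - 6 * (q s) ^ 5

/-- The local size of `A` to the right of `x`: the norm of `A` in `L²(x,∞)`. -/
def tailNorm (A : ℝ → ℝ) (x : ℝ) : ℝ := Real.sqrt (∫ y, (A (x + y)) ^ 2 ∂halfLine)

/-- The boundary condition: for fixed `t`, as `s → +∞`, `A(s+t)` is the leading term of `q₀(t)`,
with an error which is small compared with the local size of `A`. (A relative error would make no
sense at the zeros of `A`, if `A` oscillates.) -/
def BoundaryBehaviour (A σ : ℝ → ℝ) : Prop :=
  ∀ t : ℝ, (fun s => q0 A σ s t - A (s + t)) =o[atTop] (fun s => tailNorm A (s + t))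

end PainleveHierarchy

end

namespace PainleveHierarchy

/-! ### Iterated derivatives along a chain of derivatives -/

/-! Put `G = L²(σ(r) dr)` and let `w(x) ∈ G` be the translate `A(· + x)`. Then `K₂(x,y) = ⟨w(s+x),
w(s+y)⟩`, so `K₂ = W W*` with `W g = ⟨w(s+·), g⟩` (`curveAdj`, with adjoint `curveB`). Interchanging
the factors replaces `K₂` by `K(s) = W* W = ∫_s^∞ w ⊗ w dx` (`curveOp`) on the fixed space `G`.
There `s` enters only through an endpoint, so `K' = -w(s) ⊗ w(s)` has rank one.

With `R = (1 - K)⁻¹`, `u_ij = ⟨w_i, R w_j⟩`, `m = ∫_s^∞ A(t+x) w(x) dx` and `q_j = A^{(j)}(t+s) +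
⟨m, R w_j⟩`, one gets the closed system `q_j' = q_{j+1} - u_{0j} q_0`, `u_ij' = u_{i+1,j} +
u_{i,j+1} - u_{0i} u_{0j}` (`resolventSystem_curve`), and `q_0` is the function of the theorem. Four
differentiations express `q_0''''` through the `q_j` and `u_ij`. Two facts turn this into the
equation. First, the Airy equation gives `q_4 = ε(s+t) q_0 + q_3 u_00 - q_2 u_01 + q_1 u_02 - q_0
u_03` (`curveQ_four`). Secondly, `t ↦ q_j(t)`, as an element of `G`, is `R w_j` (`coeFn_curveRes`),
and integrating by parts in `σ` and then along the curve gives `(q_iᵀ σ' q_j) = -u_ij'`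
(`pairing_airyQ`). The rest is a polynomial identity (`secondMember_algebra`).

As `s → +∞`, `‖K₂‖` and the resolvent column tend to `0`, and Cauchy–Schwarz bounds `q_0 - A` by the
tail norm of `A`. For `ε = 1` a decaying solution is eventually monotone of one sign and its tail
norm is `O(|A|)` (`positiveAiry_tail`), whence the equivalence.

For `Ai₅`, moving the contour makes every derivative `O(e^{-δx})` on the whole line for every `δ >
0`, which yields the Hilbert–Schmidt condition. Since `K` is compact, invertibility only requires
excluding the eigenvalue `1`. If `K g = g` and `f = W g`, then `g(r) = b(r) = ∫ Ai₅(r+s+y) f(y) dy`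
and `‖f‖² = ∫ σ b²`. But `Ai₅` is the Fourier transform of a unimodular function, so `∫ b² ≤ ‖f‖²`
(`lintegral_inner_le`). Hence `b = 0` where `σ < 1`, in particular near `-∞`, and `b` extends to an
entire function, so `b = 0`. -/

theorem iteratedDeriv_eqOn_of_hasDerivAt_chain {U : Set ℝ} (hU : IsOpen U) (P : ℕ → ℝ → ℝ) (n : ℕ)
    (hP : ∀ k < n, ∀ s ∈ U, HasDerivAt (P k) (P (k + 1) s) s) :
    ∀ k ≤ n, EqOn (iteratedDeriv k (P 0)) (P k) U := by
  intro k
  induction k with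
  | zero => intro _ s _; simp
  | succ k ih =>
    intro hk s hs
    have h1 : iteratedDeriv k (P 0) =ᶠ[𝓝 s] P k :=
      (ih (by omega)).eventuallyEq_of_mem (hU.mem_nhds hs)
    rw [iteratedDeriv_succ, h1.deriv_eq]
    exact (hP k (by omega) s hs).deriv

theorem contDiffOn_of_hasDerivAt_chain {U : Set ℝ} (hU : IsOpen U) (n : ℕ) (P : ℕ → ℝ → ℝ)
    (hP : ∀ k < n, ∀ s ∈ U, HasDerivAt (P k) (P (k + 1) s) s) (hc : ContinuousOn (P n) U) :
    ContDiffOn ℝ n (P 0) U := by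
  induction n generalizing P with
  | zero => simpa using hc
  | succ n ih =>
    have h := ih (fun k => P (k + 1)) (fun k hk => hP (k + 1) (by omega)) hc
    have hcast : ((n + 1 : ℕ) : WithTop ℕ∞) = (n : WithTop ℕ∞) + 1 := by push_cast; rfl
    rw [hcast, contDiffOn_succ_iff_deriv_of_isOpen hU]
    refine ⟨fun s hs => (hP 0 (by omega) s hs).differentiableAt.differentiableWithinAt,
      by simp, ?_⟩
    exact h.congr fun s hs => (hP 0 (by omega) s hs).deriv

/-! ### The closed system for `q` and `u` -/

/-- The functions `q j` and `u i j` satisfy the differential system of the resolvent on `U`. -/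
structure ResolventSystem (q : ℕ → ℝ → ℝ) (u : ℕ → ℕ → ℝ → ℝ) (U : Set ℝ) : Prop where
  hq : ∀ j, ∀ s ∈ U, HasDerivAt (q j) (q (j + 1) s - u 0 j s * q 0 s) s
  hu : ∀ i j, ∀ s ∈ U,
    HasDerivAt (u i j) (u (i + 1) j s + u i (j + 1) s - u i 0 s * u 0 j s) s
  symm : ∀ i j s, u i j s = u j i s

/-- The first four derivatives of `q 0` along a `ResolventSystem`. -/
def resolventDeriv (q : ℕ → ℝ → ℝ) (u : ℕ → ℕ → ℝ → ℝ) : ℕ → ℝ → ℝ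
  | 0, s => q 0 s
  | 1, s => q 1 s - u 0 0 s * q 0 s
  | 2, s => q 2 s - u 0 0 s * q 1 s + (2 * u 0 0 s ^ 2 - 3 * u 0 1 s) * q 0 s
  | 3, s => q 3 s - u 0 0 s * q 2 s + (3 * u 0 0 s ^ 2 - 5 * u 0 1 s) * q 1 s
      + (15 * (u 0 0 s * u 0 1 s) - 6 * u 0 0 s ^ 3 - 4 * u 0 2 s - 3 * u 1 1 s) * q 0 s
  | _, s => q 4 s - u 0 3 s * q 0 s - (2 * u 0 1 s - u 0 0 s ^ 2) * q 2 s
      - u 0 0 s * (q 3 s - u 0 2 s * q 0 s)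
      + (6 * u 0 0 s * (2 * u 0 1 s - u 0 0 s ^ 2)
          - 5 * (u 1 1 s + u 0 2 s - u 0 0 s * u 0 1 s)) * q 1 s
      + (3 * u 0 0 s ^ 2 - 5 * u 0 1 s) * (q 2 s - u 0 1 s * q 0 s)
      + (15 * ((2 * u 0 1 s - u 0 0 s ^ 2) * u 0 1 s
            + u 0 0 s * (u 1 1 s + u 0 2 s - u 0 0 s * u 0 1 s))
          - 18 * u 0 0 s ^ 2 * (2 * u 0 1 s - u 0 0 s ^ 2)
          - 4 * (u 1 2 s + u 0 3 s - u 0 0 s * u 0 2 s) - 3 * (2 * u 1 2 s - u 0 1 s ^ 2)) * q 0 s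
      + (15 * (u 0 0 s * u 0 1 s) - 6 * u 0 0 s ^ 3 - 4 * u 0 2 s - 3 * u 1 1 s)
        * (q 1 s - u 0 0 s * q 0 s)

namespace ResolventSystem

variable {q : ℕ → ℝ → ℝ} {u : ℕ → ℕ → ℝ → ℝ} {U : Set ℝ}

theorem hasDerivAt_resolventDeriv (h : ResolventSystem q u U) (k : ℕ) (hk : k < 4) (s : ℝ)
    (hs : s ∈ U) :
    HasDerivAt (resolventDeriv q u k) (resolventDeriv q u (k + 1) s) s := by
  have q0 := h.hq 0 s hs
  have q1 := h.hq 1 s hs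
  have q2 := h.hq 2 s hs
  have q3 := h.hq 3 s hs
  have u00 := h.hu 0 0 s hs
  have u01 := h.hu 0 1 s hs
  have u02 := h.hu 0 2 s hs
  have u11 := h.hu 1 1 s hs
  have e10 := h.symm 1 0 s
  have e20 := h.symm 2 0 s
  have e21 := h.symm 2 1 s
  norm_num at q0 q1 q2 q3 u00 u01 u02 u11
  interval_cases k
  · refine q0.congr_deriv ?_
    simp only [resolventDeriv]
  · refine (q1.sub (u00.mul q0)).congr_deriv ?_
    simp only [resolventDeriv, e10]
    ring
  · refine ((q2.sub (u00.mul q1)).add ((((u00.pow 2).const_mul 2).sub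
      (u01.const_mul 3)).mul q0)).congr_deriv ?_
    simp only [resolventDeriv, e10]
    norm_num
    ring
  · refine (((q3.sub (u00.mul q2)).add ((((u00.pow 2).const_mul 3).sub
      (u01.const_mul 5)).mul q1)).add ((((((u00.mul u01).const_mul 15).sub
      ((u00.pow 3).const_mul 6)).sub (u02.const_mul 4)).sub (u11.const_mul 3)).mul
        q0)).congr_deriv ?_
    simp only [resolventDeriv, e10, e21]
    norm_num
    ring

theorem iteratedDeriv_eq (h : ResolventSystem q u U) (hU : IsOpen U) {k : ℕ} (hk : k ≤ 4) {s : ℝ}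
    (hs : s ∈ U) : iteratedDeriv k (q 0) s = resolventDeriv q u k s :=
  iteratedDeriv_eqOn_of_hasDerivAt_chain hU (resolventDeriv q u) 4
    (fun k hk s hs => h.hasDerivAt_resolventDeriv k hk s hs) k hk hs

theorem contDiffAt (h : ResolventSystem q u U) (hU : IsOpen U) {s : ℝ} (hs : s ∈ U) :
    ContDiffAt ℝ 4 (q 0) s := by
  have hq : ∀ j, ContinuousOn (q j) U := fun j s hs => (h.hq j s hs).continuousAt.continuousWithinAt
  have hu : ∀ i j, ContinuousOn (u i j) U :=
    fun i j s hs => (h.hu i j s hs).continuousAt.continuousWithinAt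
  refine (contDiffOn_of_hasDerivAt_chain hU 4 (resolventDeriv q u)
    (fun k hk s hs => h.hasDerivAt_resolventDeriv k hk s hs) ?_).contDiffAt (hU.mem_nhds hs)
  have q0 := hq 0
  have q1 := hq 1
  have q2 := hq 2
  have q3 := hq 3
  have q4 := hq 4
  have u00 := hu 0 0
  have u01 := hu 0 1
  have u02 := hu 0 2
  have u03 := hu 0 3
  have u11 := hu 1 1
  have u12 := hu 1 2
  unfold resolventDeriv
  fun_prop

end ResolventSystem

/-- The second member of the hierarchy, as an algebraic consequence of the quartic relation and of
the values `p i j` of the pairings of `q i` and `q j`. -/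
theorem secondMember_algebra {q : ℕ → ℝ → ℝ} {u : ℕ → ℕ → ℝ → ℝ} {s c p00 p01 p02 p11 : ℝ}
    (h4 : q 4 s = c * q 0 s + q 3 s * u 0 0 s - q 2 s * u 0 1 s + q 1 s * u 0 2 s - q 0 s * u 0 3 s)
    (h00 : p00 = -(2 * u 0 1 s - u 0 0 s ^ 2))
    (h01 : p01 = -(u 1 1 s + u 0 2 s - u 0 0 s * u 0 1 s))
    (h02 : p02 = -(u 1 2 s + u 0 3 s - u 0 0 s * u 0 2 s))
    (h11 : p11 = -(2 * u 1 2 s - u 0 1 s ^ 2)) :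
    resolventDeriv q u 4 s = c * resolventDeriv q u 0 s
      + 8 * resolventDeriv q u 1 s * (p01 - u 0 0 s * p00)
      + 6 * resolventDeriv q u 0 s * (p02 - u 0 0 s * p01
          + (2 * u 0 0 s ^ 2 - 3 * u 0 1 s) * p00)
      - 6 * resolventDeriv q u 0 s * p00 ^ 2
      + 2 * resolventDeriv q u 0 s * (p11 - 2 * u 0 0 s * p01 + u 0 0 s ^ 2 * p00)
      + 4 * resolventDeriv q u 2 s * p00 := by
  -- The brackets in the goal are the pairings of `q_0`, `q_0'`, `q_0''`, expanded by bilinearity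
  -- from `q_0' = q_1 - u_00 q_0` and the analogous formula for `q_0''`.
  simp only [resolventDeriv, h4, h00, h01, h02, h11]
  ring

end PainleveHierarchy

/-! ### Square integrable curves in a Hilbert space -/

namespace PainleveHierarchy

theorem hasDerivAt_integral_Ioi {E : Type*} [NormedAddCommGroup E] [NormedSpace ℝ E]
    [CompleteSpace E] {F : ℝ → E} (hF : Continuous F) (hi : ∀ s, IntegrableOn F (Ioi s)) (s : ℝ) :
    HasDerivAt (fun s => ∫ x in Ioi s, F x) (-F s) s := by
  have h1 : (fun s' => ∫ x in Ioi s', F x) =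
      fun s' => (∫ x in Ioi s, F x) - ∫ x in s..s', F x := by
    funext s'
    rw [← intervalIntegral.integral_Ioi_sub_Ioi' (hi s) (hi s')]
    abel
  rw [h1]
  have h2 := intervalIntegral.integral_hasDerivAt_right (hF.intervalIntegrable s s)
    (hF.stronglyMeasurableAtFilter _ _) hF.continuousAt
  exact h2.const_sub _

theorem integral_Ioi_eq_halfLine {E : Type*} [NormedAddCommGroup E] [NormedSpace ℝ E]
    (F : ℝ → E) (s : ℝ) : ∫ x in Ioi s, F x = ∫ y, F (s + y) ∂halfLine := by
  have h := (measurePreserving_add_left (volume : Measure ℝ) s).setIntegral_preimage_emb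
    (measurableEmbedding_addLeft s) F (Ioi s)
  rw [← h]
  simp [Set.preimage_const_add_Ioi]

theorem integrableOn_Ioi_iff_halfLine {E : Type*} [NormedAddCommGroup E]
    (F : ℝ → E) (s : ℝ) :
    IntegrableOn F (Ioi s) ↔ Integrable (fun y => F (s + y)) halfLine := by
  have h := (measurePreserving_add_left (volume : Measure ℝ) s).integrableOn_comp_preimage
    (measurableEmbedding_addLeft s) (f := F) (s := Ioi s)
  rw [← h]
  simp [Set.preimage_const_add_Ioi, IntegrableOn, Function.comp_def]

/-- A smooth curve `w 0` (with derivatives `w j`), all of whose derivatives are square integrable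
at `+∞`. -/
structure DecayingCurve {E : Type*} [NormedAddCommGroup E] [InnerProductSpace ℝ E]
    (w : ℕ → ℝ → E) : Prop where
  hasDerivAt : ∀ j x, HasDerivAt (w j) (w (j + 1) x) x
  sq_integrable : ∀ j s, IntegrableOn (fun x => ‖w j x‖ ^ 2) (Ioi s)

namespace DecayingCurve

variable {E F : Type*} [NormedAddCommGroup E] [InnerProductSpace ℝ E]
  [NormedAddCommGroup F] [InnerProductSpace ℝ F]
  {w : ℕ → ℝ → E} {v : ℕ → ℝ → F}

theorem continuous (h : DecayingCurve w) (j : ℕ) : Continuous (w j) :=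
  continuous_iff_continuousAt.2 fun x => (h.hasDerivAt j x).continuousAt

/-- By `ab ≤ a² + b²`, anything dominated by a product of two decaying curves is integrable at `+∞`;
this covers rank-one operators, inner products and scalar multiples at once. -/
theorem integrableOn_of_norm_le {X : Type*} [NormedAddCommGroup X] (h : DecayingCurve w)
    (h' : DecayingCurve v) (i j : ℕ) (s : ℝ) {f : ℝ → X} (hf : Continuous f) {C : ℝ}
    (hle : ∀ x, ‖f x‖ ≤ C * (‖w i x‖ * ‖v j x‖)) : IntegrableOn f (Ioi s) := by
  refine Integrable.mono' (((h.sq_integrable i s).add (h'.sq_integrable j s)).const_mul |C|)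
    hf.aestronglyMeasurable (ae_of_all _ fun x => (hle x).trans ?_)
  have h1 : ‖w i x‖ * ‖v j x‖ ≤ ‖w i x‖ ^ 2 + ‖v j x‖ ^ 2 := by
    nlinarith [sq_nonneg (‖w i x‖ - ‖v j x‖), sq_nonneg (‖w i x‖), sq_nonneg (‖v j x‖)]
  calc C * (‖w i x‖ * ‖v j x‖) ≤ |C| * (‖w i x‖ * ‖v j x‖) := by
        gcongr; exact le_abs_self C
    _ ≤ |C| * (‖w i x‖ ^ 2 + ‖v j x‖ ^ 2) := by gcongr
    _ = _ := by simp

/-- Both `‖w_j‖²` and its derivative `2⟨w_j, w_{j+1}⟩` are integrable at `+∞`. -/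
theorem tendsto_zero (h : DecayingCurve w) (j : ℕ) : Tendsto (w j) atTop (𝓝 0) := by
  have h1 : Tendsto (fun x => ‖w j x‖ ^ 2) atTop (𝓝 0) := by
    refine tendsto_zero_of_hasDerivAt_of_integrableOn_Ioi (a := 0)
      (f' := fun x => 2 * inner ℝ (w j x) (w (j + 1) x)) (fun x _ => ?_) ?_
      (h.sq_integrable j 0)
    · have := (h.hasDerivAt j x).inner ℝ (h.hasDerivAt j x)
      simp only [real_inner_self_eq_norm_sq] at this
      refine this.congr_deriv ?_
      rw [real_inner_comm (w j x) (w (j + 1) x)]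
      ring
    · refine h.integrableOn_of_norm_le h j (j + 1) 0 (C := 2) ?_ fun x => ?_
      · exact continuous_const.mul ((h.continuous _).inner (h.continuous _))
      · rw [norm_mul]
        simpa using norm_inner_le_norm (𝕜 := ℝ) (w j x) (w (j + 1) x)
  rw [tendsto_zero_iff_norm_tendsto_zero]
  have h2 := h1.sqrt
  simpa [Real.sqrt_sq] using h2

theorem continuous_rankOne (h : DecayingCurve w) (h' : DecayingCurve v) (i j : ℕ) :
    Continuous fun x => InnerProductSpace.rankOne ℝ (w i x) (v j x) :=
  ((InnerProductSpace.rankOne ℝ).continuous.comp (h.continuous i)).clm_apply (h'.continuous j)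

theorem integrableOn_rankOne (h : DecayingCurve w) (h' : DecayingCurve v) (i j : ℕ) (s : ℝ) :
    IntegrableOn (fun x => InnerProductSpace.rankOne ℝ (w i x) (v j x)) (Ioi s) :=
  h.integrableOn_of_norm_le h' i j s (h.continuous_rankOne h' i j) (C := 1) fun x => by simp

theorem integrableOn_smul {α : ℕ → ℝ → ℝ} (hα : DecayingCurve α) (h : DecayingCurve w) (i j : ℕ)
    (s : ℝ) : IntegrableOn (fun x => α i x • w j x) (Ioi s) :=
  hα.integrableOn_of_norm_le h i j s ((hα.continuous i).smul (h.continuous j)) (C := 1)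
    fun x => by simp [norm_smul]

/-- The boundary terms produced by integrating `v₄ ⟨w₀, f⟩ - v₀ ⟨w₄, f⟩`. -/
def boundaryForm (w : ℕ → ℝ → E) (v : ℕ → ℝ → F) (f : E) (x : ℝ) : F :=
  inner ℝ (w 0 x) f • v 3 x - inner ℝ (w 1 x) f • v 2 x + inner ℝ (w 2 x) f • v 1 x
    - inner ℝ (w 3 x) f • v 0 x

/-- Lagrange's identity for the fourth derivative: on differentiating the alternating sum, all the
intermediate terms cancel in pairs. -/
theorem integral_boundaryForm [CompleteSpace F] (h : DecayingCurve w) (h' : DecayingCurve v)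
    (f : E) (a b : ℝ) :
    ∫ x in a..b, (inner ℝ (w 0 x) f • v 4 x - inner ℝ (w 4 x) f • v 0 x) =
      boundaryForm w v f b - boundaryForm w v f a := by
  have hd : ∀ j x, HasDerivAt (fun x => inner ℝ (w j x) f) (inner ℝ (w (j + 1) x) f) x := by
    intro j x
    simpa using (h.hasDerivAt j x).inner ℝ (hasDerivAt_const x f)
  have hc : ∀ j, Continuous fun x => inner ℝ (w j x) f :=
    fun j => (h.continuous j).inner continuous_const
  refine intervalIntegral.integral_eq_sub_of_hasDerivAt (fun x _ => ?_) ?_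
  · refine (((((hd 0 x).smul (h'.hasDerivAt 3 x)).sub ((hd 1 x).smul (h'.hasDerivAt 2 x))).add
      ((hd 2 x).smul (h'.hasDerivAt 1 x))).sub ((hd 3 x).smul (h'.hasDerivAt 0 x))).congr_deriv ?_
    norm_num
    abel
  · exact (((hc 0).smul (h'.continuous 4)).sub
      ((hc 4).smul (h'.continuous 0))).intervalIntegrable _ _

end DecayingCurve

/-! ### The resolvent along a curve -/

section Resolvent

variable {G : Type*} [NormedAddCommGroup G] [InnerProductSpace ℝ G]

/-- The operator `∫_s^∞ w(x) ⊗ w(x) dx`. -/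
noncomputable def curveOp (w : ℕ → ℝ → G) (s : ℝ) : G →L[ℝ] G :=
  ∫ x in Ioi s, InnerProductSpace.rankOne ℝ (w 0 x) (w 0 x)

/-- The resolvent `(1 - ∫_s^∞ w(x) ⊗ w(x) dx)⁻¹`. -/
noncomputable def curveRes (w : ℕ → ℝ → G) (s : ℝ) : G →L[ℝ] G := Ring.inverse (1 - curveOp w s)

/-- The matrix elements `⟨w_i, (1 - K)⁻¹ w_j⟩`. -/
noncomputable def curveU (w : ℕ → ℝ → G) (i j : ℕ) (s : ℝ) : ℝ := inner ℝ (w i s) (curveRes w s (w j s))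

/-- The vector `∫_s^∞ α(x) w(x) dx`. -/
noncomputable def curveM (α : ℕ → ℝ → ℝ) (w : ℕ → ℝ → G) (s : ℝ) : G := ∫ x in Ioi s, α 0 x • w 0 x

/-- The functions `α_j + ⟨m, (1 - K)⁻¹ w_j⟩`. -/
noncomputable def curveQ (α : ℕ → ℝ → ℝ) (w : ℕ → ℝ → G) (j : ℕ) (s : ℝ) : ℝ :=
  α j s + inner ℝ (curveM α w s) (curveRes w s (w j s))

variable {w : ℕ → ℝ → G} {α : ℕ → ℝ → ℝ}

theorem curveOp_apply (h : DecayingCurve w) (s : ℝ) (f : G) :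
    curveOp w s f = ∫ x in Ioi s, inner ℝ (w 0 x) f • w 0 x := by
  rw [curveOp, ContinuousLinearMap.integral_apply (h.integrableOn_rankOne h 0 0 s)]
  simp

theorem inner_ringInverse_one_sub {T : G →L[ℝ] G} (hT : ∀ f g, inner ℝ (T f) g = inner ℝ f (T g))
    (f g : G) : inner ℝ (Ring.inverse (1 - T) f) g = inner ℝ f (Ring.inverse (1 - T) g) := by
  by_cases hu : IsUnit (1 - T)
  · have h1 : ∀ f, f = Ring.inverse (1 - T) f - T (Ring.inverse (1 - T) f) := by
      intro f
      have := congrArg (fun S : G →L[ℝ] G => S f) (Ring.mul_inverse_cancel _ hu)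
      simpa using this.symm
    set a := Ring.inverse (1 - T) f with ha
    set b := Ring.inverse (1 - T) g with hb
    rw [h1 f, h1 g, ← ha, ← hb, inner_sub_left, inner_sub_right, hT]
  · simp [Ring.inverse_non_unit _ hu]

variable [CompleteSpace G]

/-- Only the lower endpoint depends on `s`, so the derivative has rank one. This is what makes the
system for `q` and `u` close up. -/
theorem hasDerivAt_curveOp (h : DecayingCurve w) (s : ℝ) :
    HasDerivAt (curveOp w) (-InnerProductSpace.rankOne ℝ (w 0 s) (w 0 s)) s :=
  hasDerivAt_integral_Ioi (h.continuous_rankOne h 0 0) (h.integrableOn_rankOne h 0 0) s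

theorem isOpen_isUnit_curveOp (h : DecayingCurve w) : IsOpen {s | IsUnit (1 - curveOp w s)} := by
  have hc : Continuous fun s => 1 - curveOp w s :=
    continuous_const.sub (continuous_iff_continuousAt.2 fun s => (hasDerivAt_curveOp h s).continuousAt)
  exact Units.isOpen.preimage hc

theorem hasDerivAt_curveRes (h : DecayingCurve w) {s : ℝ} (hs : IsUnit (1 - curveOp w s)) :
    HasDerivAt (curveRes w)
      (-(curveRes w s * InnerProductSpace.rankOne ℝ (w 0 s) (w 0 s) * curveRes w s)) s := by
  obtain ⟨x, hx⟩ := hs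
  have h1 : HasDerivAt (fun s => 1 - curveOp w s) (InnerProductSpace.rankOne ℝ (w 0 s) (w 0 s)) s := by
    simpa using (hasDerivAt_curveOp h s).const_sub 1
  have h2 := hasFDerivAt_ringInverse (𝕜 := ℝ) x
  rw [hx] at h2
  refine (h2.comp_hasDerivAt s h1).congr_deriv ?_
  have : curveRes w s = ↑x⁻¹ := by rw [curveRes, ← hx, Ring.inverse_unit]
  simp [this, mul_assoc]

theorem inner_curveOp_left (h : DecayingCurve w) (s : ℝ) (f g : G) :
    inner ℝ (curveOp w s f) g = inner ℝ f (curveOp w s g) := by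
  have hi : ∀ f, IntegrableOn (fun x => inner ℝ (w 0 x) f • w 0 x) (Ioi s) := fun f =>
    (h.integrableOn_rankOne h 0 0 s).apply_continuousLinearMap f
  rw [curveOp_apply h, curveOp_apply h, ← integral_inner (hi g) f, real_inner_comm,
    ← integral_inner (hi f) g]
  refine integral_congr_ae (ae_of_all _ fun x => ?_)
  simp [real_inner_smul_right, real_inner_comm]
  ring

theorem inner_curveRes_left (h : DecayingCurve w) (s : ℝ) (f g : G) :
    inner ℝ (curveRes w s f) g = inner ℝ f (curveRes w s g) :=
  inner_ringInverse_one_sub (inner_curveOp_left h s) f g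

theorem hasDerivAt_curveRes_apply (h : DecayingCurve w) {s : ℝ} (hs : IsUnit (1 - curveOp w s))
    (j : ℕ) : HasDerivAt (fun s => curveRes w s (w j s))
      (curveRes w s (w (j + 1) s) - curveU w 0 j s • curveRes w s (w 0 s)) s := by
  refine ((hasDerivAt_curveRes h hs).clm_apply (h.hasDerivAt j s)).congr_deriv ?_
  simp [curveU]
  abel

/-- Differentiating `R` contributes `-u_{0j} ⟨m, R w_0⟩` to `q_j'` and differentiating `m`
contributes `-α_0 u_{0j}`; together they form `-u_{0j} q_0`. -/
theorem resolventSystem_curve (hα : DecayingCurve α) (h : DecayingCurve w) :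
    ResolventSystem (curveQ α w) (curveU w) {s | IsUnit (1 - curveOp w s)} where
  hq j s hs := by
    have hm : HasDerivAt (curveM α w) (-(α 0 s • w 0 s)) s :=
      hasDerivAt_integral_Ioi ((hα.continuous 0).smul (h.continuous 0))
        (hα.integrableOn_smul h 0 0) s
    refine ((hα.hasDerivAt j s).add
      (hm.inner ℝ (hasDerivAt_curveRes_apply h hs j))).congr_deriv ?_
    simp only [curveQ, curveU, inner_sub_right, real_inner_smul_right, inner_neg_left,
      real_inner_smul_left]
    ring
  hu i j s hs := by
    refine ((h.hasDerivAt i s).inner ℝ (hasDerivAt_curveRes_apply h hs j)).congr_deriv ?_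
    simp only [curveU, inner_sub_right, real_inner_smul_right]
    ring
  symm i j s := by
    rw [curveU, curveU, ← inner_curveRes_left h, real_inner_comm]

/-- The relation between `q 4` and `q 0`, up to boundary terms at `L`, when `∫_s^∞` is truncated
to `∫_s^L`. -/
theorem truncated_quartic (hα : DecayingCurve α) (h : DecayingCurve w) {ε t s L : ℝ}
    (hα4 : ∀ x, α 4 x = ε * (t + x) * α 0 x)
    (hw4 : ∀ x y, inner ℝ (w 0 x) (w 4 y) - ε * y * inner ℝ (w 0 x) (w 0 y) =
      inner ℝ (w 4 x) (w 0 y) - ε * x * inner ℝ (w 0 x) (w 0 y))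
    {T R : G →L[ℝ] G} {m f : G}
    (hT : T = ∫ x in s..L, InnerProductSpace.rankOne ℝ (w 0 x) (w 0 x))
    (hR1 : R * (1 - T) = 1) (hR2 : (1 - T) * R = 1) (hm : m = ∫ x in s..L, α 0 x • w 0 x)
    (hf : f = R (w 0 s)) :
    α 4 s + inner ℝ m (R (w 4 s)) = ε * (t + s) * (α 0 s + inner ℝ m f)
      + (DecayingCurve.boundaryForm w α f s + inner ℝ m (R (DecayingCurve.boundaryForm w w f s)))
      - (DecayingCurve.boundaryForm w α f L + inner ℝ m (R (DecayingCurve.boundaryForm w w f L))) := by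
  have hw := h.continuous
  have hα' := hα.continuous
  have hTa : ∀ g, T g = ∫ x in s..L, inner ℝ (w 0 x) g • w 0 x := by
    intro g
    rw [hT, ContinuousLinearMap.intervalIntegral_apply]
    · simp
    · exact (h.continuous_rankOne h 0 0).intervalIntegrable _ _
  have hfT : f = w 0 s + T f := by
    have := congrArg (fun S : G →L[ℝ] G => S (w 0 s)) hR2
    simp only [mul_apply_eq_comp, sub_apply,
      one_apply_eq_self] at this
    rw [← hf] at this
    exact (sub_eq_iff_eq_add.1 this)
  have hin : ∀ (y : G) (F : ℝ → G), Continuous F →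
      inner ℝ y (∫ x in s..L, F x) = ∫ x in s..L, inner ℝ y (F x) := by
    intro y F hF
    exact ((innerSL ℝ y).intervalIntegral_comp_comm (hF.intervalIntegrable s L)).symm
  -- In the application `w 4 x - ε x • w 0 x` is multiplication by `ε r` applied to `w 0 x`, and
  -- `hw4` is the symmetry of that operator `M`. So `z x` plays the role of `(M + ε s) w 0 x`, and
  -- `g` below that of `(M + ε s) f`, without any unbounded operator. The factor `x - s` multiplying
  -- `w 0` has no integrability assumption at `+∞`, hence the truncation at `L`.
  let z : ℝ → G := fun x => w 4 x - (ε * (x - s)) • w 0 x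
  have hz : Continuous z := by fun_prop
  set g : G := w 4 s + ∫ x in s..L, inner ℝ (w 0 x) f • z x with hg
  have hzf : Continuous fun x => inner ℝ (w 0 x) f • z x := by fun_prop
  have hkey : ∀ x, inner ℝ (w 0 x) g = inner ℝ (z x) f := by
    intro x
    have hr : inner ℝ (z x) f = inner ℝ (z x) (w 0 s) + inner ℝ (z x) (T f) := by
      conv_lhs => rw [hfT]
      rw [inner_add_right]
    rw [hr, hg, inner_add_right, hin _ _ hzf, hTa, hin _ _ (by fun_prop)]
    congr 1
    · simp only [z, inner_sub_left, real_inner_smul_left]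
      linear_combination hw4 x s
    · refine intervalIntegral.integral_congr fun y _ => ?_
      simp only [z, inner_sub_left, inner_sub_right, real_inner_smul_left, real_inner_smul_right]
      linear_combination (inner ℝ (w 0 y) f) * hw4 x y
  -- By `hkey` the terms in `ε (x - s)` cancel, and what remains is the Lagrange integrand of `w`
  -- with itself. So `g` solves `(1 - T) g = w 4 s` up to boundary terms.
  have hgT : g - T g = w 4 s + (DecayingCurve.boundaryForm w w f L
      - DecayingCurve.boundaryForm w w f s) := by
    rw [← h.integral_boundaryForm h, hTa g, hg, add_sub_assoc, ← hg,
      ← intervalIntegral.integral_sub (hzf.intervalIntegrable _ _)]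
    · congr 1
      refine intervalIntegral.integral_congr fun x _ => ?_
      simp only [hkey]
      simp only [z, inner_sub_left, real_inner_smul_left]
      module
    · exact Continuous.intervalIntegrable (by fun_prop) _ _
  have hRg : R (w 4 s) = g + R (DecayingCurve.boundaryForm w w f s)
      - R (DecayingCurve.boundaryForm w w f L) := by
    have := congrArg (fun S : G →L[ℝ] G => S g) hR1
    simp only [mul_apply_eq_comp, sub_apply,
      one_apply_eq_self] at this
    rw [hgT, map_add, map_sub] at this
    rw [← this]
    abel
  -- The same cancellation against `α`: the shifts `x - s` and `t + s` add up to the factor `t + x`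
  -- in the equation of `α`.
  have hmg : inner ℝ m g - ε * (t + s) * inner ℝ m f =
      -(DecayingCurve.boundaryForm w α f L - DecayingCurve.boundaryForm w α f s) := by
    rw [← h.integral_boundaryForm hα, hm, real_inner_comm, hin _ _ (by fun_prop),
      real_inner_comm, hin _ _ (by fun_prop), ← intervalIntegral.integral_const_mul,
      ← intervalIntegral.integral_sub, ← intervalIntegral.integral_neg]
    · refine intervalIntegral.integral_congr fun x _ => ?_
      simp only [hα4, smul_eq_mul]
      rw [real_inner_comm, real_inner_smul_left, hkey, real_inner_smul_right,
        real_inner_comm (w 0 x) f]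
      simp only [z, inner_sub_left, real_inner_smul_left]
      ring
    · exact Continuous.intervalIntegrable (by fun_prop) _ _
    · exact Continuous.intervalIntegrable (by fun_prop) _ _
  rw [hRg, inner_sub_right, inner_add_right, hα4 s]
  linear_combination hmg

theorem tendsto_boundaryForm {E X : Type*} [NormedAddCommGroup E] [InnerProductSpace ℝ E]
    [NormedAddCommGroup X] [InnerProductSpace ℝ X] {w : ℕ → ℝ → E} {v : ℕ → ℝ → X}
    (h : DecayingCurve w) (h' : DecayingCurve v) {F : ℝ → E} {f : E}
    (hF : Tendsto F atTop (𝓝 f)) :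
    Tendsto (fun L => DecayingCurve.boundaryForm w v (F L) L) atTop (𝓝 0) := by
  have hw : ∀ j, Tendsto (fun L => inner ℝ (w j L) (F L)) atTop (𝓝 0) := fun j => by
    simpa using (h.tendsto_zero j).inner hF
  have := ((((hw 0).smul (h'.tendsto_zero 3)).sub ((hw 1).smul (h'.tendsto_zero 2))).add
      ((hw 2).smul (h'.tendsto_zero 1))).sub ((hw 3).smul (h'.tendsto_zero 0))
  simpa [DecayingCurve.boundaryForm] using this

theorem tendsto_boundaryForm_const {E X : Type*} [NormedAddCommGroup E] [InnerProductSpace ℝ E]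
    [NormedAddCommGroup X] [InnerProductSpace ℝ X] {w : ℕ → ℝ → E} {v : ℕ → ℝ → X} (x : ℝ)
    {F : ℝ → E} {f : E} (hF : Tendsto F atTop (𝓝 f)) :
    Tendsto (fun L => DecayingCurve.boundaryForm w v (F L) x) atTop
      (𝓝 (DecayingCurve.boundaryForm w v f x)) := by
  have hw : ∀ j, Tendsto (fun L => inner ℝ (w j x) (F L)) atTop (𝓝 (inner ℝ (w j x) f)) :=
    fun j => tendsto_const_nhds.inner hF
  exact ((((hw 0).smul_const _).sub ((hw 1).smul_const _)).add ((hw 2).smul_const _)).sub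
    ((hw 3).smul_const _)

/-- Let `L → ∞` in `truncated_quartic`. The boundary terms at `L` disappear, while those at `s`,
with `f = R w_0`, have coefficients `⟨w_k, R w_0⟩ = u_{0k}` and assemble into the alternating sum of
the `q_{3-k} u_{0k}`. -/
theorem curveQ_four (hα : DecayingCurve α) (h : DecayingCurve w) {ε t s : ℝ}
    (hα4 : ∀ x, α 4 x = ε * (t + x) * α 0 x)
    (hw4 : ∀ x y, inner ℝ (w 0 x) (w 4 y) - ε * y * inner ℝ (w 0 x) (w 0 y) =
      inner ℝ (w 4 x) (w 0 y) - ε * x * inner ℝ (w 0 x) (w 0 y))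
    (hs : IsUnit (1 - curveOp w s)) :
    curveQ α w 4 s = ε * (t + s) * curveQ α w 0 s + curveQ α w 3 s * curveU w 0 0 s
      - curveQ α w 2 s * curveU w 0 1 s + curveQ α w 1 s * curveU w 0 2 s
      - curveQ α w 0 s * curveU w 0 3 s := by
  let T : ℝ → G →L[ℝ] G := fun L => ∫ x in s..L, InnerProductSpace.rankOne ℝ (w 0 x) (w 0 x)
  let R : ℝ → G →L[ℝ] G := fun L => Ring.inverse (1 - T L)
  let m : ℝ → G := fun L => ∫ x in s..L, α 0 x • w 0 x
  have hT : Tendsto (fun L => 1 - T L) atTop (𝓝 (1 - curveOp w s)) :=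
    (intervalIntegral_tendsto_integral_Ioi s (h.integrableOn_rankOne h 0 0 s)
      tendsto_id).const_sub _
  have hm : Tendsto m atTop (𝓝 (curveM α w s)) :=
    intervalIntegral_tendsto_integral_Ioi s (hα.integrableOn_smul h 0 0 s) tendsto_id
  have hR : Tendsto R atTop (𝓝 (curveRes w s)) := by
    obtain ⟨x, hx⟩ := hs
    rw [curveRes, ← hx]
    rw [← hx] at hT
    exact (NormedRing.inverse_continuousAt x).tendsto.comp hT
  have hRa : ∀ {v : ℝ → G} {v' : G}, Tendsto v atTop (𝓝 v') →
      Tendsto (fun L => R L (v L)) atTop (𝓝 (curveRes w s v')) := fun {v v'} hv =>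
    (isBoundedBilinearMap_apply.continuous.tendsto (curveRes w s, v')).comp (hR.prodMk_nhds hv)
  have hf := hRa (tendsto_const_nhds (x := w 0 s))
  -- The units are open, so the truncated operators are invertible for large `L`, which is all that
  -- the limit requires.
  have hunit : ∀ᶠ L in atTop, IsUnit (1 - T L) := hT.eventually (Units.isOpen.mem_nhds hs)
  have hbs1 := tendsto_boundaryForm_const (w := w) (v := α) s hf
  have hbs2 := tendsto_boundaryForm_const (w := w) (v := w) s hf
  have h1 : Tendsto (fun L => α 4 s + inner ℝ (m L) (R L (w 4 s))) atTop (𝓝 (curveQ α w 4 s)) :=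
    tendsto_const_nhds.add (hm.inner (hRa tendsto_const_nhds))
  have h2 := (((tendsto_const_nhds (x := α 0 s)).add (hm.inner hf)).const_mul
    (ε * (t + s))).add (hbs1.add (hm.inner (hRa hbs2)))
  have h3 := h2.sub ((tendsto_boundaryForm h hα hf).add
    (hm.inner (hRa (tendsto_boundaryForm h h hf))))
  have h4 := tendsto_nhds_unique_of_eventuallyEq h1 h3 (hunit.mono fun L hL =>
    truncated_quartic hα h hα4 hw4 rfl (Ring.inverse_mul_cancel _ hL)
      (Ring.mul_inverse_cancel _ hL) rfl rfl)
  rw [h4]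
  have hsy := (resolventSystem_curve hα h).symm
  simp only [DecayingCurve.boundaryForm, map_add, map_sub, map_smul, inner_add_right,
    inner_sub_right, real_inner_smul_right, curveQ, hsy 0 1, hsy 0 2, hsy 0 3, smul_eq_mul,
    map_zero, inner_zero_right]
  simp only [curveU]
  ring

end Resolvent

end PainleveHierarchy

namespace PainleveHierarchy

/-! ### Swapping the two factors of an operator -/

section Swap

variable {E F : Type*} [NormedAddCommGroup E] [NormedSpace ℝ E] [NormedAddCommGroup F]
  [NormedSpace ℝ F]

theorem isUnit_one_sub_comp_swap (P : E →L[ℝ] F) (Q : F →L[ℝ] E)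
    (h : IsUnit (1 - Q ∘L P : E →L[ℝ] E)) : IsUnit (1 - P ∘L Q : F →L[ℝ] F) := by
  obtain ⟨x, hx⟩ := h
  set R : E →L[ℝ] E := ↑x⁻¹ with hR
  have h1 : ∀ e, R e - Q (P (R e)) = e := fun e => by
    have : (x : E →L[ℝ] E) * R = 1 := x.mul_inv
    rw [hx] at this
    simpa using congrArg (fun S : E →L[ℝ] E => S e) this
  have h2 : ∀ e, R (e - Q (P e)) = e := fun e => by
    have : R * (x : E →L[ℝ] E) = 1 := x.inv_mul
    rw [hx] at this
    simpa using congrArg (fun S : E →L[ℝ] E => S e) this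
  -- The classical formula `(1 - PQ)⁻¹ = 1 + P (1 - QP)⁻¹ Q`.
  refine ⟨⟨1 - P ∘L Q, 1 + P ∘L R ∘L Q, ?_, ?_⟩, rfl⟩
  · ext f
    have := congrArg P (h1 (Q f))
    simp only [map_sub] at this
    simp only [mul_apply_eq_comp, sub_apply, one_apply_eq_self, add_apply,
      ContinuousLinearMap.comp_apply, map_add]
    rw [← this]
    abel
  · ext f
    have := congrArg P (h2 (Q f))
    simp only [map_sub] at this
    simp only [mul_apply_eq_comp, sub_apply, one_apply_eq_self, add_apply,
      ContinuousLinearMap.comp_apply, map_sub]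
    rw [← sub_eq_zero]
    rw [← sub_eq_zero] at this
    rw [← this]
    abel

theorem ringInverse_one_sub_comp_swap (P : E →L[ℝ] F) (Q : F →L[ℝ] E)
    (h : IsUnit (1 - Q ∘L P : E →L[ℝ] E)) (f : F) :
    Ring.inverse (1 - Q ∘L P) (Q f) = Q (Ring.inverse (1 - P ∘L Q) f) := by
  have h' := isUnit_one_sub_comp_swap P Q h
  have h1 : Ring.inverse (1 - P ∘L Q) f - P (Q (Ring.inverse (1 - P ∘L Q) f)) = f := by
    simpa using congrArg (fun S : F →L[ℝ] F => S f) (Ring.mul_inverse_cancel _ h')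
  have h2 : ∀ e, Ring.inverse (1 - Q ∘L P) (e - Q (P e)) = e := fun e => by
    simpa using congrArg (fun S : E →L[ℝ] E => S e) (Ring.inverse_mul_cancel _ h)
  nth_rewrite 1 [← h1]
  rw [map_sub, h2]

end Swap

/-! ### The factorization of `K₂` -/

/-- The `L²` norm of `w j` on `(s, ∞)`. -/
noncomputable def tailL2 {X : Type*} [NormedAddCommGroup X] (w : ℕ → ℝ → X) (j : ℕ) (s : ℝ) : ℝ := Real.sqrt (∫ x in Ioi s, ‖w j x‖ ^ 2)

theorem tailL2_nonneg {X : Type*} [NormedAddCommGroup X] {w : ℕ → ℝ → X} (j : ℕ) (s : ℝ) : 0 ≤ tailL2 w j s := Real.sqrt_nonneg _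

theorem tailL2_sq {X : Type*} [NormedAddCommGroup X] {w : ℕ → ℝ → X} (j : ℕ) (s : ℝ) : tailL2 w j s ^ 2 = ∫ y, ‖w j (s + y)‖ ^ 2 ∂halfLine := by
  rw [tailL2, Real.sq_sqrt (integral_nonneg fun x => sq_nonneg _), integral_Ioi_eq_halfLine]

theorem tendsto_tailL2 {X : Type*} [NormedAddCommGroup X] {w : ℕ → ℝ → X} (j : ℕ) :
    Tendsto (tailL2 w j) atTop (𝓝 0) := by
  have h := (tendsto_integral_Ioi_zero (μ := volume) (f := fun x => ‖w j x‖ ^ 2)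
    (tendsto_id (α := ℝ))).sqrt
  rw [Real.sqrt_zero] at h
  exact h

section Factor

variable {G : Type*} [NormedAddCommGroup G] [InnerProductSpace ℝ G]
  {w : ℕ → ℝ → G}

theorem L2pos_norm_sq (f : L2pos) : ‖f‖ ^ 2 = ∫ y, (f y) ^ 2 ∂halfLine := by
  rw [← real_inner_self_eq_norm_sq, L2.inner_def]
  simp [sq]

theorem DecayingCurve.integrable_halfLine (h : DecayingCurve w) (j : ℕ) (s : ℝ) :
    Integrable (fun y => ‖w j (s + y)‖ ^ 2) halfLine :=
  (integrableOn_Ioi_iff_halfLine _ s).1 (h.sq_integrable j s)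

theorem DecayingCurve.memLp_halfLine (h : DecayingCurve w) (j : ℕ) (s : ℝ) :
    MemLp (fun y => w j (s + y)) 2 halfLine := by
  have hc : Continuous fun y => w j (s + y) := (h.continuous j).comp (by fun_prop)
  rw [memLp_two_iff_integrable_sq_norm hc.aestronglyMeasurable]
  exact h.integrable_halfLine j s

theorem DecayingCurve.memLp_inner (h : DecayingCurve w) (j : ℕ) (s : ℝ) (g : G) :
    MemLp (fun y => inner ℝ (w j (s + y)) g) 2 halfLine := by
  have hc : Continuous fun y => inner ℝ (w j (s + y)) g :=
    ((h.continuous j).comp (by fun_prop)).inner continuous_const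
  refine ((h.memLp_halfLine j s).norm.mul_const ‖g‖).mono hc.aestronglyMeasurable
    (ae_of_all _ fun y => ?_)
  simpa using norm_inner_le_norm (𝕜 := ℝ) (w j (s + y)) g

/-- The operator `g ↦ ⟨w j (s + ·), g⟩` from `G` to `L²(ℝ₊)`. -/
noncomputable def curveAdj (h : DecayingCurve w) (j : ℕ) (s : ℝ) : G →L[ℝ] L2pos :=
  LinearMap.mkContinuous
    { toFun := fun g => (h.memLp_inner j s g).toLp _
      map_add' := fun g g' => by
        rw [← MemLp.toLp_add]
        congr 1
        funext y
        simp [inner_add_right]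
      map_smul' := fun c g => by
        rw [RingHom.id_apply, ← MemLp.toLp_const_smul]
        congr 1
        funext y
        simp [real_inner_smul_right] }
    (tailL2 w j s) (by
      intro g
      refine abs_le_of_sq_le_sq' ?_ (by positivity [tailL2_nonneg (w := w) j s]) |>.2
      rw [mul_pow, tailL2_sq, L2pos_norm_sq, ← integral_mul_const]
      refine integral_mono_ae ((memLp_two_iff_integrable_sq (Lp.aestronglyMeasurable _)).1
        (Lp.memLp _)) ((h.integrable_halfLine j s).mul_const _) ?_
      filter_upwards [(h.memLp_inner j s g).coeFn_toLp] with y hy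
      simp only [LinearMap.coe_mk, AddHom.coe_mk, hy]
      rw [← mul_pow]
      exact sq_le_sq' (by linarith [neg_abs_le (inner ℝ (w j (s + y)) g),
        abs_real_inner_le_norm (w j (s + y)) g]) (real_inner_le_norm _ _))

theorem coeFn_curveAdj (h : DecayingCurve w) (j : ℕ) (s : ℝ) (g : G) :
    curveAdj h j s g =ᵐ[halfLine] fun y => inner ℝ (w j (s + y)) g :=
  (h.memLp_inner j s g).coeFn_toLp

theorem norm_curveAdj_le (h : DecayingCurve w) (j : ℕ) (s : ℝ) : ‖curveAdj h j s‖ ≤ tailL2 w j s :=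
  LinearMap.mkContinuous_norm_le _ (tailL2_nonneg j s) _

theorem DecayingCurve.integrable_smul_halfLine (h : DecayingCurve w) (j : ℕ) (s : ℝ)
    {c : ℝ → ℝ} (hc : MemLp c 2 halfLine) :
    Integrable (fun y => c y • w j (s + y)) halfLine :=
  memLp_one_iff_integrable.1 ((h.memLp_halfLine j s).smul hc)

variable [CompleteSpace G]

/-- The operator `c ↦ ∫_{ℝ₊} c(y) w_j(s + y) dy` from `L²(ℝ₊)` to `G`. -/
noncomputable def curveB (h : DecayingCurve w) (j : ℕ) (s : ℝ) : L2pos →L[ℝ] G := (curveAdj h j s).adjoint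

theorem inner_curveB (h : DecayingCurve w) (j : ℕ) (s : ℝ) (c : L2pos) (g : G) :
    inner ℝ (curveB h j s c) g = inner ℝ c (curveAdj h j s g) :=
  ContinuousLinearMap.adjoint_inner_left _ _ _

theorem norm_curveB_le (h : DecayingCurve w) (j : ℕ) (s : ℝ) : ‖curveB h j s‖ ≤ tailL2 w j s := by
  rw [curveB, LinearIsometryEquiv.norm_map]
  exact norm_curveAdj_le h j s

theorem curveB_apply (h : DecayingCurve w) (j : ℕ) (s : ℝ) (c : L2pos) :
    curveB h j s c = ∫ y, c y • w j (s + y) ∂halfLine := by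
  refine ext_inner_right ℝ fun g => ?_
  rw [inner_curveB, real_inner_comm _ (∫ y, c y • w j (s + y) ∂halfLine),
    ← integral_inner (h.integrable_smul_halfLine j s (Lp.memLp c)) g, L2.inner_def]
  refine integral_congr_ae ?_
  filter_upwards [coeFn_curveAdj h j s g] with y hy
  rw [hy, real_inner_smul_right, real_inner_comm (w j (s + y)) g]
  simp [mul_comm]

theorem curveB_curveAdj (h : DecayingCurve w) (i j : ℕ) (s : ℝ) (g : G) :
    curveB h i s (curveAdj h j s g) = ∫ x in Ioi s, inner ℝ (w j x) g • w i x := by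
  rw [curveB_apply, integral_Ioi_eq_halfLine (fun x => inner ℝ (w j x) g • w i x) s]
  refine integral_congr_ae ?_
  filter_upwards [coeFn_curveAdj h j s g] with y hy
  simp only [hy]

theorem curveB_comp_curveAdj (h : DecayingCurve w) (s : ℝ) :
    curveB h 0 s ∘L curveAdj h 0 s = curveOp w s := by
  ext g
  rw [curveOp_apply h, ContinuousLinearMap.comp_apply, curveB_curveAdj]

/-- The operator on `L²(ℝ₊)` is traded for one on `G` whose derivative in `s` has rank one. -/
theorem isUnit_curveOp_iff (h : DecayingCurve w) (s : ℝ) :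
    IsUnit (1 - curveAdj h 0 s ∘L curveB h 0 s) ↔ IsUnit (1 - curveOp w s) := by
  rw [← curveB_comp_curveAdj h s]
  exact ⟨isUnit_one_sub_comp_swap _ _, isUnit_one_sub_comp_swap _ _⟩

/-- Integration by parts in the curve parameter. -/
theorem inner_curveB_one_curveAdj_zero (h : DecayingCurve w) (s : ℝ) (f g : G) :
    inner ℝ (curveB h 1 s (curveAdj h 0 s f)) g + inner ℝ f (curveB h 1 s (curveAdj h 0 s g)) =
      -(inner ℝ (w 0 s) f * inner ℝ (w 0 s) g) := by
  have hd : ∀ j f x, HasDerivAt (fun x => inner ℝ (w j x) f) (inner ℝ (w (j + 1) x) f) x := by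
    intro j f x
    simpa using (h.hasDerivAt j x).inner ℝ (hasDerivAt_const x f)
  have hi : ∀ f, IntegrableOn (fun x => inner ℝ (w 0 x) f • w 1 x) (Ioi s) := fun f =>
    (h.integrableOn_rankOne h 1 0 s).apply_continuousLinearMap f
  have hlim : ∀ f, Tendsto (fun x => inner ℝ (w 0 x) f) atTop (𝓝 0) := fun f => by
    simpa using (h.tendsto_zero 0).inner (tendsto_const_nhds (x := f))
  have h2 := integral_Ioi_of_hasDerivAt_of_tendsto' (a := s)
    (f := fun x => inner ℝ (w 0 x) f * inner ℝ (w 0 x) g)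
    (fun x _ => (hd 0 f x).mul (hd 0 g x)) ?_ (by simpa using (hlim f).mul (hlim g))
  · rw [zero_sub] at h2
    rw [← h2, curveB_curveAdj, curveB_curveAdj, ← integral_inner (hi g) f, real_inner_comm,
      ← integral_inner (hi f) g, ← integral_add]
    · refine integral_congr_ae (ae_of_all _ fun x => ?_)
      simp only [real_inner_smul_right, real_inner_comm (w 1 x)]
      ring
    · exact (hi f).const_inner g
    · exact (hi g).const_inner f
  · refine (((hi f).const_inner g).add ((hi g).const_inner f)).congr (ae_of_all _ fun x => ?_)
    simp only [Pi.add_apply, real_inner_smul_right, real_inner_comm (w 1 x)]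
    ring

theorem isIntegralOperator_curve (h : DecayingCurve w) (s : ℝ) :
    IsIntegralOperator (fun x y => inner ℝ (w 0 (s + x)) (w 0 (s + y)))
      (curveAdj h 0 s ∘L curveB h 0 s) := by
  intro f
  filter_upwards [coeFn_curveAdj h 0 s (curveB h 0 s f)] with x hx
  have hi := h.integrable_smul_halfLine 0 s (Lp.memLp f)
  have he : ∀ y, inner ℝ (w 0 (s + x)) (w 0 (s + y)) * f y =
      inner ℝ (w 0 (s + x)) (f y • w 0 (s + y)) := fun y => by
    rw [real_inner_smul_right, mul_comm]
  simp only [he]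
  refine ⟨hi.const_inner _, ?_⟩
  rw [ContinuousLinearMap.comp_apply, hx, curveB_apply, integral_inner hi]

end Factor

theorem IsIntegralOperator.unique {k : ℝ → ℝ → ℝ} {T T' : L2pos →L[ℝ] L2pos}
    (h : IsIntegralOperator k T) (h' : IsIntegralOperator k T') : T = T' := by
  ext f
  filter_upwards [h f, h' f] with x hx hx'
  rw [hx.2, hx'.2]

theorem integralOperator_eq {k : ℝ → ℝ → ℝ} {T : L2pos →L[ℝ] L2pos}
    (h : IsIntegralOperator k T) : integralOperator k = T := by
  have hex : ∃ T, IsIntegralOperator k T := ⟨T, h⟩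
  rw [integralOperator, dif_pos hex]
  exact hex.choose_spec.unique h

end PainleveHierarchy

namespace PainleveHierarchy

/-! ### The curve of translates in a weighted `L²` space -/

theorem Lp_two_norm_sq {μ : Measure ℝ} (f : Lp ℝ 2 μ) : ‖f‖ ^ 2 = ∫ y, (f y) ^ 2 ∂μ := by
  rw [← real_inner_self_eq_norm_sq, L2.inner_def]
  simp [sq]

theorem toLp_two_norm_sq {μ : Measure ℝ} {f : ℝ → ℝ} (hf : MemLp f 2 μ) :
    ‖hf.toLp f‖ ^ 2 = ∫ y, (f y) ^ 2 ∂μ := by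
  rw [Lp_two_norm_sq]
  refine integral_congr_ae ?_
  filter_upwards [hf.coeFn_toLp] with y hy
  rw [hy]

theorem inner_toLp_two {μ : Measure ℝ} {f g : ℝ → ℝ} (hf : MemLp f 2 μ) (hg : MemLp g 2 μ) :
    inner ℝ (hf.toLp f) (hg.toLp g) = ∫ y, f y * g y ∂μ := by
  rw [L2.inner_def]
  refine integral_congr_ae ?_
  filter_upwards [hf.coeFn_toLp, hg.coeFn_toLp] with y hy hy'
  rw [hy, hy']
  simp [mul_comm]

section Translates

variable {A : ℕ → ℝ → ℝ}

theorem tailL2_antitone (hA : DecayingCurve A) (j : ℕ) : Antitone (tailL2 A j) := by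
  intro a b hab
  refine Real.sqrt_le_sqrt ?_
  exact setIntegral_mono_set (hA.sq_integrable j a) (ae_of_all _ fun x => sq_nonneg _)
    (Ioi_subset_Ioi hab).eventuallyLE

/-- A bound for `A j` by `L²` norms, in the manner of Sobolev. -/
noncomputable def tailSq (A : ℕ → ℝ → ℝ) (j : ℕ) (u : ℝ) : ℝ := tailL2 A j u ^ 2 + tailL2 A (j + 1) u ^ 2

theorem tailSq_nonneg (j : ℕ) (u : ℝ) : 0 ≤ tailSq A j u := by
  unfold tailSq; positivity

theorem tailSq_antitone (hA : DecayingCurve A) (j : ℕ) : Antitone (tailSq A j) := by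
  intro a b hab
  unfold tailSq
  gcongr 1
  · exact pow_le_pow_left₀ (tailL2_nonneg _ _) (tailL2_antitone hA j hab) 2
  · exact pow_le_pow_left₀ (tailL2_nonneg _ _) (tailL2_antitone hA (j + 1) hab) 2

/-- `A_j(u)² = -2 ∫_u^∞ A_j A_{j+1}`, and `-2ab ≤ a² + b²`. The bound is monotone in `u`, which
makes it a convenient dominating function. -/
theorem sq_le_tailSq (hA : DecayingCurve A) (j : ℕ) (u : ℝ) : A j u ^ 2 ≤ tailSq A j u := by
  have hi : ∀ i, IntegrableOn (fun x => (A i x) ^ 2) (Ioi u) := fun i => by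
    simpa using hA.sq_integrable i u
  have hprod : IntegrableOn (fun x => 2 * (A j x * A (j + 1) x)) (Ioi u) :=
    hA.integrableOn_of_norm_le hA j (j + 1) u
      (continuous_const.mul ((hA.continuous _).mul (hA.continuous _))) (C := 2) fun x => by simp
  have h1 := integral_Ioi_of_hasDerivAt_of_tendsto' (a := u) (f := fun x => A j x ^ 2)
    (f' := fun x => 2 * (A j x * A (j + 1) x)) (m := 0)
    (fun x _ => ((hA.hasDerivAt j x).pow 2).congr_deriv (by norm_num; ring)) hprod
    (by simpa using (hA.tendsto_zero j).pow 2)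
  have h2 : A j u ^ 2 = ∫ x in Ioi u, -(2 * (A j x * A (j + 1) x)) := by
    rw [integral_neg, h1]; ring
  rw [h2, tailSq, tailL2, tailL2, Real.sq_sqrt (integral_nonneg fun x => sq_nonneg _),
    Real.sq_sqrt (integral_nonneg fun x => sq_nonneg _)]
  simp only [Real.norm_eq_abs, sq_abs]
  rw [← integral_add (hi j) (hi (j + 1))]
  refine integral_mono hprod.neg ((hi j).add (hi (j + 1))) fun x => ?_
  nlinarith [sq_nonneg (A j x + A (j + 1) x)]

/-- All the translates of `A` and of its derivatives are square integrable for `μ`, and so are the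
corresponding operators. -/
def TranslatesL2 (A : ℕ → ℝ → ℝ) (μ : Measure ℝ) : Prop :=
  ∀ (j : ℕ) (s : ℝ), Integrable (fun p : ℝ × ℝ => (A j (p.1 + p.2 + s)) ^ 2) (μ.prod halfLine)

variable {μ : Measure ℝ}

theorem integrable_tailSq (hμ : TranslatesL2 A μ) (j : ℕ) (s : ℝ) :
    Integrable (fun r => tailSq A j (r + s)) μ := by
  have h : ∀ i, Integrable (fun r => tailL2 A i (r + s) ^ 2) μ := fun i => by
    refine (hμ i s).integral_prod_left.congr (ae_of_all _ fun r => ?_)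
    simp only [tailL2_sq, Real.norm_eq_abs, sq_abs]
    refine integral_congr_ae (ae_of_all _ fun y => ?_)
    simp only
    congr 2
    ring
  exact (h j).add (h (j + 1))

/-- The hypothesis controls only double integrals; a single translate is reached through the Sobolev
bound, at the price of one more derivative. -/
theorem memLp_translate (hA : DecayingCurve A) (hμ : TranslatesL2 A μ) (j : ℕ) (x : ℝ) :
    MemLp (fun r => A j (r + x)) 2 μ := by
  have hc : Continuous fun r => A j (r + x) := (hA.continuous j).comp (by fun_prop)
  rw [memLp_two_iff_integrable_sq hc.aestronglyMeasurable]
  refine (integrable_tailSq hμ j x).mono' (hc.pow 2).aestronglyMeasurable (ae_of_all _ fun r => ?_)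
  rw [Real.norm_eq_abs, abs_of_nonneg (sq_nonneg _)]
  exact sq_le_tailSq hA j _

/-- The translates of `A j`, as a curve in `L²(μ)`. -/
noncomputable def translate (hA : DecayingCurve A) (hμ : TranslatesL2 A μ) (j : ℕ) (x : ℝ) : Lp ℝ 2 μ :=
  (memLp_translate hA hμ j x).toLp _

theorem coeFn_translate (hA : DecayingCurve A) (hμ : TranslatesL2 A μ) (j : ℕ) (x : ℝ) :
    translate hA hμ j x =ᵐ[μ] fun r => A j (r + x) :=
  (memLp_translate hA hμ j x).coeFn_toLp

theorem inner_translate (hA : DecayingCurve A) (hμ : TranslatesL2 A μ) (i j : ℕ) (x y : ℝ) :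
    inner ℝ (translate hA hμ i x) (translate hA hμ j y) = ∫ r, A i (r + x) * A j (r + y) ∂μ :=
  inner_toLp_two _ _

theorem hasDerivAt_translate (hA : DecayingCurve A) (hμ : TranslatesL2 A μ) (j : ℕ) (x : ℝ) :
    HasDerivAt (translate hA hμ j) (translate hA hμ (j + 1) x) x := by
  rw [hasDerivAt_iff_tendsto_slope, ← tendsto_sub_nhds_zero_iff,
    tendsto_zero_iff_norm_tendsto_zero]
  -- As `tailSq` is antitone, its value at `r + (x - 1)` bounds `A (j+1)` at every `r + x'` with `x'
  -- ≥ x - 1`; by the mean value inequality it dominates the squared difference quotients near `x`.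
  set D : ℝ → ℝ := fun r => tailSq A (j + 1) (r + (x - 1)) with hD
  let F : ℝ → ℝ → ℝ := fun x' r => (x' - x)⁻¹ * (A j (r + x') - A j (r + x)) - A (j + 1) (r + x)
  have hFc : ∀ x', Continuous (F x') := fun x' => by
    have := hA.continuous j
    have := hA.continuous (j + 1)
    fun_prop
  have hA1 : ∀ r x', x - 1 ≤ x' → |A (j + 1) (r + x')| ≤ Real.sqrt (D r) := fun r x' hx' => by
    refine Real.abs_le_sqrt ((sq_le_tailSq hA (j + 1) _).trans ?_)
    exact tailSq_antitone hA (j + 1) (by linarith)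
  have hlim : Tendsto (fun x' => ∫ r, (F x' r) ^ 2 ∂μ) (𝓝[≠] x) (𝓝 (∫ r, (0 : ℝ) ∂μ)) := by
    refine tendsto_integral_filter_of_dominated_convergence (fun r => 4 * D r)
      (Eventually.of_forall fun x' => ((hFc x').pow 2).aestronglyMeasurable) ?_
      ((integrable_tailSq hμ (j + 1) (x - 1)).const_mul 4) (ae_of_all _ fun r => ?_)
    · have : ∀ᶠ x' in 𝓝[≠] x, x - 1 < x' :=
        (eventually_gt_nhds (by linarith)).filter_mono nhdsWithin_le_nhds
      filter_upwards [this, self_mem_nhdsWithin] with x' hx' hne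
      refine ae_of_all _ fun r => ?_
      have h1 : ‖A j (r + x') - A j (r + x)‖ ≤ Real.sqrt (D r) * ‖x' - x‖ := by
        refine (convex_Ioi (x - 1)).norm_image_sub_le_of_norm_hasDerivWithin_le
          (f := fun z => A j (r + z)) (f' := fun z => A (j + 1) (r + z)) (fun z hz => ?_)
          (fun z hz => hA1 r z (le_of_lt hz)) (show x - 1 < x by linarith) hx'
        exact ((hA.hasDerivAt j (r + z)).comp_const_add r z).hasDerivWithinAt
      have hne' : 0 < ‖x' - x‖ := norm_pos_iff.2 (sub_ne_zero.2 hne)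
      have h2 : |(x' - x)⁻¹ * (A j (r + x') - A j (r + x))| ≤ Real.sqrt (D r) := by
        rw [abs_mul, abs_inv, ← Real.norm_eq_abs (x' - x), inv_mul_le_iff₀ hne', mul_comm]
        exact h1
      have h3 := hA1 r x (by linarith)
      have h4 : |F x' r| ≤ 2 * Real.sqrt (D r) := (abs_sub _ _).trans (by linarith)
      have h5 := Real.sq_sqrt (tailSq_nonneg (A := A) (j + 1) (r + (x - 1)))
      rw [Real.norm_eq_abs, abs_of_nonneg (sq_nonneg _), ← sq_abs]
      calc |F x' r| ^ 2 ≤ (2 * Real.sqrt (D r)) ^ 2 := by gcongr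
        _ = 4 * D r := by rw [mul_pow, h5, hD]; norm_num
    · have hd : HasDerivAt (fun z => A j (r + z)) (A (j + 1) (r + x)) x :=
        (hA.hasDerivAt j (r + x)).comp_const_add r x
      rw [hasDerivAt_iff_tendsto_slope] at hd
      have := (hd.sub_const (A (j + 1) (r + x))).pow 2
      simpa [slope_def_field, F, div_eq_inv_mul] using this
  have hnorm : ∀ x', ‖slope (translate hA hμ j) x x' - translate hA hμ (j + 1) x‖ =
      Real.sqrt (∫ r, (F x' r) ^ 2 ∂μ) := by
    intro x'
    rw [← Real.sqrt_sq (norm_nonneg (slope _ _ _ - _)), Lp_two_norm_sq]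
    congr 1
    refine integral_congr_ae ?_
    rw [slope_def_module]
    filter_upwards [Lp.coeFn_sub ((x' - x)⁻¹ • (translate hA hμ j x' - translate hA hμ j x))
      (translate hA hμ (j + 1) x), Lp.coeFn_smul (x' - x)⁻¹
      (translate hA hμ j x' - translate hA hμ j x),
      Lp.coeFn_sub (translate hA hμ j x') (translate hA hμ j x), coeFn_translate hA hμ j x,
      coeFn_translate hA hμ j x', coeFn_translate hA hμ (j + 1) x] with r h1 h2 h3 h4 h5 h6
    rw [h1, Pi.sub_apply, h2, Pi.smul_apply, h3, Pi.sub_apply, h4, h5, h6]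
    simp [F]
  simp only [hnorm]
  simpa using hlim.sqrt

theorem DecayingCurve.shift (hA : DecayingCurve A) (t : ℝ) :
    DecayingCurve fun j x => A j (t + x) where
  hasDerivAt j x := (hA.hasDerivAt j (t + x)).comp_const_add t x
  sq_integrable j s := by
    have := (integrableOn_Ioi_iff_halfLine (fun x => ‖A j x‖ ^ 2) (t + s)).1
      (hA.sq_integrable j (t + s))
    rw [integrableOn_Ioi_iff_halfLine]
    simpa [add_assoc] using this

variable [SigmaFinite μ]

theorem decayingCurve_translate (hA : DecayingCurve A) (hμ : TranslatesL2 A μ) :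
    DecayingCurve (translate hA hμ) where
  hasDerivAt := hasDerivAt_translate hA hμ
  sq_integrable j s := by
    rw [integrableOn_Ioi_iff_halfLine]
    refine (hμ j s).integral_prod_right.congr (ae_of_all _ fun y => ?_)
    simp only [translate, toLp_two_norm_sq]
    refine integral_congr_ae (ae_of_all _ fun r => ?_)
    simp only
    congr 2
    ring

/-- The vector-valued integral `∫ c(y) w_j(s + y) dy` in `L²(μ)` can be evaluated pointwise. -/
theorem coeFn_curveB_translate (hA : DecayingCurve A) (hμ : TranslatesL2 A μ) (j : ℕ) (s : ℝ)
    (c : L2pos) :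
    curveB (decayingCurve_translate hA hμ) j s c =ᵐ[μ]
      fun r => ∫ y, A j (r + s + y) * c y ∂halfLine := by
  set h := decayingCurve_translate hA hμ
  have hcc : Integrable (fun y => (c y) ^ 2) halfLine :=
    (memLp_two_iff_integrable_sq (Lp.aestronglyMeasurable _)).1 (Lp.memLp c)
  have hAc : Continuous fun p : ℝ × ℝ => A j (p.1 + s + p.2) :=
    (hA.continuous j).comp (by fun_prop)
  have hprod : ∀ S : Set ℝ, MeasurableSet S → μ S < ⊤ →
      Integrable (fun p : ℝ × ℝ => A j (p.1 + s + p.2) * c p.2) ((μ.restrict S).prod halfLine) := by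
    intro S hS hSf
    have : IsFiniteMeasure (μ.restrict S) := ⟨by simpa using hSf⟩
    have h1 : Integrable (fun p : ℝ × ℝ => (A j (p.1 + p.2 + s)) ^ 2)
        ((μ.restrict S).prod halfLine) := by
      refine (hμ j s).mono_measure ?_
      exact Measure.prod_mono Measure.restrict_le_self le_rfl
    have h2 : Integrable (fun p : ℝ × ℝ => (c p.2) ^ 2) ((μ.restrict S).prod halfLine) :=
      hcc.comp_snd _
    refine (h1.add h2).mono' ?_ (ae_of_all _ fun p => ?_)
    · exact hAc.aestronglyMeasurable.mul (Lp.aestronglyMeasurable c).comp_snd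
    · have e : p.1 + s + p.2 = p.1 + p.2 + s := by ring
      rw [Real.norm_eq_abs, abs_mul, e, Pi.add_apply, ← sq_abs (A j _), ← sq_abs (c p.2)]
      nlinarith [sq_nonneg (|A j (p.1 + p.2 + s)| - |c p.2|), sq_nonneg |A j (p.1 + p.2 + s)|,
        sq_nonneg |c p.2|]
  -- The two functions are compared through their integrals over sets of finite measure, where
  -- Fubini's theorem applies; no global integrability in `r` is available.
  refine ae_eq_of_forall_setIntegral_eq_of_sigmaFinite (fun S hS hSf => ?_) (fun S hS hSf => ?_)
    fun S hS hSf => ?_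
  · have : IsFiniteMeasure (μ.restrict S) := ⟨by simpa using hSf⟩
    exact ((Lp.memLp (curveB h j s c)).restrict S).integrable one_le_two
  · exact (hprod S hS hSf).integral_prod_left
  · have h1 : ∫ r in S, curveB h j s c r ∂μ =
        inner ℝ (indicatorConstLp 2 hS hSf.ne (1 : ℝ)) (curveB h j s c) :=
      (L2.inner_indicatorConstLp_one hS hSf.ne _).symm
    rw [h1, real_inner_comm, inner_curveB, L2.inner_def,
      integral_integral_swap (f := fun r y => A j (r + s + y) * c y) (hprod S hS hSf)]
    refine integral_congr_ae ?_
    filter_upwards [coeFn_curveAdj h j s (indicatorConstLp 2 hS hSf.ne (1 : ℝ))] with y hy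
    rw [hy, real_inner_comm _ (translate hA hμ j (s + y)), L2.inner_indicatorConstLp_one hS hSf.ne,
      integral_mul_const]
    simp only [RCLike.inner_apply, conj_trivial]
    congr 1
    refine integral_congr_ae (ae_restrict_of_ae ?_)
    filter_upwards [coeFn_translate hA hμ j (s + y)] with r hr
    rw [hr, add_assoc]

end Translates

end PainleveHierarchy

namespace PainleveHierarchy

/-! ### Admissible weights -/

namespace IsAdmissible

variable {σ : ℝ → ℝ}

theorem tendsto_atBot (hσ : IsAdmissible σ) : Tendsto σ atBot (𝓝 0) := by
  obtain ⟨γ, C, c, -, -, hc, h, -⟩ := hσ.limits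
  refine squeeze_zero_norm' (a := fun r => C * Real.exp (c * r))
    ((eventually_le_atBot 0).mono fun r hr => h r hr) ?_
  have : Tendsto (fun r : ℝ => Real.exp (c * r)) atBot (𝓝 0) :=
    Real.tendsto_exp_atBot.comp (tendsto_id.const_mul_atBot hc)
  simpa using this.const_mul C

theorem exists_tendsto_atTop (hσ : IsAdmissible σ) :
    ∃ γ, 0 < γ ∧ γ ≤ 1 ∧ Tendsto σ atTop (𝓝 γ) := by
  obtain ⟨γ, C, c, h0, h1, hc, -, h⟩ := hσ.limits
  refine ⟨γ, h0, h1, ?_⟩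
  rw [← tendsto_sub_nhds_zero_iff]
  refine squeeze_zero_norm' (a := fun r => C * Real.exp (-(c * r)))
    ((eventually_ge_atTop 0).mono fun r hr => h r hr) ?_
  have : Tendsto (fun r : ℝ => Real.exp (-(c * r))) atTop (𝓝 0) :=
    Real.tendsto_exp_atBot.comp (tendsto_neg_atTop_atBot.comp (tendsto_id.const_mul_atTop hc))
  simpa using this.const_mul C

theorem nonneg (hσ : IsAdmissible σ) (r : ℝ) : 0 ≤ σ r :=
  hσ.mono.le_of_tendsto hσ.tendsto_atBot r

theorem le_one (hσ : IsAdmissible σ) (r : ℝ) : σ r ≤ 1 := by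
  obtain ⟨γ, -, h1, h⟩ := hσ.exists_tendsto_atTop
  exact (hσ.mono.ge_of_tendsto h r).trans h1

theorem exists_pos (hσ : IsAdmissible σ) : ∃ R, 0 < σ R := by
  obtain ⟨γ, h0, -, h⟩ := hσ.exists_tendsto_atTop
  exact (h.eventually (eventually_gt_nhds h0)).exists

theorem measurable (hσ : IsAdmissible σ) : Measurable σ := hσ.mono.measurable

/-- The measure `σ'` of `(-∞, x]` is `σ x`, for almost all `x`. -/
theorem ae_dσ_Iic (hσ : IsAdmissible σ) :
    -- The mass is the right limit of `σ`, which equals `σ x` off the countable set of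
    -- discontinuities.
    ∀ᵐ x : ℝ, dσ hσ.mono (Iic x) = ENNReal.ofReal (σ x) := by
  have h1 : ∀ᵐ x : ℝ, ContinuousAt σ x := by
    rw [ae_iff]
    exact hσ.mono.countable_not_continuousAt.measure_zero _
  filter_upwards [h1] with x hx
  have h2 : Tendsto hσ.mono.stieltjesFunction atBot (𝓝 0) := by
    refine tendsto_of_tendsto_of_tendsto_of_le_of_le (g := σ) (h := fun x => σ (x + 1))
      hσ.tendsto_atBot (hσ.tendsto_atBot.comp (tendsto_atBot_add_const_right _ 1 tendsto_id))
      (fun x => ?_) fun x => ?_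
    · rw [Monotone.stieltjesFunction_eq]
      exact hσ.mono.le_rightLim le_rfl
    · rw [Monotone.stieltjesFunction_eq]
      exact hσ.mono.rightLim_le (by simp)
  rw [dσ, StieltjesFunction.measure_Iic _ h2, Monotone.stieltjesFunction_eq, sub_zero,
    hx.continuousWithinAt.rightLim_eq]

/-- Integration by parts against the measure `σ'`. -/
theorem integral_dσ (hσ : IsAdmissible σ) {F F' : ℝ → ℝ} (hF : ∀ r, HasDerivAt F (F' r) r)
    (hF' : Continuous F') (h1 : Integrable (fun r => σ r * F r))
    (h2 : Integrable (fun r => σ r * F' r)) :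
    Integrable F (dσ hσ.mono) ∧ ∫ r, F r ∂(dσ hσ.mono) = -∫ r, σ r * F' r := by
  have : SigmaFinite (dσ hσ.mono) := by unfold dσ; infer_instance
  have hFc : Continuous F := continuous_iff_continuousAt.2 fun r => (hF r).continuousAt
  obtain ⟨R, hR⟩ := hσ.exists_pos
  have hint : ∀ f : ℝ → ℝ, Continuous f → Integrable (fun r => σ r * f r) →
      -- Beyond `R` the weight is at least `σ R > 0`, so weighted integrability implies
      -- integrability at `+∞`.
      ∀ r, IntegrableOn f (Ioi r) := by
    intro f hf hi r
    have hR1 : IntegrableOn f (Ioi R) := by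
      refine ((hi.norm.const_mul (σ R)⁻¹).integrableOn (s := Ioi R)).mono'
        hf.aestronglyMeasurable ((ae_restrict_iff' measurableSet_Ioi).2 (ae_of_all _ fun x hx => ?_))
      rw [norm_mul, Real.norm_of_nonneg (hσ.nonneg x), ← mul_assoc]
      refine le_mul_of_one_le_left (norm_nonneg _) ?_
      rw [inv_mul_eq_div, one_le_div hR]
      exact hσ.mono (le_of_lt hx)
    rcases le_total R r with h | h
    · exact hR1.mono_set (Ioi_subset_Ioi h)
    · rw [← Ioc_union_Ioi_eq_Ioi h]
      exact (hf.integrableOn_Ioc).union hR1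
  have hlim : Tendsto F atTop (𝓝 0) :=
    tendsto_zero_of_hasDerivAt_of_integrableOn_Ioi (a := 0) (fun x _ => hF x)
      (hint F' hF' h2 0) (hint F hFc h1 0)
  have hFr : ∀ r, ∫ x in Ici r, F' x = -F r := fun r => by
    rw [integral_Ici_eq_integral_Ioi,
      integral_Ioi_of_hasDerivAt_of_tendsto' (fun x _ => hF x) (hint F' hF' h2 r) hlim, zero_sub]
  -- Fubini's theorem for `F'(x)` on the region `r ≤ x`: integrating in `x` first gives `-F(r)`,
  -- integrating in `r` first gives `σ(x) F'(x)` for almost every `x`.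
  let Φ : ℝ × ℝ → ℝ := {p : ℝ × ℝ | p.1 ≤ p.2}.indicator fun p => F' p.2
  have hset : MeasurableSet {p : ℝ × ℝ | p.1 ≤ p.2} := measurableSet_le measurable_fst measurable_snd
  have hΦm : Measurable Φ := (hF'.measurable.comp measurable_snd).indicator hset
  have hΦ1 : ∀ x, (fun r => Φ (r, x)) = (Iic x).indicator fun _ => F' x := fun x => by
    funext r
    simp [Φ, indicator]
  have hΦ2 : ∀ r, (fun x => Φ (r, x)) = (Ici r).indicator F' := fun r => by
    funext x
    simp [Φ, indicator]
  have hfin : ∀ᵐ x : ℝ, (dσ hσ.mono).real (Iic x) = σ x := by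
    filter_upwards [hσ.ae_dσ_Iic] with x hx
    rw [measureReal_def, hx, ENNReal.toReal_ofReal (hσ.nonneg x)]
  have hΦi : Integrable Φ ((dσ hσ.mono).prod volume) := by
    rw [integrable_prod_iff' hΦm.aestronglyMeasurable]
    constructor
    · filter_upwards [hσ.ae_dσ_Iic] with x hx
      rw [hΦ1]
      exact (integrable_indicator_iff measurableSet_Iic).2 (integrableOn_const (by simp [hx]))
    · refine h2.norm.congr ?_
      filter_upwards [hfin] with x hx
      have : (fun r => ‖Φ (r, x)‖) = (Iic x).indicator fun _ => ‖F' x‖ := by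
        funext r
        rw [← norm_indicator_eq_indicator_norm, ← congrFun (hΦ1 x) r]
      rw [this, integral_indicator measurableSet_Iic, setIntegral_const, hx, norm_mul,
        Real.norm_of_nonneg (hσ.nonneg x), smul_eq_mul]
  have hleft : ∀ r, ∫ x, Φ (r, x) = -F r := fun r => by
    rw [hΦ2, integral_indicator measurableSet_Ici, hFr]
  have hiF : Integrable F (dσ hσ.mono) := by
    have := hΦi.integral_prod_left
    simp only [hleft] at this
    simpa using this.neg
  refine ⟨hiF, ?_⟩
  have hswap := integral_integral_swap (f := fun r x => Φ (r, x)) hΦi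
  simp only [hleft] at hswap
  rw [integral_neg] at hswap
  rw [← neg_inj, hswap, neg_neg]
  refine integral_congr_ae ?_
  filter_upwards [hfin] with x hx
  rw [hΦ1, integral_indicator measurableSet_Iic, setIntegral_const, hx, smul_eq_mul]

end IsAdmissible

/-- The measure `σ(r) dr`. -/
noncomputable def weight (σ : ℝ → ℝ) : Measure ℝ := volume.withDensity fun r => ENNReal.ofReal (σ r)

instance (σ : ℝ → ℝ) : SigmaFinite (weight σ) := by
  unfold weight
  infer_instance

theorem integral_weight {σ : ℝ → ℝ} (hσ : IsAdmissible σ) (f : ℝ → ℝ) :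
    ∫ r, f r ∂weight σ = ∫ r, σ r * f r := by
  rw [weight, integral_withDensity_eq_integral_toReal_smul hσ.measurable.ennreal_ofReal
    (ae_of_all _ fun r => ENNReal.ofReal_lt_top)]
  simp [ENNReal.toReal_ofReal (hσ.nonneg _)]

theorem integrable_weight_iff {σ : ℝ → ℝ} (hσ : IsAdmissible σ) (f : ℝ → ℝ) :
    Integrable f (weight σ) ↔ Integrable fun r => σ r * f r := by
  rw [weight, integrable_withDensity_iff_integrable_smul' hσ.measurable.ennreal_ofReal
    (ae_of_all _ fun r => ENNReal.ofReal_lt_top)]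
  simp [ENNReal.toReal_ofReal (hσ.nonneg _)]

theorem translatesL2_weight {A σ : ℝ → ℝ} (hσ : IsAdmissible σ)
    (h : SqrtWeightHilbertSchmidt A σ) :
    TranslatesL2 (fun j => iteratedDeriv j A) (weight σ) := by
  intro j s
  rw [weight, prod_withDensity_left hσ.measurable.ennreal_ofReal,
    integrable_withDensity_iff_integrable_smul' (f := fun z : ℝ × ℝ => ENNReal.ofReal (σ z.1))
    (hσ.measurable.comp measurable_fst).ennreal_ofReal
    (ae_of_all _ fun r => ENNReal.ofReal_lt_top)]
  refine (h j s).congr (ae_of_all _ fun p => ?_)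
  simp [ENNReal.toReal_ofReal (hσ.nonneg _)]

/-! ### Airy functions as decaying curves -/

theorem IsHigherAiry.decayingCurve {ε : ℝ} {A : ℝ → ℝ} (hA : IsHigherAiry ε A) :
    DecayingCurve fun j => iteratedDeriv j A where
  hasDerivAt j x := by
    rw [iteratedDeriv_succ]
    have := hA.smooth.differentiable_iteratedDeriv j (by exact_mod_cast ENat.natCast_lt_top j)
    exact (this x).hasDerivAt
  sq_integrable j s := by
    obtain ⟨C, c, hc, h⟩ := hA.decay j
    have hcont : Continuous fun x => ‖iteratedDeriv j A x‖ ^ 2 :=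
      ((hA.smooth.continuous_iteratedDeriv j (by exact_mod_cast le_top)).norm.pow 2)
    have h0 : IntegrableOn (fun x => ‖iteratedDeriv j A x‖ ^ 2) (Ioi 0) := by
      have hexp := (integrableOn_exp_mul_Ioi (a := -(2 * c)) (by linarith) 0).const_mul (C ^ 2)
      refine hexp.mono' hcont.aestronglyMeasurable
        ((ae_restrict_iff' measurableSet_Ioi).2 (ae_of_all _ fun x hx => ?_))
      rw [Real.norm_of_nonneg (by positivity)]
      calc ‖iteratedDeriv j A x‖ ^ 2 ≤ (C * Real.exp (-(c * x))) ^ 2 := by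
            gcongr; exact h x (le_of_lt hx)
        _ = C ^ 2 * Real.exp (-(2 * c) * x) := by
            rw [mul_pow, ← Real.exp_nat_mul]; congr 2; push_cast; ring
    rcases le_total 0 s with hs | hs
    · exact h0.mono_set (Ioi_subset_Ioi hs)
    · rw [← Ioc_union_Ioi_eq_Ioi hs]
      exact hcont.integrableOn_Ioc.union h0

theorem IsHigherAiry.translatesL2_halfLine {ε : ℝ} {A : ℝ → ℝ} (hA : IsHigherAiry ε A) :
    TranslatesL2 (fun j => iteratedDeriv j A) halfLine := by
  intro j s
  obtain ⟨C, c, hc, h⟩ := hA.decay j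
  have hcont := hA.smooth.continuous_iteratedDeriv j (by exact_mod_cast le_top)
  obtain ⟨M, hM⟩ := (isCompact_Icc (a := s) (b := 0)).exists_bound_of_continuousOn hcont.continuousOn
  have hC : 0 ≤ C := by simpa using (abs_nonneg _).trans (h 0 le_rfl)
  have hbound : ∀ x, s ≤ x → |iteratedDeriv j A x| ≤ (C + |M|) * Real.exp (-(c * x)) := by
    intro x hx
    rcases le_total 0 x with h0 | h0
    · refine (h x h0).trans ?_
      gcongr
      linarith [abs_nonneg M]
    · have h1 : 1 ≤ Real.exp (-(c * x)) := Real.one_le_exp (by nlinarith)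
      have h2 := hM x ⟨hx, h0⟩
      rw [Real.norm_eq_abs] at h2
      nlinarith [le_abs_self M, abs_nonneg M]
  have hexp : Integrable (fun x => Real.exp (-(2 * c) * x)) halfLine :=
    integrableOn_exp_mul_Ioi (a := -(2 * c)) (by linarith) 0
  refine ((hexp.mul_prod hexp).const_mul ((C + |M|) ^ 2 * Real.exp (-(2 * c) * s))).mono' ?_ ?_
  · exact ((hcont.comp (by fun_prop)).pow 2).aestronglyMeasurable
  · have hpos : ∀ᵐ p ∂(halfLine.prod halfLine), p ∈ Ioi (0 : ℝ) ×ˢ Ioi (0 : ℝ) := by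
      rw [Measure.prod_restrict]
      exact ae_restrict_mem (measurableSet_Ioi.prod measurableSet_Ioi)
    filter_upwards [hpos] with p hp
    have hp1 : (0 : ℝ) < p.1 := hp.1
    have hp2 : (0 : ℝ) < p.2 := hp.2
    have h1 := hbound (p.1 + p.2 + s) (by linarith)
    rw [Real.norm_of_nonneg (by positivity), ← sq_abs]
    calc |iteratedDeriv j A (p.1 + p.2 + s)| ^ 2
        ≤ ((C + |M|) * Real.exp (-(c * (p.1 + p.2 + s)))) ^ 2 := by gcongr
      _ = _ := by
        rw [mul_pow, ← Real.exp_nat_mul, mul_assoc, ← Real.exp_add, ← Real.exp_add]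
        congr 2
        push_cast
        ring

end PainleveHierarchy

/-! ### The differential equation and the boundary behaviour for a general Airy function -/

namespace PainleveHierarchy

section HigherAiry

variable {ε : ℝ} {A σ : ℝ → ℝ}

/-- The translates `A(· + x)` as a curve in `L²(σ(r) dr)`. -/
noncomputable def airyCurve (hA : IsHigherAiry ε A) (hσ : IsAdmissible σ)
    (h : SqrtWeightHilbertSchmidt A σ) : ℕ → ℝ → Lp ℝ 2 (weight σ) :=
  translate hA.decayingCurve (translatesL2_weight hσ h)

/-- The translates `A(· + x)` as a curve in `L²(ℝ₊)`. -/
noncomputable def halfLineCurve (hA : IsHigherAiry ε A) : ℕ → ℝ → L2pos :=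
  translate hA.decayingCurve hA.translatesL2_halfLine

theorem decayingCurve_airyCurve (hA : IsHigherAiry ε A) (hσ : IsAdmissible σ)
    (h : SqrtWeightHilbertSchmidt A σ) : DecayingCurve (airyCurve hA hσ h) :=
  decayingCurve_translate _ _

theorem decayingCurve_halfLineCurve (hA : IsHigherAiry ε A) : DecayingCurve (halfLineCurve hA) :=
  decayingCurve_translate _ _

theorem kernelK2_eq_inner (hA : IsHigherAiry ε A) (hσ : IsAdmissible σ)
    (h : SqrtWeightHilbertSchmidt A σ) (s x y : ℝ) :
    kernelK2 A σ s x y =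
      inner ℝ (airyCurve hA hσ h 0 (s + x)) (airyCurve hA hσ h 0 (s + y)) := by
  rw [airyCurve, inner_translate, integral_weight hσ, kernelK2]
  refine integral_congr_ae (ae_of_all _ fun r => ?_)
  simp only [iteratedDeriv_zero]
  rw [show x + s + r = r + (s + x) by ring, show y + s + r = r + (s + y) by ring, mul_assoc]

theorem isIntegralOperator_kernelK2 (hA : IsHigherAiry ε A) (hσ : IsAdmissible σ)
    (h : SqrtWeightHilbertSchmidt A σ) (s : ℝ) :
    IsIntegralOperator (kernelK2 A σ s) (curveAdj (decayingCurve_airyCurve hA hσ h) 0 s ∘L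
      curveB (decayingCurve_airyCurve hA hσ h) 0 s) := by
  have : kernelK2 A σ s = fun x y =>
      inner ℝ (airyCurve hA hσ h 0 (s + x)) (airyCurve hA hσ h 0 (s + y)) := by
    funext x y
    exact kernelK2_eq_inner hA hσ h s x y
  rw [this]
  exact isIntegralOperator_curve _ s

theorem opK2_eq (hA : IsHigherAiry ε A) (hσ : IsAdmissible σ)
    (h : SqrtWeightHilbertSchmidt A σ) (s : ℝ) :
    opK2 A σ s = curveAdj (decayingCurve_airyCurve hA hσ h) 0 s ∘L
      curveB (decayingCurve_airyCurve hA hσ h) 0 s :=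
  integralOperator_eq (isIntegralOperator_kernelK2 hA hσ h s)

theorem column_eq (hA : IsHigherAiry ε A) (hσ : IsAdmissible σ)
    (h : SqrtWeightHilbertSchmidt A σ) (s : ℝ) :
    (fun y => kernelK2 A σ s y 0) =
      fun y => inner ℝ (airyCurve hA hσ h 0 (s + y)) (airyCurve hA hσ h 0 s) := by
  funext y
  rw [kernelK2_eq_inner hA hσ h, add_zero]

theorem memLp_column (hA : IsHigherAiry ε A) (hσ : IsAdmissible σ)
    (h : SqrtWeightHilbertSchmidt A σ) (s : ℝ) :
    MemLp (fun y => kernelK2 A σ s y 0) 2 halfLine := by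
  rw [column_eq hA hσ h]
  exact (decayingCurve_airyCurve hA hσ h).memLp_inner 0 s _

theorem columnK2_eq (hA : IsHigherAiry ε A) (hσ : IsAdmissible σ)
    (h : SqrtWeightHilbertSchmidt A σ) (s : ℝ) :
    columnK2 A σ s = curveAdj (decayingCurve_airyCurve hA hσ h) 0 s (airyCurve hA hσ h 0 s) := by
  rw [columnK2, dif_pos (memLp_column hA hσ h s)]
  change _ = ((decayingCurve_airyCurve hA hσ h).memLp_inner 0 s _).toLp _
  congr 1
  exact column_eq hA hσ h s

theorem k2WellDefined (hA : IsHigherAiry ε A) (hσ : IsAdmissible σ)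
    (h : SqrtWeightHilbertSchmidt A σ) (s : ℝ) : K2WellDefined A σ s := by
  refine ⟨?_, memLp_column hA hσ h s⟩
  rw [opK2_eq hA hσ h]
  exact isIntegralOperator_kernelK2 hA hσ h s

theorem isUnit_opK2_iff (hA : IsHigherAiry ε A) (hσ : IsAdmissible σ)
    (h : SqrtWeightHilbertSchmidt A σ) (s : ℝ) :
    IsUnit (1 - opK2 A σ s) ↔ IsUnit (1 - curveOp (airyCurve hA hσ h) s) := by
  rw [opK2_eq hA hσ h]
  exact isUnit_curveOp_iff _ s

/-- The element of `L²(ℝ₊)` that represents the integral part of `q_j`. -/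
noncomputable def resolventVector (hA : IsHigherAiry ε A) (hσ : IsAdmissible σ)
    (h : SqrtWeightHilbertSchmidt A σ) (j : ℕ) (s : ℝ) : L2pos :=
  curveAdj (decayingCurve_airyCurve hA hσ h) 0 s
    (curveRes (airyCurve hA hσ h) s (airyCurve hA hσ h j s))

/-- The column of `K₂` is `W w(s)`, so `(1 - W W*)⁻¹ W = W (1 - W* W)⁻¹` applies. -/
theorem resolventColumn_eq (hA : IsHigherAiry ε A) (hσ : IsAdmissible σ)
    (h : SqrtWeightHilbertSchmidt A σ) {s : ℝ} (hs : IsUnit (1 - opK2 A σ s)) :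
    resolventColumn A σ s = resolventVector hA hσ h 0 s := by
  rw [opK2_eq hA hσ h] at hs
  rw [resolventColumn, columnK2_eq hA hσ h, opK2_eq hA hσ h, ringInverse_one_sub_comp_swap _ _ hs,
    resolventVector, curveRes, curveB_comp_curveAdj]

theorem inner_halfLineCurve (hA : IsHigherAiry ε A) (j : ℕ) (u : ℝ) (c : L2pos) :
    inner ℝ (halfLineCurve hA j u) c = ∫ y, iteratedDeriv j A (u + y) * c y ∂halfLine := by
  rw [L2.inner_def]
  refine integral_congr_ae ?_
  filter_upwards [coeFn_translate hA.decayingCurve hA.translatesL2_halfLine j u] with y hy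
  rw [halfLineCurve, hy, add_comm u y]
  simp [mul_comm]

theorem q0_eq_inner (hA : IsHigherAiry ε A) (σ : ℝ → ℝ) (s t : ℝ) :
    q0 A σ s t = A (t + s) + inner ℝ (halfLineCurve hA 0 (t + s)) (resolventColumn A σ s) := by
  rw [inner_halfLineCurve, q0]
  simp

theorem norm_halfLineCurve (hA : IsHigherAiry ε A) (u : ℝ) :
    ‖halfLineCurve hA 0 u‖ = tailNorm A u := by
  rw [← Real.sqrt_sq (norm_nonneg _), halfLineCurve, translate, toLp_two_norm_sq, tailNorm]
  simp [add_comm]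

/-- `q_j` as a function of `t`. -/
noncomputable def airyQ (hA : IsHigherAiry ε A) (hσ : IsAdmissible σ)
    (h : SqrtWeightHilbertSchmidt A σ) (j : ℕ) (s t : ℝ) : ℝ :=
  iteratedDeriv j A (t + s) + inner ℝ (halfLineCurve hA 0 (t + s)) (resolventVector hA hσ h j s)

/-- The derivative of `q_j` in `t`. -/
noncomputable def airyQt (hA : IsHigherAiry ε A) (hσ : IsAdmissible σ)
    (h : SqrtWeightHilbertSchmidt A σ) (j : ℕ) (s t : ℝ) : ℝ :=
  iteratedDeriv (j + 1) A (t + s)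
    + inner ℝ (halfLineCurve hA 1 (t + s)) (resolventVector hA hσ h j s)

theorem hasDerivAt_airyQ (hA : IsHigherAiry ε A) (hσ : IsAdmissible σ)
    (h : SqrtWeightHilbertSchmidt A σ) (j : ℕ) (s t : ℝ) :
    HasDerivAt (airyQ hA hσ h j s) (airyQt hA hσ h j s t) t := by
  have h1 := (hA.decayingCurve.hasDerivAt j (t + s)).comp_add_const t s
  have h2 := ((decayingCurve_halfLineCurve hA).hasDerivAt 0 (t + s)).comp_add_const t s
  refine (h1.add (h2.inner ℝ (hasDerivAt_const t (resolventVector hA hσ h j s)))).congr_deriv ?_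
  simp [airyQt]

theorem continuous_airyQt (hA : IsHigherAiry ε A) (hσ : IsAdmissible σ)
    (h : SqrtWeightHilbertSchmidt A σ) (j : ℕ) (s : ℝ) : Continuous (airyQt hA hσ h j s) := by
  have h1 := hA.decayingCurve.continuous (j + 1)
  have h2 := (decayingCurve_halfLineCurve hA).continuous 1
  unfold airyQt
  fun_prop

theorem coeFn_curveB_airyCurve (hA : IsHigherAiry ε A) (hσ : IsAdmissible σ)
    (h : SqrtWeightHilbertSchmidt A σ) (j : ℕ) (s : ℝ) (c : L2pos) :
    curveB (decayingCurve_airyCurve hA hσ h) j s c =ᵐ[weight σ]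
      fun r => inner ℝ (halfLineCurve hA j (r + s)) c := by
  simp only [inner_halfLineCurve]
  exact coeFn_curveB_translate hA.decayingCurve (translatesL2_weight hσ h) j s c

theorem curveRes_eq_add (hA : IsHigherAiry ε A) (hσ : IsAdmissible σ)
    (h : SqrtWeightHilbertSchmidt A σ) {s : ℝ} (hs : IsUnit (1 - opK2 A σ s)) (j : ℕ) :
    curveRes (airyCurve hA hσ h) s (airyCurve hA hσ h j s) = airyCurve hA hσ h j s
      + curveB (decayingCurve_airyCurve hA hσ h) 0 s (resolventVector hA hσ h j s) := by
  rw [isUnit_opK2_iff hA hσ h] at hs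
  rw [resolventVector, ← ContinuousLinearMap.comp_apply, curveB_comp_curveAdj, ← sub_eq_iff_eq_add]
  simpa [curveRes] using congrArg (fun S => S (airyCurve hA hσ h j s)) (Ring.mul_inverse_cancel _ hs)

/-- The functions `q_j` thus appear twice: pointwise in `t` they solve the system in `s`, and as
elements of `L²(σ)` they are `R w_j`. The second description makes their weighted products
computable in terms of the `u_ij`. -/
theorem coeFn_curveRes (hA : IsHigherAiry ε A) (hσ : IsAdmissible σ)
    (h : SqrtWeightHilbertSchmidt A σ) {s : ℝ} (hs : IsUnit (1 - opK2 A σ s)) (j : ℕ) :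
    curveRes (airyCurve hA hσ h) s (airyCurve hA hσ h j s) =ᵐ[weight σ] airyQ hA hσ h j s := by
  rw [curveRes_eq_add hA hσ h hs]
  filter_upwards [Lp.coeFn_add (airyCurve hA hσ h j s)
    (curveB (decayingCurve_airyCurve hA hσ h) 0 s (resolventVector hA hσ h j s)),
    coeFn_translate hA.decayingCurve (translatesL2_weight hσ h) j s,
    coeFn_curveB_airyCurve hA hσ h 0 s (resolventVector hA hσ h j s)] with r h1 h2 h3
  rw [h1, Pi.add_apply, h3, airyCurve, h2, airyQ]

theorem coeFn_airyQt (hA : IsHigherAiry ε A) (hσ : IsAdmissible σ)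
    (h : SqrtWeightHilbertSchmidt A σ) (j : ℕ) (s : ℝ) :
    ↑(airyCurve hA hσ h (j + 1) s
      + curveB (decayingCurve_airyCurve hA hσ h) 1 s (resolventVector hA hσ h j s))
      =ᵐ[weight σ] airyQt hA hσ h j s := by
  filter_upwards [Lp.coeFn_add (airyCurve hA hσ h (j + 1) s)
    (curveB (decayingCurve_airyCurve hA hσ h) 1 s (resolventVector hA hσ h j s)),
    coeFn_translate hA.decayingCurve (translatesL2_weight hσ h) (j + 1) s,
    coeFn_curveB_airyCurve hA hσ h 1 s (resolventVector hA hσ h j s)] with r h1 h2 h3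
  rw [h1, Pi.add_apply, h3, airyCurve, h2, airyQt]

theorem integrable_mul_of_ae_eq {f g : Lp ℝ 2 (weight σ)} {F G : ℝ → ℝ}
    (hF : f =ᵐ[weight σ] F) (hG : g =ᵐ[weight σ] G) :
    Integrable (fun r => F r * G r) (weight σ) ∧ ∫ r, F r * G r ∂weight σ = inner ℝ f g := by
  have e : (fun r => inner ℝ (f r) (g r)) =ᵐ[weight σ] fun r => F r * G r := by
    filter_upwards [hF, hG] with r h1 h2
    rw [h1, h2]
    simp [mul_comm]
  exact ⟨(L2.integrable_inner f g).congr e, by rw [L2.inner_def]; exact (integral_congr_ae e).symm⟩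

/-- The pairings of the functions `q_i` with respect to `σ'`. -/
theorem pairing_airyQ (hA : IsHigherAiry ε A) (hσ : IsAdmissible σ)
    (h : SqrtWeightHilbertSchmidt A σ) {s : ℝ} (hs : IsUnit (1 - opK2 A σ s)) (i j : ℕ) :
    Integrable (fun v => airyQ hA hσ h i s v * airyQ hA hσ h j s v) (dσ hσ.mono) ∧
      ∫ v, airyQ hA hσ h i s v * airyQ hA hσ h j s v ∂(dσ hσ.mono) =
        -(curveU (airyCurve hA hσ h) (i + 1) j s + curveU (airyCurve hA hσ h) i (j + 1) s
          - curveU (airyCurve hA hσ h) 0 i s * curveU (airyCurve hA hσ h) 0 j s) := by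
  have hc := decayingCurve_airyCurve hA hσ h
  have hd : ∀ r, HasDerivAt (fun v => airyQ hA hσ h i s v * airyQ hA hσ h j s v)
      (airyQt hA hσ h i s r * airyQ hA hσ h j s r + airyQ hA hσ h i s r * airyQt hA hσ h j s r) r :=
    fun r => (hasDerivAt_airyQ hA hσ h i s r).mul (hasDerivAt_airyQ hA hσ h j s r)
  have hQc : ∀ k, Continuous (airyQ hA hσ h k s) := fun k =>
    continuous_iff_continuousAt.2 fun r => (hasDerivAt_airyQ hA hσ h k s r).continuousAt
  have h0 := integrable_mul_of_ae_eq (coeFn_curveRes hA hσ h hs i) (coeFn_curveRes hA hσ h hs j)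
  have h1 := integrable_mul_of_ae_eq (coeFn_airyQt hA hσ h i s) (coeFn_curveRes hA hσ h hs j)
  have h2 := integrable_mul_of_ae_eq (coeFn_curveRes hA hσ h hs i) (coeFn_airyQt hA hσ h j s)
  -- The first integration by parts, in `v`, exchanges `σ'` for `σ` and puts a derivative on the
  -- product.
  obtain ⟨hi, he⟩ := hσ.integral_dσ hd
    (((continuous_airyQt hA hσ h i s).mul (hQc j)).add
      ((hQc i).mul (continuous_airyQt hA hσ h j s)))
    ((integrable_weight_iff hσ _).1 h0.1) ((integrable_weight_iff hσ _).1 (h1.1.add h2.1))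
  refine ⟨hi, ?_⟩
  rw [he, ← integral_weight hσ, integral_add h1.1 h2.1, h1.2, h2.2, inner_add_left,
    inner_add_right]
  -- The second one, along the curve, evaluates the terms in which the derivative falls under the
  -- integral over the half line.
  have h3 := inner_curveB_one_curveAdj_zero hc s
    (curveRes (airyCurve hA hσ h) s (airyCurve hA hσ h i s))
    (curveRes (airyCurve hA hσ h) s (airyCurve hA hσ h j s))
  have h4 : inner ℝ (curveRes (airyCurve hA hσ h) s (airyCurve hA hσ h i s))
      (airyCurve hA hσ h (j + 1) s) = curveU (airyCurve hA hσ h) i (j + 1) s := by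
    rw [curveU, inner_curveRes_left hc]
  rw [resolventVector, resolventVector, h4]
  simp only [curveU]
  linear_combination (-1 : ℝ) * h3

theorem integral_sub_mul_add_mul {μ : Measure ℝ} {f g k : ℝ → ℝ} (hf : Integrable f μ)
    (hg : Integrable g μ) (hk : Integrable k μ) (a b : ℝ) :
    ∫ v, (f v - a * g v + b * k v) ∂μ = (∫ v, f v ∂μ) - a * (∫ v, g v ∂μ) + b * ∫ v, k v ∂μ := by
  have h1 := integral_add (hf.sub (hg.const_mul a)) (hk.const_mul b)
  have h2 := integral_sub hf (hg.const_mul a)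
  simp only [Pi.sub_apply, integral_const_mul] at h1 h2
  rw [h1, h2]

/-- The functions `x ↦ A^{(j)}(t + x)`. -/
noncomputable def airyShift (A : ℝ → ℝ) (t : ℝ) : ℕ → ℝ → ℝ := fun j x => iteratedDeriv j A (t + x)

theorem decayingCurve_airyShift (hA : IsHigherAiry ε A) (t : ℝ) : DecayingCurve (airyShift A t) :=
  hA.decayingCurve.shift t

/-- The vector `m` is `W*` applied to `A(t+s+·)`; moving `W*` across the inner product recovers the
integral over `ℝ₊`. -/
theorem curveQ_eq_airyQ (hA : IsHigherAiry ε A) (hσ : IsAdmissible σ)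
    (h : SqrtWeightHilbertSchmidt A σ) (j : ℕ) (s t : ℝ) :
    curveQ (airyShift A t) (airyCurve hA hσ h) j s = airyQ hA hσ h j s t := by
  have hc := decayingCurve_airyCurve hA hσ h
  have hM : curveM (airyShift A t) (airyCurve hA hσ h) s =
      curveB hc 0 s (halfLineCurve hA 0 (t + s)) := by
    rw [curveM, curveB_apply,
      integral_Ioi_eq_halfLine (fun x => airyShift A t 0 x • airyCurve hA hσ h 0 x) s]
    refine integral_congr_ae ?_
    filter_upwards [coeFn_translate hA.decayingCurve hA.translatesL2_halfLine 0 (t + s)] with y hy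
    rw [halfLineCurve, hy, airyShift, add_comm y, add_assoc]
  rw [curveQ, hM, inner_curveB, airyQ, airyShift, resolventVector]

theorem q0_eq_airyQ (hA : IsHigherAiry ε A) (hσ : IsAdmissible σ)
    (h : SqrtWeightHilbertSchmidt A σ) {s : ℝ} (hs : IsUnit (1 - opK2 A σ s)) (t : ℝ) :
    q0 A σ s t = airyQ hA hσ h 0 s t := by
  rw [q0_eq_inner hA, resolventColumn_eq hA hσ h hs, airyQ, iteratedDeriv_zero]

/-- Each side equals `ε ∫ σ(r) r A(r+x) A(r+y) dr`. -/
theorem airyCurve_four (hA : IsHigherAiry ε A) (hσ : IsAdmissible σ)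
    (h : SqrtWeightHilbertSchmidt A σ) (x y : ℝ) :
    inner ℝ (airyCurve hA hσ h 0 x) (airyCurve hA hσ h 4 y)
        - ε * y * inner ℝ (airyCurve hA hσ h 0 x) (airyCurve hA hσ h 0 y) =
      inner ℝ (airyCurve hA hσ h 4 x) (airyCurve hA hσ h 0 y)
        - ε * x * inner ℝ (airyCurve hA hσ h 0 x) (airyCurve hA hσ h 0 y) := by
  have hi : ∀ i j, Integrable (fun r => iteratedDeriv i A (r + x) * iteratedDeriv j A (r + y))
      (weight σ) := fun i j =>
    (memLp_translate hA.decayingCurve (translatesL2_weight hσ h) i x).integrable_mul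
      (memLp_translate hA.decayingCurve (translatesL2_weight hσ h) j y)
  simp only [airyCurve, inner_translate]
  rw [← integral_const_mul, ← integral_const_mul, ← integral_sub (hi 0 4) ((hi 0 0).const_mul _),
    ← integral_sub (hi 4 0) ((hi 0 0).const_mul _)]
  refine integral_congr_ae (ae_of_all _ fun r => ?_)
  simp only [iteratedDeriv_zero, hA.ode]
  ring

theorem dq0_eq (hA : IsHigherAiry ε A) (hσ : IsAdmissible σ)
    (h : SqrtWeightHilbertSchmidt A σ) {s : ℝ} (hs : IsUnit (1 - opK2 A σ s)) (t : ℝ) :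
    ContDiffAt ℝ 4 (fun s' => q0 A σ s' t) s ∧ ∀ k ≤ 4, dq0 A σ k s t =
      resolventDeriv (fun j s => airyQ hA hσ h j s t) (curveU (airyCurve hA hσ h)) k s := by
  have hc := decayingCurve_airyCurve hA hσ h
  have hsys := resolventSystem_curve (decayingCurve_airyShift hA t) hc
  have hU := isOpen_isUnit_curveOp hc
  have hQ : curveQ (airyShift A t) (airyCurve hA hσ h) = fun j s => airyQ hA hσ h j s t := by
    funext j s
    exact curveQ_eq_airyQ hA hσ h j s t
  rw [hQ] at hsys
  have hs' : s ∈ {s | IsUnit (1 - curveOp (airyCurve hA hσ h) s)} :=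
    (isUnit_opK2_iff hA hσ h s).1 hs
  have he : (fun s' => q0 A σ s' t) =ᶠ[𝓝 s] fun s' => airyQ hA hσ h 0 s' t := by
    -- Invertibility is an open condition, so `q0` agrees with `airyQ` near `s` and not only at `s`.
    filter_upwards [hU.mem_nhds hs'] with s' hs''
    exact q0_eq_airyQ hA hσ h ((isUnit_opK2_iff hA hσ h s').2 hs'') t
  refine ⟨(hsys.contDiffAt hU hs').congr_of_eventuallyEq he, fun k hk => ?_⟩
  rw [dq0, he.iteratedDeriv_eq k]
  exact hsys.iteratedDeriv_eq hU hk hs'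

theorem secondMemberAt (hA : IsHigherAiry ε A) (hσ : IsAdmissible σ)
    (h : SqrtWeightHilbertSchmidt A σ) {s : ℝ} (hs : IsUnit (1 - opK2 A σ s)) :
    SecondMemberAt ε A hσ.mono s := by
  have hc := decayingCurve_airyCurve hA hσ h
  set Q := airyQ hA hσ h with hQ
  set u := curveU (airyCurve hA hσ h) with hu
  have hp := pairing_airyQ hA hσ h hs
  rw [← hQ, ← hu] at hp
  have hd := fun t => (dq0_eq hA hσ h hs t).2
  rw [← hQ, ← hu] at hd
  have hsymm : ∀ i j, u i j s = u j i s :=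
    fun i j => (resolventSystem_curve (decayingCurve_airyShift hA 0) hc).symm i j s
  have d0 : ∀ t, dq0 A σ 0 s t = Q 0 s t := fun t => hd t 0 (by norm_num)
  have d1 : ∀ t, dq0 A σ 1 s t = Q 1 s t - u 0 0 s * Q 0 s t := fun t => hd t 1 (by norm_num)
  have d2 : ∀ t, dq0 A σ 2 s t =
      Q 2 s t - u 0 0 s * Q 1 s t + (2 * u 0 0 s ^ 2 - 3 * u 0 1 s) * Q 0 s t :=
    fun t => hd t 2 (by norm_num)
  -- The coefficients do not depend on `t`, so the pairings of derivatives reduce to those of the `Q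
  -- j`.
  have hlin : ∀ k ≤ 2, ∃ a b c : ℝ, ∀ t, dq0 A σ k s t = a * Q 0 s t + b * Q 1 s t + c * Q 2 s t := by
    intro k hk
    interval_cases k
    · exact ⟨1, 0, 0, fun t => by rw [d0]; ring⟩
    · exact ⟨-u 0 0 s, 1, 0, fun t => by rw [d1]; ring⟩
    · exact ⟨2 * u 0 0 s ^ 2 - 3 * u 0 1 s, -u 0 0 s, 1, fun t => by rw [d2]; ring⟩
  have hint : ∀ i j : ℕ, i ≤ 2 → j ≤ 2 →
      Integrable (fun v => dq0 A σ i s v * dq0 A σ j s v) (dσ hσ.mono) := by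
    intro i j hi hj
    obtain ⟨a, b, c, h1⟩ := hlin i hi
    obtain ⟨a', b', c', h2⟩ := hlin j hj
    simp only [h1, h2]
    have := ((((hp 0 0).1.const_mul (a * a')).add ((hp 0 1).1.const_mul (a * b' + b * a'))).add
      (((hp 0 2).1.const_mul (a * c' + c * a')).add ((hp 1 1).1.const_mul (b * b')))).add
      (((hp 1 2).1.const_mul (b * c' + c * b')).add ((hp 2 2).1.const_mul (c * c')))
    refine this.congr (ae_of_all _ fun v => ?_)
    simp only [Pi.add_apply]
    ring
  refine ⟨fun t => (dq0_eq hA hσ h hs t).1, hint, fun t => ?_⟩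
  have h4 : Q 4 s t = ε * (s + t) * Q 0 s t + Q 3 s t * u 0 0 s - Q 2 s t * u 0 1 s
      + Q 1 s t * u 0 2 s - Q 0 s t * u 0 3 s := by
    have := curveQ_four (decayingCurve_airyShift hA t) hc (ε := ε) (t := t) (s := s)
      (fun x => by simp only [airyShift, iteratedDeriv_zero]; exact hA.ode (t + x))
      (airyCurve_four hA hσ h) ((isUnit_opK2_iff hA hσ h s).1 hs)
    simp only [curveQ_eq_airyQ] at this
    rw [add_comm s t]
    exact this
  have e00 : ∀ t, q0 A σ s t = Q 0 s t := q0_eq_airyQ hA hσ h hs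
  have p00 : pairing (dσ hσ.mono) (q0 A σ s) (q0 A σ s) = ∫ v, Q 0 s v * Q 0 s v ∂(dσ hσ.mono) := by
    simp only [pairing, e00]
  have p01 : pairing (dσ hσ.mono) (q0 A σ s) (dq0 A σ 1 s) =
      (∫ v, Q 0 s v * Q 1 s v ∂(dσ hσ.mono)) - u 0 0 s * ∫ v, Q 0 s v * Q 0 s v ∂(dσ hσ.mono) := by
    simp only [pairing, e00, d1]
    rw [← integral_const_mul, ← integral_sub (hp 0 1).1 ((hp 0 0).1.const_mul _)]
    exact integral_congr_ae (ae_of_all _ fun v => by ring)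
  have p02 : pairing (dσ hσ.mono) (q0 A σ s) (dq0 A σ 2 s) =
      (∫ v, Q 0 s v * Q 2 s v ∂(dσ hσ.mono)) - u 0 0 s * (∫ v, Q 0 s v * Q 1 s v ∂(dσ hσ.mono))
        + (2 * u 0 0 s ^ 2 - 3 * u 0 1 s) * ∫ v, Q 0 s v * Q 0 s v ∂(dσ hσ.mono) := by
    simp only [pairing, e00, d2]
    rw [← integral_sub_mul_add_mul (hp 0 2).1 (hp 0 1).1 (hp 0 0).1]
    exact integral_congr_ae (ae_of_all _ fun v => by ring)
  have p11 : pairing (dσ hσ.mono) (dq0 A σ 1 s) (dq0 A σ 1 s) =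
      (∫ v, Q 1 s v * Q 1 s v ∂(dσ hσ.mono))
        - 2 * u 0 0 s * (∫ v, Q 0 s v * Q 1 s v ∂(dσ hσ.mono))
        + u 0 0 s ^ 2 * ∫ v, Q 0 s v * Q 0 s v ∂(dσ hσ.mono) := by
    simp only [pairing, d1]
    rw [← integral_sub_mul_add_mul (hp 1 1).1 (hp 0 1).1 (hp 0 0).1]
    exact integral_congr_ae (ae_of_all _ fun v => by ring)
  have halg := secondMember_algebra (q := fun j s => Q j s t) (u := u) (s := s)
    (c := ε * (s + t)) h4
    ((hp 0 0).2.trans (by rw [hsymm (0 + 1) 0]; ring))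
    ((hp 0 1).2.trans (by ring))
    ((hp 0 2).2.trans (by norm_num))
    ((hp 1 1).2.trans (by rw [hsymm (1 + 1) 1]; ring))
  rw [← hd t 4 le_rfl, ← hd t 0 (by norm_num), ← hd t 1 (by norm_num), ← hd t 2 (by norm_num),
    d0, ← e00, ← p01, ← p02, ← p11, ← p00] at halg
  exact halg

/-- For `σ' = δ_0` the pairings are products of values at `0`, and the coefficients merge: `8 + 2 =
10` and `6 + 4 = 10`. -/
theorem painleveIISecondMemberAt (hA : IsHigherAiry ε A) (hσ : IsAdmissible σ)
    (h : SqrtWeightHilbertSchmidt A σ) {s : ℝ} (hs : IsUnit (1 - opK2 A σ s))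
    (hδ : dσ hσ.mono = Measure.dirac 0) :
    PainleveIISecondMemberAt ε (fun s' => q0 A σ s' 0) s := by
  have h1 := (secondMemberAt hA hσ h hs).2.2 0
  simp only [hδ, pairing, integral_dirac, dq0] at h1
  rw [PainleveIISecondMemberAt, h1]
  ring

/-! ### Behaviour as `s → +∞` -/

theorem norm_opK2_le (hA : IsHigherAiry ε A) (hσ : IsAdmissible σ)
    (h : SqrtWeightHilbertSchmidt A σ) (s : ℝ) :
    ‖opK2 A σ s‖ ≤ tailL2 (airyCurve hA hσ h) 0 s * tailL2 (airyCurve hA hσ h) 0 s := by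
  rw [opK2_eq hA hσ h]
  refine (ContinuousLinearMap.opNorm_comp_le _ _).trans ?_
  exact mul_le_mul (norm_curveAdj_le _ 0 s) (norm_curveB_le _ 0 s) (norm_nonneg _)
    (tailL2_nonneg 0 s)

theorem tendsto_norm_opK2 (hA : IsHigherAiry ε A) (hσ : IsAdmissible σ)
    (h : SqrtWeightHilbertSchmidt A σ) : Tendsto (fun s => ‖opK2 A σ s‖) atTop (𝓝 0) := by
  refine squeeze_zero (fun s => norm_nonneg _) (norm_opK2_le hA hσ h) ?_
  simpa using (tendsto_tailL2 (w := airyCurve hA hσ h) 0).mul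
    (tendsto_tailL2 (w := airyCurve hA hσ h) 0)

theorem eventually_isUnit (hA : IsHigherAiry ε A) (hσ : IsAdmissible σ)
    (h : SqrtWeightHilbertSchmidt A σ) : ∀ᶠ s in atTop, IsUnit (1 - opK2 A σ s) :=
  ((tendsto_norm_opK2 hA hσ h).eventually (eventually_lt_nhds one_pos)).mono fun _ hs =>
    isUnit_one_sub_of_norm_lt_one hs

/-- Once `‖K₂‖ < 1/2`, the equation `ρ = K₂(·,0) + K₂ ρ` gives `‖ρ‖ ≤ 2 ‖K₂(·,0)‖`, and the column
is at most `‖W‖ ‖w(s)‖`. -/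
theorem tendsto_resolventColumn (hA : IsHigherAiry ε A) (hσ : IsAdmissible σ)
    (h : SqrtWeightHilbertSchmidt A σ) : Tendsto (resolventColumn A σ) atTop (𝓝 0) := by
  rw [tendsto_zero_iff_norm_tendsto_zero]
  have hc := decayingCurve_airyCurve hA hσ h
  have h1 : Tendsto (fun s => 2 * (tailL2 (airyCurve hA hσ h) 0 s * ‖airyCurve hA hσ h 0 s‖)) atTop
      (𝓝 0) := by
    simpa using ((tendsto_tailL2 (w := airyCurve hA hσ h) 0).mul
      (hc.tendsto_zero 0).norm).const_mul 2
  refine squeeze_zero' (Eventually.of_forall fun s => norm_nonneg _) ?_ h1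
  filter_upwards [eventually_isUnit hA hσ h,
    (tendsto_norm_opK2 hA hσ h).eventually (eventually_lt_nhds (show (0 : ℝ) < 1 / 2 by norm_num))]
    with s hs hn
  have h2 : resolventColumn A σ s - opK2 A σ s (resolventColumn A σ s) = columnK2 A σ s := by
    simpa [resolventColumn] using
      congrArg (fun S => S (columnK2 A σ s)) (Ring.mul_inverse_cancel _ hs)
  have h3 : ‖columnK2 A σ s‖ ≤ tailL2 (airyCurve hA hσ h) 0 s * ‖airyCurve hA hσ h 0 s‖ := by
    rw [columnK2_eq hA hσ h]
    exact (ContinuousLinearMap.le_opNorm _ _).trans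
      (mul_le_mul_of_nonneg_right (norm_curveAdj_le _ 0 s) (norm_nonneg _))
  have h4 : ‖resolventColumn A σ s‖ ≤
      ‖columnK2 A σ s‖ + ‖opK2 A σ s (resolventColumn A σ s)‖ := by
    rw [sub_eq_iff_eq_add.1 h2]
    rw [← sub_eq_iff_eq_add.1 h2]
    conv_lhs => rw [sub_eq_iff_eq_add.1 h2]
    exact norm_add_le _ _
  have h5 := (opK2 A σ s).le_opNorm (resolventColumn A σ s)
  nlinarith [norm_nonneg (resolventColumn A σ s)]

/-- Cauchy–Schwarz: the error is at most the tail norm times `‖ρ‖`. -/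
theorem boundaryBehaviour (hA : IsHigherAiry ε A) (hσ : IsAdmissible σ)
    (h : SqrtWeightHilbertSchmidt A σ) : BoundaryBehaviour A σ := by
  intro t
  have h1 := (tendsto_resolventColumn hA hσ h)
  rw [isLittleO_iff]
  intro c hc
  filter_upwards [(tendsto_zero_iff_norm_tendsto_zero.1 h1).eventually (eventually_lt_nhds hc)]
    with s hs
  rw [q0_eq_inner hA, add_comm t s, add_sub_cancel_left]
  refine (norm_inner_le_norm _ _).trans ?_
  rw [norm_halfLineCurve hA, Real.norm_of_nonneg (by unfold tailNorm; positivity), mul_comm]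
  exact mul_le_mul_of_nonneg_right hs.le (by unfold tailNorm; positivity)

end HigherAiry

end PainleveHierarchy

namespace PainleveHierarchy

/-! ### Decaying solutions of `A'''' = x A` -/

theorem le_of_hasDerivAt_nonneg {f f' : ℝ → ℝ} {a b : ℝ} (hab : a ≤ b)
    (hf : ∀ x, HasDerivAt f (f' x) x) (h : ∀ x ∈ Icc a b, 0 ≤ f' x) : f a ≤ f b := by
  refine monotoneOn_of_deriv_nonneg (convex_Icc a b)
    (fun x _ => (hf x).continuousAt.continuousWithinAt)
    (fun x _ => (hf x).differentiableAt.differentiableWithinAt) (fun x hx => ?_)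
    (left_mem_Icc.2 hab) (right_mem_Icc.2 hab) hab
  rw [(hf x).deriv]
  exact h x (interior_subset hx)

theorem le_of_hasDerivAt_nonpos {f f' : ℝ → ℝ} {a b : ℝ} (hab : a ≤ b)
    (hf : ∀ x, HasDerivAt f (f' x) x) (h : ∀ x ∈ Icc a b, f' x ≤ 0) : f b ≤ f a := by
  have := le_of_hasDerivAt_nonneg (f := fun x => -f x) (f' := fun x => -f' x) hab
    (fun x => (hf x).neg) fun x hx => neg_nonneg.2 (h x hx)
  linarith

theorem nonneg_of_deriv_nonpos_of_tendsto {f f' : ℝ → ℝ} {a : ℝ}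
    (hf : ∀ x, HasDerivAt f (f' x) x) (h : ∀ x, a ≤ x → f' x ≤ 0)
    (hlim : Tendsto f atTop (𝓝 0)) : 0 ≤ f a :=
  le_of_tendsto hlim ((eventually_ge_atTop a).mono fun _ hb =>
    le_of_hasDerivAt_nonpos hb hf fun x hx => h x hx.1)

theorem nonpos_of_deriv_nonneg_of_tendsto {f f' : ℝ → ℝ} {a : ℝ}
    (hf : ∀ x, HasDerivAt f (f' x) x) (h : ∀ x, a ≤ x → 0 ≤ f' x)
    (hlim : Tendsto f atTop (𝓝 0)) : f a ≤ 0 :=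
  ge_of_tendsto hlim ((eventually_ge_atTop a).mono fun _ hb =>
    le_of_hasDerivAt_nonneg hb hf fun x hx => h x hx.1)

section PositiveAiry

variable {f : ℕ → ℝ → ℝ}

theorem DecayingCurve.neg (h : DecayingCurve f) : DecayingCurve fun j x => -f j x where
  hasDerivAt j x := (h.hasDerivAt j x).neg
  sq_integrable j s := by simpa using h.sq_integrable j s

theorem DecayingCurve.integrableOn_sq (h : DecayingCurve f) (j : ℕ) (s : ℝ) :
    IntegrableOn (fun x => f j x ^ 2) (Ioi s) := by
  simpa using h.sq_integrable j s

/-- The energy identity for decaying solutions of `f'''' = x f`. -/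
theorem positiveAiry_identity (h : DecayingCurve f) (h4 : ∀ x, f 4 x = x * f 0 x) (x : ℝ) :
    f 1 x * f 3 x = f 2 x ^ 2 / 2 + x * f 0 x ^ 2 / 2 + (∫ y in Ioi x, f 0 y ^ 2) / 2 := by
  have hd : ∀ y ∈ Ici x, HasDerivAt
      (fun y => f 1 y * f 3 y - f 2 y ^ 2 / 2 - y * f 0 y ^ 2 / 2) (-(f 0 y ^ 2 / 2)) y := by
    intro y _
    have d0 := h.hasDerivAt 0 y
    have d1 := h.hasDerivAt 1 y
    have d2 := h.hasDerivAt 2 y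
    have d3 := h.hasDerivAt 3 y
    refine (((d1.mul d3).sub ((d2.pow 2).div_const 2)).sub
      (((hasDerivAt_id y).mul (d0.pow 2)).div_const 2)).congr_deriv ?_
    norm_num [h4]
    ring
  have hlim : Tendsto (fun y => f 1 y * f 3 y - f 2 y ^ 2 / 2 - y * f 0 y ^ 2 / 2) atTop (𝓝 0) := by
    have t := h.tendsto_zero
    have := (((t 1).mul (t 3)).sub (((t 2).pow 2).div_const 2)).sub (((t 4).mul (t 0)).div_const 2)
    norm_num at this
    refine this.congr fun y => ?_
    rw [h4]
    ring
  have := integral_Ioi_of_hasDerivAt_of_tendsto' hd ((h.integrableOn_sq 0 x).div_const 2).neg hlim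
  rw [integral_neg, integral_div] at this
  linarith

/-- For `z ≥ 0` the energy identity writes `f' f'''` as a sum of nonnegative terms; a zero of `f'`
kills the tail integral of `f²`, hence `f` beyond `z`. -/
theorem positiveAiry_eqOn_zero (h : DecayingCurve f) (h4 : ∀ x, f 4 x = x * f 0 x) {z : ℝ}
    (hz : 0 ≤ z) (h1 : f 1 z = 0) : ∀ b, z < b → f 1 b = 0 := by
  have hid := positiveAiry_identity h h4 z
  have hT : ∫ y in Ioi z, f 0 y ^ 2 = 0 := by
    refine le_antisymm ?_ (integral_nonneg fun y => sq_nonneg _)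
    rw [h1, zero_mul] at hid
    nlinarith [sq_nonneg (f 2 z), mul_nonneg hz (sq_nonneg (f 0 z))]
  have hae := (integral_eq_zero_iff_of_nonneg (fun y => sq_nonneg (f 0 y))
    (h.integrableOn_sq 0 z)).1 hT
  have hEq : EqOn (fun y => f 0 y ^ 2) 0 (Ioi z) :=
    Measure.eqOn_open_of_ae_eq hae isOpen_Ioi ((h.continuous 0).pow 2).continuousOn
      continuousOn_const
  intro b hb
  have he : f 0 =ᶠ[𝓝 b] fun _ => 0 := by
    filter_upwards [Ioi_mem_nhds hb] with y hy
    simpa using hEq hy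
  have := (h.hasDerivAt 0 b).unique ((hasDerivAt_const b (0 : ℝ)).congr_of_eventuallyEq he)
  simpa using this

theorem positiveAiry_sign (h : DecayingCurve f) (h4 : ∀ x, f 4 x = x * f 0 x) :
    (∀ x, 1 ≤ x → f 1 x ≤ 0) ∨ ∀ x, 1 ≤ x → 0 ≤ f 1 x := by
  by_contra hcon
  push Not at hcon
  obtain ⟨⟨a, ha, ha'⟩, b, hb, hb'⟩ := hcon
  have hne : a ≠ b := by
    rintro rfl
    linarith
  obtain ⟨z, hz, hz0⟩ : ∃ z ∈ uIcc a b, f 1 z = 0 := by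
    have := intermediate_value_uIcc (h.continuous 1).continuousOn (a := a) (b := b)
    exact this (mem_uIcc.2 (Or.inr ⟨hb'.le, ha'.le⟩))
  have hz1 : 1 ≤ z := (le_min ha hb).trans hz.1
  have hzero := positiveAiry_eqOn_zero h h4 (by linarith) hz0
  have hza : z ≠ a := by
    rintro rfl
    linarith
  have hzb : z ≠ b := by
    rintro rfl
    linarith
  rcases lt_or_gt_of_ne hza with h1 | h1
  · linarith [hzero a h1]
  · rcases lt_or_gt_of_ne hzb with h2 | h2
    · linarith [hzero b h2]
    · have := hz.2
      rcases max_choice a b with hm | hm <;> rw [hm] at this <;> linarith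

theorem positiveAiry_tail_of_nonpos (h : DecayingCurve f) (h4 : ∀ x, f 4 x = x * f 0 x)
    (h1 : ∀ x, 1 ≤ x → f 1 x ≤ 0) {x : ℝ} (hx : 1 ≤ x) :
    ∫ y in Ioi x, f 0 y ^ 2 ≤ 7 / 2 * f 0 x ^ 2 := by
  have d := h.hasDerivAt
  have t := h.tendsto_zero
  have s0 : ∀ x, 1 ≤ x → 0 ≤ f 0 x := fun x hx =>
    nonneg_of_deriv_nonpos_of_tendsto (d 0) (fun y hy => h1 y (hx.trans hy)) (t 0)
  have s4 : ∀ x, 1 ≤ x → f 0 x ≤ f 4 x := fun x hx => by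
    rw [h4]
    exact le_mul_of_one_le_left (s0 x hx) hx
  have s3 : ∀ x, 1 ≤ x → f 3 x ≤ 0 := fun x hx =>
    nonpos_of_deriv_nonneg_of_tendsto (d 3)
      (fun y hy => (s0 y (hx.trans hy)).trans (s4 y (hx.trans hy))) (t 3)
  have s2 : ∀ x, 1 ≤ x → 0 ≤ f 2 x := fun x hx =>
    nonneg_of_deriv_nonpos_of_tendsto (d 2) (fun y hy => s3 y (hx.trans hy)) (t 2)
  -- With `m = f(x+1)`, `f'''' ≥ m` on `[x, x+1]`. Integrating down from `x+1`, where the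
  -- derivatives have alternating signs, gives `f'(x) ≤ -m/6`; convexity gives `f(x) + f'(x) ≤ m`.
  -- Hence the factor `7 = 6 + 1`, and the integral of `-7 f f'` is `7/2 f²`.
  have key : ∀ x, 1 ≤ x → f 0 x ≤ -7 * f 1 x := by
    intro x hx
    set m := f 0 (x + 1) with hm
    have hp : ∀ (n : ℕ) (c y : ℝ), HasDerivAt (fun y => c * (x + 1 - y) ^ (n + 1))
        (-(c * ((n + 1) * (x + 1 - y) ^ n))) y := by
      intro n c y
      have := (((hasDerivAt_id y).const_sub (x + 1)).pow (n + 1)).const_mul c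
      refine this.congr_deriv ?_
      simp
    have g0 : ∀ y ∈ Icc x (x + 1), m ≤ f 4 y := fun y hy =>
      (le_of_hasDerivAt_nonpos hy.2 (d 0) fun z hz => h1 z (by linarith [hz.1, hy.1])).trans
        (s4 y (hx.trans hy.1))
    have g3 : ∀ y ∈ Icc x (x + 1), f 3 y + m * (x + 1 - y) ≤ 0 := by
      intro y hy
      have := le_of_hasDerivAt_nonneg hy.2 (fun z => (d 3 z).add (hp 0 m z)) fun z hz => by
        have := g0 z ⟨hy.1.trans hz.1, hz.2⟩
        norm_num
        linarith
      have h3 := s3 (x + 1) (by linarith)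
      norm_num at this
      linarith
    have g2 : ∀ y ∈ Icc x (x + 1), 0 ≤ f 2 y - m / 2 * (x + 1 - y) ^ 2 := by
      intro y hy
      have := le_of_hasDerivAt_nonpos hy.2 (fun z => (d 2 z).sub (hp 1 (m / 2) z)) fun z hz => by
        have := g3 z ⟨hy.1.trans hz.1, hz.2⟩
        norm_num
        linarith
      have h3 := s2 (x + 1) (by linarith)
      norm_num at this
      linarith
    have g1 : f 1 x + m / 6 * (x + 1 - x) ^ 3 ≤ 0 := by
      have := le_of_hasDerivAt_nonneg (show x ≤ x + 1 by linarith)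
        (fun z => (d 1 z).add (hp 2 (m / 6) z)) fun z hz => by
          have := g2 z hz
          norm_num
          linarith
      have h3 := h1 (x + 1) (by linarith)
      norm_num at this
      norm_num
      linarith
    have g : f 0 x + f 1 x ≤ m := by
      have := le_of_hasDerivAt_nonneg (show x ≤ x + 1 by linarith)
        (fun z => (d 0 z).sub ((hasDerivAt_id z).mul_const (f 1 x))) fun z hz => by
          have := le_of_hasDerivAt_nonneg hz.1 (d 1) fun w hw => s2 w (hx.trans hw.1)
          norm_num
          linarith
      simp only [Pi.sub_apply, id] at this
      linarith
    norm_num at g1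
    linarith
  have hprod : IntegrableOn (fun y => -7 * (f 0 y * f 1 y)) (Ioi x) :=
    h.integrableOn_of_norm_le h 0 1 x
      (continuous_const.mul ((h.continuous _).mul (h.continuous _))) (C := 7) fun x => by simp
  have hint := integral_Ioi_of_hasDerivAt_of_tendsto' (a := x)
    (f := fun y => -(7 / 2) * f 0 y ^ 2) (f' := fun y => -7 * (f 0 y * f 1 y)) (m := 0)
    (fun y _ => (((d 0 y).pow 2).const_mul (-(7 / 2))).congr_deriv (by norm_num; ring)) hprod
    (by simpa using ((t 0).pow 2).const_mul (-(7 / 2)))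
  have hle : ∫ y in Ioi x, f 0 y ^ 2 ≤ ∫ y in Ioi x, -7 * (f 0 y * f 1 y) := by
    refine setIntegral_mono_on (h.integrableOn_sq 0 x) hprod measurableSet_Ioi fun y hy => ?_
    have hy1 : 1 ≤ y := hx.trans (le_of_lt hy)
    nlinarith [key y hy1, s0 y hy1]
  linarith

theorem positiveAiry_tail (h : DecayingCurve f) (h4 : ∀ x, f 4 x = x * f 0 x) {x : ℝ}
    (hx : 1 ≤ x) : ∫ y in Ioi x, f 0 y ^ 2 ≤ 7 / 2 * f 0 x ^ 2 := by
  rcases positiveAiry_sign h h4 with h1 | h1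
  · exact positiveAiry_tail_of_nonpos h h4 h1 hx
  · have := positiveAiry_tail_of_nonpos h.neg (fun x => by rw [h4]; ring)
      (fun x hx => neg_nonpos.2 (h1 x hx)) hx
    simpa using this

end PositiveAiry

theorem isEquivalent_of_positive {A σ : ℝ → ℝ} (hA : IsHigherAiry 1 A)
    (hb : BoundaryBehaviour A σ) (t : ℝ) : (fun s => q0 A σ s t) ~[atTop] fun s => A (s + t) := by
  refine (hb t).trans_isBigO ?_
  refine IsBigO.of_bound (Real.sqrt (7 / 2)) ?_
  filter_upwards [eventually_ge_atTop (1 - t)] with s hs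
  have h1 := positiveAiry_tail hA.decayingCurve
    (fun x => by simpa using hA.ode x) (x := s + t) (by linarith)
  rw [tailNorm, Real.norm_of_nonneg (Real.sqrt_nonneg _), Real.norm_eq_abs, ← Real.sqrt_sq_eq_abs,
    ← Real.sqrt_mul (by norm_num)]
  refine Real.sqrt_le_sqrt ?_
  rw [integral_Ioi_eq_halfLine (fun y => iteratedDeriv 0 A y ^ 2)] at h1
  simpa using h1

end PainleveHierarchy

namespace PainleveHierarchy

/-! ### Plancherel's identity for integrable functions -/

section Plancherel

open FourierTransform
open scoped SchwartzMap ContDiff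

theorem continuous_fourier {h : ℝ → ℂ} (hi : Integrable h) : Continuous (𝓕 h) :=
  VectorFourier.fourierIntegral_continuous (L := innerₗ ℝ) Real.continuous_fourierChar
    continuous_inner hi

/-- The `L²` transform and the integral define the same distribution: both are moved onto the test
function by the self-adjointness of the Fourier transform. -/
theorem fourier_toLp_ae_eq {h : ℝ → ℂ} (hi : Integrable h) (h2 : MemLp h 2) :
    (𝓕 (h2.toLp h) : Lp ℂ 2 (volume : Measure ℝ)) =ᵐ[volume] 𝓕 h := by
  refine ae_eq_of_integral_contDiff_smul_eq
    ((Lp.memLp _).locallyIntegrable one_le_two) (continuous_fourier hi).locallyIntegrable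
    fun g g_smooth g_cpt => ?_
  have hg₁ : HasCompactSupport (Complex.ofRealCLM ∘ g) := g_cpt.comp_left rfl
  have hg₂ : ContDiff ℝ ∞ (Complex.ofRealCLM ∘ g) := by fun_prop
  set G : 𝓢(ℝ, ℂ) := hg₁.toSchwartzMap hg₂ with hG
  have hGg : ∀ x, G x = (g x : ℂ) := fun x => by simp [hG]
  have h1 : ∫ x, g x • (𝓕 (h2.toLp h) : Lp ℂ 2 (volume : Measure ℝ)) x =
      Lp.toTemperedDistribution (𝓕 (h2.toLp h) : Lp ℂ 2 (volume : Measure ℝ)) G := by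
    rw [Lp.toTemperedDistribution_apply]
    refine integral_congr_ae (ae_of_all _ fun x => ?_)
    simp [hGg]
  have h3 : ∫ x, (𝓕 (G : ℝ → ℂ)) x • h x = ∫ x, G x • (𝓕 h) x := by
    simpa using! VectorFourier.integral_fourierIntegral_smul_eq_flip (L := innerₗ ℝ)
      Real.continuous_fourierChar continuous_inner G.integrable hi
  rw [h1, ← Lp.fourier_toTemperedDistribution_eq, TemperedDistribution.fourier_apply,
    Lp.toTemperedDistribution_apply]
  calc ∫ x, (𝓕 G) x • (h2.toLp h) x = ∫ x, (𝓕 (G : ℝ → ℂ)) x • h x := by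
        refine integral_congr_ae ?_
        filter_upwards [h2.coeFn_toLp] with x hx
        rw [hx, SchwartzMap.fourier_coe]
    _ = ∫ x, g x • (𝓕 h) x := by
        rw [h3]
        refine integral_congr_ae (ae_of_all _ fun x => ?_)
        simp [hGg]

theorem lintegral_fourier_sq {h : ℝ → ℂ} (hi : Integrable h) (h2 : MemLp h 2) :
    ∫⁻ x, ‖(𝓕 h) x‖ₑ ^ 2 = ∫⁻ x, ‖h x‖ₑ ^ 2 := by
  have h1 : eLpNorm (𝓕 h) 2 volume = eLpNorm h 2 volume := by
    rw [← eLpNorm_congr_ae (fourier_toLp_ae_eq hi h2), ← eLpNorm_congr_ae h2.coeFn_toLp,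
      ← Lp.enorm_def, ← Lp.enorm_def, ← ofReal_norm, ← ofReal_norm, Lp.norm_fourier_eq]
  have e : ∀ f : ℝ → ℂ, ∫⁻ x, ‖f x‖ₑ ^ 2 = eLpNorm f 2 volume ^ 2 := fun f => by
    rw [eLpNorm_eq_lintegral_rpow_enorm_toReal two_ne_zero ENNReal.ofNat_ne_top,
      ← ENNReal.rpow_two, ← ENNReal.rpow_mul]
    simp
  rw [e, e, h1]

/-- Plancherel's identity, with the normalization `∫ e^{iur} h(u) du`. -/
theorem lintegral_exp_sq {h : ℝ → ℂ} (hi : Integrable h) (h2 : MemLp h 2) :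
    ∫⁻ r : ℝ, ‖∫ u : ℝ, Complex.exp (Complex.I * u * r) * h u‖ₑ ^ 2 =
      ENNReal.ofReal (2 * Real.pi) * ∫⁻ u, ‖h u‖ₑ ^ 2 := by
  have hpi := Real.pi_pos
  -- Evaluating the normalized transform at frequency `-r/(2π)`; the change of variable produces the
  -- factor `2π`.
  have e : ∀ r : ℝ, ∫ u : ℝ, Complex.exp (Complex.I * u * r) * h u =
      (𝓕 h) (-(2 * Real.pi)⁻¹ * r) := fun r => by
    rw [Real.fourier_real_eq_integral_exp_smul]
    refine integral_congr_ae (ae_of_all _ fun u => ?_)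
    simp only [smul_eq_mul]
    congr 2
    have : -2 * Real.pi * u * (-(2 * Real.pi)⁻¹ * r) = u * r := by
      field_simp
    rw [this]
    push_cast
    ring
  simp only [e]
  have hne : -(2 * Real.pi)⁻¹ ≠ 0 := by
    simp
  have hm : Measurable fun x => ‖(𝓕 h) x‖ₑ ^ 2 :=
    (continuous_fourier hi).enorm.measurable.pow_const 2
  have := lintegral_map (μ := (volume : Measure ℝ)) hm (measurable_const_mul (-(2 * Real.pi)⁻¹))
  rw [← this, Real.map_volume_mul_left hne, lintegral_smul_measure, lintegral_fourier_sq hi h2]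
  congr 2
  rw [inv_neg, inv_inv, abs_neg, abs_of_pos (by positivity)]

end Plancherel

end PainleveHierarchy

namespace PainleveHierarchy

/-! ### The contour integral -/

/-- The integrand `(ik)ⁿ exp(i k⁵/5 + i k z)`, as a function of `k`. -/
noncomputable def airyPhase (n : ℕ) (z k : ℂ) : ℂ :=
  (Complex.I * k) ^ n * Complex.exp (Complex.I * k ^ 5 / 5 + Complex.I * k * z)

/-- The point `u + iδ` of the contour. -/
noncomputable def contour (δ u : ℝ) : ℂ := (u : ℂ) + δ * Complex.I

/-- The integral of `airyPhase` over the line `Im k = δ`. -/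
noncomputable def airyInt (n : ℕ) (δ : ℝ) (z : ℂ) : ℂ := ∫ u : ℝ, airyPhase n z (contour δ u)

theorem continuous_airyPhase_contour (n : ℕ) (δ : ℝ) (z : ℂ) :
    Continuous fun u => airyPhase n z (contour δ u) := by
  unfold airyPhase contour
  fun_prop

theorem norm_exp_contour (δ u : ℝ) (z : ℂ) :
    ‖Complex.exp (Complex.I * contour δ u ^ 5 / 5 + Complex.I * contour δ u * z)‖ =
      Real.exp (-(δ * u ^ 4) + 2 * δ ^ 3 * u ^ 2 - δ ^ 5 / 5 - δ * z.re - u * z.im) := by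
  rw [Complex.norm_exp]
  congr 1
  have h5 : Complex.I * contour δ u ^ 5 / 5 =
      (((-(δ * u ^ 4) + 2 * δ ^ 3 * u ^ 2 - δ ^ 5 / 5 : ℝ)) : ℂ)
        + ((u ^ 5 / 5 - 2 * u ^ 3 * δ ^ 2 + u * δ ^ 4 : ℝ) : ℂ) * Complex.I := by
    have hI2 : Complex.I ^ 2 = -1 := Complex.I_sq
    have hI3 : Complex.I ^ 3 = -Complex.I := by rw [pow_succ, hI2]; ring
    have hI4 : Complex.I ^ 4 = 1 := Complex.I_pow_four
    have hI5 : Complex.I ^ 5 = Complex.I := by rw [pow_succ, hI4]; ring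
    have hI6 : Complex.I ^ 6 = -1 := by rw [pow_succ, hI5, ← sq, hI2]
    unfold contour
    push_cast
    ring_nf
    simp only [hI2, hI3, hI4, hI5, hI6]
    ring_nf
  have h1 : (Complex.I * contour δ u * z).re = -δ * z.re - u * z.im := by
    simp [contour]
  rw [Complex.add_re, h1, h5, Complex.add_re, Complex.ofReal_re, Complex.re_ofReal_mul,
    Complex.I_re]
  ring

theorem norm_airyPhase (n : ℕ) (δ u : ℝ) (z : ℂ) :
    ‖airyPhase n z (contour δ u)‖ = ‖contour δ u‖ ^ n *
      Real.exp (-(δ * u ^ 4) + 2 * δ ^ 3 * u ^ 2 - δ ^ 5 / 5 - δ * z.re - u * z.im) := by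
  rw [airyPhase, norm_mul, norm_exp_contour, norm_pow, norm_mul, Complex.norm_I, one_mul]

/-- A bound for the integrand which is locally uniform in `δ > 0` and in `z`. -/
theorem exists_bound_airyPhase (n : ℕ) {a b X : ℝ} (ha : 0 < a) :
    ∃ C, ∀ δ ∈ Icc a b, ∀ z : ℂ, ‖z‖ ≤ X → ∀ u : ℝ,
      ‖airyPhase n z (contour δ u)‖ ≤ C * Real.exp (-(1 / 2) * u ^ 2) := by
  rcases lt_or_ge b a with hab | hab
  · exact ⟨0, fun δ hδ => absurd (hδ.1.trans hδ.2) (not_le.2 hab)⟩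
  have hb : 0 < b := ha.trans_le hab
  -- `M` collects the coefficients of `u²`: `2b³` from the phase, `1/2` each from `e2` and `e3`, and
  -- `1/2` reserved for the Gaussian. The quartic absorbs them by completing the square in `u²`,
  -- with some room to spare.
  set M := 2 * b ^ 3 + 1 + 1 / 2 with hM
  refine ⟨n.factorial * Real.exp (b + b * X + X ^ 2 / 2 + 1 / 2 + (M + 1) ^ 2 / (4 * a)),
    fun δ hδ z hz u => ?_⟩
  have hδ0 : 0 < δ := ha.trans_le hδ.1
  rw [norm_airyPhase]
  have hk : ‖contour δ u‖ ≤ |u| + b := by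
    unfold contour
    refine (norm_add_le _ _).trans ?_
    rw [norm_mul, Complex.norm_I, mul_one, Complex.norm_real, Complex.norm_real, Real.norm_eq_abs,
      Real.norm_of_nonneg hδ0.le]
    linarith [hδ.2]
  have hpow : ‖contour δ u‖ ^ n ≤ n.factorial * Real.exp (|u| + b) := by
    have h1 := Real.pow_div_factorial_le_exp (|u| + b) (by positivity) n
    rw [div_le_iff₀ (by positivity)] at h1
    calc ‖contour δ u‖ ^ n ≤ (|u| + b) ^ n := pow_le_pow_left₀ (norm_nonneg _) hk n
      _ ≤ _ := by linarith
  have hre : |z.re| ≤ X := (Complex.abs_re_le_norm z).trans hz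
  have him : |z.im| ≤ X := (Complex.abs_im_le_norm z).trans hz
  have hX : 0 ≤ X := (abs_nonneg _).trans hre
  have e1 : -(δ * z.re) ≤ b * X := by
    have : -(δ * z.re) ≤ δ * |z.re| := by nlinarith [neg_abs_le z.re]
    exact this.trans (mul_le_mul hδ.2 hre (abs_nonneg _) hb.le)
  have e2 : -(u * z.im) ≤ u ^ 2 / 2 + X ^ 2 / 2 := by
    have h1 : z.im ^ 2 ≤ X ^ 2 := sq_le_sq' (by linarith [neg_abs_le z.im]) ((le_abs_self _).trans him)
    nlinarith [sq_nonneg (u + z.im)]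
  have e3 : |u| ≤ u ^ 2 / 2 + 1 / 2 := by nlinarith [sq_nonneg (|u| - 1), sq_abs u]
  have e4 : 2 * δ ^ 3 * u ^ 2 ≤ 2 * b ^ 3 * u ^ 2 := by
    have := pow_le_pow_left₀ hδ0.le hδ.2 3
    gcongr
  have e5 : a * u ^ 4 ≤ δ * u ^ 4 := by
    gcongr
    exact hδ.1
  have e6 : (M + 1) * u ^ 2 - a * u ^ 4 ≤ (M + 1) ^ 2 / (4 * a) := by
    rw [le_div_iff₀ (by positivity)]
    nlinarith [sq_nonneg (2 * a * u ^ 2 - (M + 1))]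
  have e7 : 0 ≤ δ ^ 5 / 5 := by positivity
  calc ‖contour δ u‖ ^ n *
        Real.exp (-(δ * u ^ 4) + 2 * δ ^ 3 * u ^ 2 - δ ^ 5 / 5 - δ * z.re - u * z.im)
      ≤ n.factorial * Real.exp (|u| + b) *
        Real.exp (-(δ * u ^ 4) + 2 * δ ^ 3 * u ^ 2 - δ ^ 5 / 5 - δ * z.re - u * z.im) := by
        gcongr
    _ ≤ _ := by
        rw [mul_assoc (n.factorial : ℝ), mul_assoc (n.factorial : ℝ), ← Real.exp_add,
          ← Real.exp_add]
        refine mul_le_mul_of_nonneg_left (Real.exp_le_exp.2 ?_) (by positivity)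
        nlinarith [sq_nonneg u]

theorem integrable_gauss : Integrable fun u : ℝ => Real.exp (-(1 / 2) * u ^ 2) :=
  integrable_exp_neg_mul_sq (by norm_num)

theorem integrable_airyPhase (n : ℕ) {δ : ℝ} (hδ : 0 < δ) (z : ℂ) :
    Integrable fun u => airyPhase n z (contour δ u) := by
  obtain ⟨C, hC⟩ := exists_bound_airyPhase n (a := δ) (b := δ) (X := ‖z‖) hδ
  exact (integrable_gauss.const_mul C).mono' (continuous_airyPhase_contour n δ z).aestronglyMeasurable
    (ae_of_all _ fun u => hC δ ⟨le_rfl, le_rfl⟩ z le_rfl u)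

theorem hasDerivAt_airyPhase (n : ℕ) (z k : ℂ) :
    HasDerivAt (fun z => airyPhase n z k) (airyPhase (n + 1) z k) z := by
  have h1 : HasDerivAt (fun z => Complex.I * k ^ 5 / 5 + Complex.I * k * z) (Complex.I * k) z := by
    simpa using ((hasDerivAt_id z).const_mul (Complex.I * k)).const_add (Complex.I * k ^ 5 / 5)
  refine (h1.cexp.const_mul ((Complex.I * k) ^ n)).congr_deriv ?_
  rw [airyPhase]
  ring

/-- Since `(ik)⁴ = k⁴`, the combination `A'''' + zA` is the integral of an exact derivative in `k`.
Both the differential equation and the independence of the contour come from this. -/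
theorem hasDerivAt_airyPhase_right (z k : ℂ) :
    HasDerivAt (fun k => airyPhase 0 z k)
      (Complex.I * (airyPhase 4 z k + z * airyPhase 0 z k)) k := by
  have h1 : HasDerivAt (fun k => Complex.I * k ^ 5 / 5 + Complex.I * k * z)
      (Complex.I * k ^ 4 + Complex.I * z) k := by
    refine ((((hasDerivAt_id k).pow 5).const_mul Complex.I).div_const 5).add
      (((hasDerivAt_id k).const_mul Complex.I).mul_const z) |>.congr_deriv ?_
    simp
    ring
  have h2 : (fun k => airyPhase 0 z k) =
      fun k => Complex.exp (Complex.I * k ^ 5 / 5 + Complex.I * k * z) := by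
    funext k
    simp [airyPhase]
  rw [h2]
  refine h1.cexp.congr_deriv ?_
  rw [airyPhase, airyPhase, mul_pow, Complex.I_pow_four]
  ring

theorem hasDerivAt_airyInt (n : ℕ) {δ : ℝ} (hδ : 0 < δ) (z : ℂ) :
    HasDerivAt (airyInt n δ) (airyInt (n + 1) δ z) z := by
  obtain ⟨C, hC⟩ := exists_bound_airyPhase (n + 1) (a := δ) (b := δ) (X := ‖z‖ + 1) hδ
  refine (hasDerivAt_integral_of_dominated_loc_of_deriv_le (Metric.ball_mem_nhds z one_pos)
    (Eventually.of_forall fun w => (continuous_airyPhase_contour n δ w).aestronglyMeasurable)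
    (integrable_airyPhase n hδ z) (continuous_airyPhase_contour (n + 1) δ z).aestronglyMeasurable
    (ae_of_all _ fun u w hw => hC δ ⟨le_rfl, le_rfl⟩ w ?_ u) (integrable_gauss.const_mul C)
    (ae_of_all _ fun u w _ => hasDerivAt_airyPhase n w _)).2
  have : ‖w - z‖ < 1 := by simpa [dist_eq_norm] using hw
  calc ‖w‖ = ‖z + (w - z)‖ := by congr 1; ring
    _ ≤ ‖z‖ + ‖w - z‖ := norm_add_le _ _
    _ ≤ ‖z‖ + 1 := by linarith

theorem hasDerivAt_contour (δ u : ℝ) : HasDerivAt (contour δ) 1 u := by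
  exact ((hasDerivAt_id u).ofReal_comp).add_const ((δ : ℂ) * Complex.I)

theorem hasDerivAt_contour_left (δ u : ℝ) : HasDerivAt (fun δ => contour δ u) Complex.I δ := by
  refine ((((hasDerivAt_id δ).ofReal_comp).mul_const Complex.I).const_add (u : ℂ)).congr_deriv ?_
  simp

/-- The differential equation, for the contour integral. -/
theorem airyInt_four {δ : ℝ} (hδ : 0 < δ) (z : ℂ) : airyInt 4 δ z + z * airyInt 0 δ z = 0 := by
  have hd : ∀ u, HasDerivAt (fun u => airyPhase 0 z (contour δ u))
      (Complex.I * (airyPhase 4 z (contour δ u) + z * airyPhase 0 z (contour δ u))) u := fun u => by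
    have h := (hasDerivAt_airyPhase_right z (contour δ u)).scomp u (hasDerivAt_contour δ u)
    rw [one_smul] at h
    exact h
  have h4 := integrable_airyPhase 4 hδ z
  have h0 := integrable_airyPhase 0 hδ z
  have h := integral_eq_zero_of_hasDerivAt_of_integrable hd
    ((h4.add (h0.const_mul z)).const_mul Complex.I) h0
  rw [integral_const_mul, integral_add h4 (h0.const_mul z), integral_const_mul] at h
  exact (mul_eq_zero.1 h).resolve_left Complex.I_ne_zero

/-- The contour integral does not depend on the contour. -/
theorem airyInt_zero_eq {δ δ' : ℝ} (hδ : 0 < δ) (hδ' : 0 < δ') (z : ℂ) :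
    airyInt 0 δ z = airyInt 0 δ' z := by
  -- A derivative in `δ` is `i` times a derivative in `k`, whose integral along the line is zero by
  -- `airyInt_four`.
  have hd : ∀ δ ∈ Ioi (0 : ℝ), HasDerivAt (fun δ => airyInt 0 δ z) 0 δ := by
    intro δ hδ
    have hδ : 0 < δ := hδ
    obtain ⟨C4, hC4⟩ := exists_bound_airyPhase 4 (a := δ / 2) (b := 2 * δ) (X := ‖z‖) (by linarith)
    obtain ⟨C0, hC0⟩ := exists_bound_airyPhase 0 (a := δ / 2) (b := 2 * δ) (X := ‖z‖) (by linarith)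
    have hdd : ∀ u δ, HasDerivAt (fun δ => airyPhase 0 z (contour δ u))
        (Complex.I * (airyPhase 4 z (contour δ u) + z * airyPhase 0 z (contour δ u))
          * Complex.I) δ := fun u δ => by
      have h := (hasDerivAt_airyPhase_right z (contour δ u)).scomp δ (hasDerivAt_contour_left δ u)
      rw [smul_eq_mul, mul_comm] at h
      exact h
    have hint := (hasDerivAt_integral_of_dominated_loc_of_deriv_le (𝕜 := ℝ)
      (F := fun δ u => airyPhase 0 z (contour δ u))
      (F' := fun δ u => Complex.I * (airyPhase 4 z (contour δ u)
        + z * airyPhase 0 z (contour δ u)) * Complex.I)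
      (bound := fun u => (C4 + ‖z‖ * C0) * Real.exp (-(1 / 2) * u ^ 2)) (x₀ := δ)
      (s := Icc (δ / 2) (2 * δ)) (Icc_mem_nhds (by linarith) (by linarith))
      (Eventually.of_forall fun w => (continuous_airyPhase_contour 0 w z).aestronglyMeasurable)
      (integrable_airyPhase 0 hδ z) ?_ (ae_of_all _ fun u w hw => ?_)
      (integrable_gauss.const_mul _) (ae_of_all _ fun u w _ => hdd u w)).2
    · refine hint.congr_deriv ?_
      have h4 := integrable_airyPhase 4 hδ z
      have h0 := integrable_airyPhase 0 hδ z
      rw [integral_mul_const, integral_const_mul, integral_add h4 (h0.const_mul z),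
        integral_const_mul]
      have := airyInt_four hδ z
      unfold airyInt at this
      rw [this]
      simp
    · exact ((continuous_const.mul ((continuous_airyPhase_contour 4 δ z).add
        (continuous_const.mul (continuous_airyPhase_contour 0 δ z)))).mul
          continuous_const).aestronglyMeasurable
    · rw [norm_mul, norm_mul, Complex.norm_I, one_mul, mul_one]
      refine (norm_add_le _ _).trans ?_
      rw [norm_mul]
      have h1 := hC4 w hw z le_rfl u
      have h2 := mul_le_mul_of_nonneg_left (hC0 w hw z le_rfl u) (norm_nonneg z)
      nlinarith
  exact isOpen_Ioi.is_const_of_deriv_eq_zero isPreconnected_Ioi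
    (fun δ hδ => (hd δ hδ).differentiableAt.differentiableWithinAt)
    (fun δ hδ => (hd δ hδ).deriv) hδ hδ'

theorem airyInt_eq (n : ℕ) {δ δ' : ℝ} (hδ : 0 < δ) (hδ' : 0 < δ') (z : ℂ) :
    airyInt n δ z = airyInt n δ' z := by
  induction n generalizing z with
  | zero => exact airyInt_zero_eq hδ hδ' z
  | succ n ih =>
    rw [← (hasDerivAt_airyInt n hδ z).deriv, ← (hasDerivAt_airyInt n hδ' z).deriv]
    congr 1
    exact funext ih

theorem conj_airyInt_zero (x : ℝ) :
    (starRingEnd ℂ) (airyInt 0 1 x) = airyInt 0 1 x := by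
  have h := integral_neg_eq_self (fun u : ℝ => airyPhase 0 x (contour 1 u)) volume
  rw [airyInt, ← integral_conj, ← h]
  refine integral_congr_ae (ae_of_all _ fun u => ?_)
  have hc : (starRingEnd ℂ) (contour 1 u) = -contour 1 (-u) := by
    simp [contour]
    ring
  simp only [airyPhase, pow_zero, one_mul, ← Complex.exp_conj, map_add, map_mul, map_div₀, map_pow,
    hc, Complex.conj_I, Complex.conj_ofReal, map_ofNat]
  congr 1
  ring

theorem Ai5_eq (x : ℝ) : Ai5 x = (1 / (2 * Real.pi)) * (airyInt 0 1 x).re := by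
  rw [Ai5, airyInt]
  congr 3
  funext u
  simp [airyPhase, contour]

theorem ofReal_Ai5 {δ : ℝ} (hδ : 0 < δ) (x : ℝ) :
    (Ai5 x : ℂ) = (1 / (2 * Real.pi)) * airyInt 0 δ x := by
  rw [airyInt_eq 0 hδ one_pos, Ai5_eq]
  have := Complex.conj_eq_iff_re.1 (conj_airyInt_zero x)
  push_cast
  rw [this]

theorem hasDerivAt_re_airyInt (n : ℕ) (x : ℝ) :
    HasDerivAt (fun x : ℝ => (1 / (2 * Real.pi)) * (airyInt n 1 x).re)
      ((1 / (2 * Real.pi)) * (airyInt (n + 1) 1 x).re) x :=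
  (hasDerivAt_airyInt n one_pos (x : ℂ)).real_of_complex.const_mul _

theorem iteratedDeriv_Ai5 (n : ℕ) {δ : ℝ} (hδ : 0 < δ) (x : ℝ) :
    iteratedDeriv n Ai5 x = (1 / (2 * Real.pi)) * (airyInt n δ x).re := by
  rw [airyInt_eq n hδ one_pos]
  have h := iteratedDeriv_eqOn_of_hasDerivAt_chain isOpen_univ
    (fun n (x : ℝ) => (1 / (2 * Real.pi)) * (airyInt n 1 x).re) n
    (fun k _ s _ => hasDerivAt_re_airyInt k s) n le_rfl (mem_univ x)
  refine Eq.trans ?_ h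
  rw [show Ai5 = fun x : ℝ => (1 / (2 * Real.pi)) * (airyInt 0 1 x).re from funext Ai5_eq]

/-- All the derivatives of `Ai₅` are `O(exp(-δ x))` on the whole line, for every `δ > 0`. -/
theorem exists_bound_Ai5 (n : ℕ) {δ : ℝ} (hδ : 0 < δ) :
    ∃ C, 0 ≤ C ∧ ∀ x : ℝ, |iteratedDeriv n Ai5 x| ≤ C * Real.exp (-(δ * x)) := by
  refine ⟨|1 / (2 * Real.pi)| * ∫ u, ‖airyPhase n 0 (contour δ u)‖,
    mul_nonneg (abs_nonneg _) (integral_nonneg fun u => norm_nonneg _), fun x => ?_⟩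
  rw [iteratedDeriv_Ai5 n hδ, abs_mul, mul_assoc, ← integral_mul_const]
  refine mul_le_mul_of_nonneg_left ?_ (abs_nonneg _)
  refine (Complex.abs_re_le_norm _).trans ((norm_integral_le_integral_norm _).trans_eq ?_)
  refine integral_congr_ae (ae_of_all _ fun u => ?_)
  simp only [norm_airyPhase]
  rw [mul_assoc (‖contour δ u‖ ^ n), ← Real.exp_add]
  congr 2
  simp
  ring

theorem isHigherAiry_Ai5 : IsHigherAiry (-1) Ai5 where
  smooth := by
    rw [contDiff_infty]
    intro n
    have h := contDiffOn_of_hasDerivAt_chain isOpen_univ n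
      (fun n (x : ℝ) => (1 / (2 * Real.pi)) * (airyInt n 1 x).re)
      (fun k _ s _ => hasDerivAt_re_airyInt k s)
      (fun s hs => (hasDerivAt_re_airyInt n s).continuousAt.continuousWithinAt)
    rw [contDiffOn_univ] at h
    rw [show Ai5 = fun x : ℝ => (1 / (2 * Real.pi)) * (airyInt 0 1 x).re from funext Ai5_eq]
    exact h
  ode x := by
    have h := airyInt_four one_pos (x : ℂ)
    rw [iteratedDeriv_Ai5 4 one_pos, Ai5_eq, eq_neg_of_add_eq_zero_left h]
    simp
    ring
  decay j := by
    obtain ⟨C, -, hC⟩ := exists_bound_Ai5 j one_pos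
    exact ⟨C, 1, one_pos, fun x _ => hC x⟩

theorem integrable_exp_neg_mul_abs {a : ℝ} (ha : 0 < a) :
    Integrable fun r : ℝ => Real.exp (-(a * |r|)) := by
  have h1 : IntegrableOn (fun r : ℝ => Real.exp (-(a * |r|))) (Iic 0) := by
    refine (integrableOn_exp_mul_Iic ha 0).congr_fun (fun r hr => ?_) measurableSet_Iic
    simp only [abs_of_nonpos (mem_Iic.1 hr)]
    ring_nf
  have h2 : IntegrableOn (fun r : ℝ => Real.exp (-(a * |r|))) (Ioi 0) := by
    refine (integrableOn_exp_mul_Ioi (neg_lt_zero.2 ha) 0).congr_fun (fun r hr => ?_)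
      measurableSet_Ioi
    simp only [abs_of_pos (mem_Ioi.1 hr)]
    ring_nf
  rw [← integrableOn_univ, ← Iic_union_Ioi (a := (0 : ℝ))]
  exact h1.union h2

theorem sqrtWeightHilbertSchmidt_Ai5 {σ : ℝ → ℝ} (hσ : IsAdmissible σ) :
    SqrtWeightHilbertSchmidt Ai5 σ := by
  intro j s
  obtain ⟨γ, C, c, -, -, hc, hneg, -⟩ := hσ.limits
  -- With rate `c/4` the square grows like `e^{-cr/2}` at `-∞`; half of the decay `e^{cr}` of `σ`
  -- compensates it and the other half gives integrability.
  obtain ⟨D, hD0, hD⟩ := exists_bound_Ai5 j (δ := c / 4) (by linarith)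
  have hC : 0 ≤ C := by simpa using (abs_nonneg _).trans (hneg 0 le_rfl)
  have hσb : ∀ r, σ r * Real.exp (-(c / 2 * r)) ≤ (C + 1) * Real.exp (-(c / 2 * |r|)) := by
    intro r
    rcases le_total r 0 with hr | hr
    · have h1 := (le_abs_self _).trans (hneg r hr)
      rw [abs_of_nonpos hr]
      calc σ r * Real.exp (-(c / 2 * r)) ≤ C * Real.exp (c * r) * Real.exp (-(c / 2 * r)) := by
            gcongr
        _ = C * Real.exp (-(c / 2 * -r)) := by
            rw [mul_assoc, ← Real.exp_add]
            ring_nf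
        _ ≤ _ := by
            gcongr
            linarith
    · rw [abs_of_nonneg hr]
      gcongr
      linarith [hσ.le_one r]
  have hexp : Integrable (fun y => Real.exp (-(c / 2) * y)) halfLine :=
    integrableOn_exp_mul_Ioi (by linarith) 0
  have hint := (((integrable_exp_neg_mul_abs (a := c / 2) (by linarith)).mul_prod hexp).const_mul
    ((C + 1) * D ^ 2 * Real.exp (-(c / 2) * s)))
  have hcont := isHigherAiry_Ai5.decayingCurve.continuous j
  refine hint.mono' ?_ (ae_of_all _ fun p => ?_)
  · exact (hσ.measurable.comp measurable_fst).aestronglyMeasurable.mul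
      ((hcont.comp (by fun_prop)).pow 2).aestronglyMeasurable
  · rw [Real.norm_of_nonneg (mul_nonneg (hσ.nonneg _) (sq_nonneg _))]
    have h1 : iteratedDeriv j Ai5 (p.1 + p.2 + s) ^ 2 ≤
        (D * Real.exp (-(c / 4 * (p.1 + p.2 + s)))) ^ 2 := by
      rw [← sq_abs]
      exact pow_le_pow_left₀ (abs_nonneg _) (hD _) 2
    have h2 : (D * Real.exp (-(c / 4 * (p.1 + p.2 + s)))) ^ 2 =
        Real.exp (-(c / 2 * p.1)) *
          (D ^ 2 * Real.exp (-(c / 2) * s) * Real.exp (-(c / 2) * p.2)) := by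
      rw [mul_pow, ← Real.exp_nat_mul]
      have : ((2 : ℕ) : ℝ) * -(c / 4 * (p.1 + p.2 + s)) =
          -(c / 2 * p.1) + (-(c / 2) * s + -(c / 2) * p.2) := by
        push_cast
        ring
      rw [this, Real.exp_add, Real.exp_add]
      ring
    calc σ p.1 * iteratedDeriv j Ai5 (p.1 + p.2 + s) ^ 2
        ≤ σ p.1 * (D * Real.exp (-(c / 4 * (p.1 + p.2 + s)))) ^ 2 :=
          mul_le_mul_of_nonneg_left h1 (hσ.nonneg _)
      _ = σ p.1 * Real.exp (-(c / 2 * p.1)) *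
          (D ^ 2 * Real.exp (-(c / 2) * s) * Real.exp (-(c / 2) * p.2)) := by rw [h2]; ring
      _ ≤ (C + 1) * Real.exp (-(c / 2 * |p.1|)) *
          (D ^ 2 * Real.exp (-(c / 2) * s) * Real.exp (-(c / 2) * p.2)) := by
          have := hσb p.1
          gcongr
      _ = _ := by ring

end PainleveHierarchy

namespace PainleveHierarchy

/-! ### Compactness -/

theorem integral_mem_of_isClosed {α E : Type*} [MeasurableSpace α] {μ : Measure α}
    [NormedAddCommGroup E] [NormedSpace ℝ E] [CompleteSpace E] {S : Submodule ℝ E}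
    (hS : IsClosed (S : Set E)) {f : α → E} (hi : Integrable f μ) (hf : ∀ x, f x ∈ S) :
    ∫ x, f x ∂μ ∈ S := by
  have : IsClosed (S : Set E) := hS
  have h1 := S.mkQL.integral_comp_comm hi
  have h2 : ∀ x, S.mkQL (f x) = 0 := fun x => by
    rw [Submodule.mkQL_apply, Submodule.mkQ_apply, Submodule.Quotient.mk_eq_zero]
    exact hf x
  simp only [h2, integral_zero] at h1
  exact (Submodule.Quotient.mk_eq_zero S).1 h1.symm

theorem isCompactOperator_integral {α E : Type*} [MeasurableSpace α] {μ : Measure α}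
    [NormedAddCommGroup E] [NormedSpace ℝ E] [CompleteSpace E] {f : α → E →L[ℝ] E}
    (hi : Integrable f μ) (hf : ∀ x, IsCompactOperator (f x)) :
    IsCompactOperator (∫ x, f x ∂μ : E →L[ℝ] E) :=
  integral_mem_of_isClosed (S := compactOperator (RingHom.id ℝ) E E)
    isClosed_setOfPred_isCompactOperator hi hf

theorem isCompactOperator_rankOne {G : Type*} [NormedAddCommGroup G] [InnerProductSpace ℝ G]
    (x y : G) : IsCompactOperator (InnerProductSpace.rankOne ℝ x y) := by
  have h : IsCompactOperator (ContinuousLinearMap.toSpanSingleton ℝ x) :=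
    isCompactOperator_of_locallyCompactSpace_rng _
  exact h.comp_clm (innerSL ℝ y)

/-- A norm-convergent integral of rank-one operators stays in the closed subspace of compact
operators. -/
theorem isCompactOperator_curveOp {G : Type*} [NormedAddCommGroup G] [InnerProductSpace ℝ G]
    [CompleteSpace G] {w : ℕ → ℝ → G} (h : DecayingCurve w) (s : ℝ) :
    IsCompactOperator (curveOp w s) :=
  isCompactOperator_integral (h.integrableOn_rankOne h 0 0 s) fun _ => isCompactOperator_rankOne _ _

/-- The Fredholm alternative for `1 - K`. -/
theorem isUnit_one_sub_of_injective {X : Type*} [NormedAddCommGroup X] [NormedSpace ℝ X]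
    [CompleteSpace X] {T : X →L[ℝ] X} (hT : IsCompactOperator T) (h : ∀ x, T x = x → x = 0) :
    IsUnit (1 - T) := by
  rcases hT.hasEigenvalue_or_mem_resolventSet (one_ne_zero (α := ℝ)) with h1 | h1
  · obtain ⟨v, hv⟩ := h1.exists_hasEigenvector
    exact absurd (h v (by simpa using hv.apply_eq_smul)) hv.2
  · rw [spectrum.mem_resolventSet_iff, map_one] at h1
    exact h1

/-! ### The Laplace transform on the half line -/

/-- The integral `∫₀^∞ exp(iky) f(y) dy`. -/
noncomputable def halfLineTransform (f : L2pos) (k : ℂ) : ℂ :=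
  ∫ y, Complex.exp (Complex.I * k * y) * (f y : ℂ) ∂halfLine

theorem norm_exp_contour_mul (δ u y : ℝ) :
    ‖Complex.exp (Complex.I * contour δ u * y)‖ = Real.exp (-(δ * y)) := by
  rw [Complex.norm_exp]
  simp [contour]

theorem exp_contour_mul (δ u y : ℝ) : Complex.exp (Complex.I * contour δ u * y) =
    Complex.exp (Complex.I * u * y) * (Real.exp (-(δ * y)) : ℂ) := by
  rw [Complex.ofReal_exp, ← Complex.exp_add]
  congr 1
  push_cast [contour]
  linear_combination (δ * y : ℂ) * Complex.I_sq

theorem memLp_exp_halfLine {δ : ℝ} (hδ : 0 < δ) :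
    MemLp (fun y => Real.exp (-(δ * y))) 2 halfLine := by
  rw [memLp_two_iff_integrable_sq (by fun_prop)]
  have h : Integrable (fun y => Real.exp (-(2 * δ) * y)) halfLine :=
    integrableOn_exp_mul_Ioi (by linarith) 0
  refine h.congr (ae_of_all _ fun y => ?_)
  simp only [← Real.exp_nat_mul]
  congr 1
  push_cast
  ring

theorem integrable_exp_mul (f : L2pos) {δ : ℝ} (hδ : 0 < δ) :
    Integrable (fun y => Real.exp (-(δ * y)) * f y) halfLine :=
  (memLp_exp_halfLine hδ).integrable_mul (Lp.memLp f)

theorem norm_halfLineTransform_le (f : L2pos) (δ u : ℝ) :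
    ‖halfLineTransform f (contour δ u)‖ ≤ ∫ y, ‖Real.exp (-(δ * y)) * f y‖ ∂halfLine := by
  refine (norm_integral_le_integral_norm _).trans_eq ?_
  refine integral_congr_ae (ae_of_all _ fun y => ?_)
  simp only [norm_mul, norm_exp_contour_mul, Complex.norm_real]
  rw [Real.norm_of_nonneg (Real.exp_pos _).le]

/-- The damped function, extended by zero to the whole line. -/
noncomputable def damped (f : L2pos) (δ : ℝ) : ℝ → ℂ :=
  (Ioi (0 : ℝ)).indicator fun y => ((Real.exp (-(δ * y)) * f y : ℝ) : ℂ)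

theorem integrable_damped (f : L2pos) {δ : ℝ} (hδ : 0 < δ) : Integrable (damped f δ) := by
  rw [damped, integrable_indicator_iff measurableSet_Ioi]
  exact (integrable_exp_mul f hδ).ofReal

theorem memLp_halfLine_damped (f : L2pos) {δ : ℝ} (hδ : 0 ≤ δ) :
    MemLp (fun y => ((Real.exp (-(δ * y)) * f y : ℝ) : ℂ)) 2 halfLine := by
  refine (Lp.memLp f).of_le ?_ ?_
  · exact (Complex.measurable_ofReal.comp_aemeasurable (by fun_prop)).aestronglyMeasurable
  · refine ae_restrict_of_forall_mem measurableSet_Ioi fun y hy => ?_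
    rw [Complex.norm_real, norm_mul, Real.norm_of_nonneg (Real.exp_pos _).le]
    refine mul_le_of_le_one_left (norm_nonneg _) (Real.exp_le_one_iff.2 ?_)
    have := mul_nonneg hδ (le_of_lt (mem_Ioi.1 hy))
    linarith

theorem memLp_damped (f : L2pos) {δ : ℝ} (hδ : 0 ≤ δ) : MemLp (damped f δ) 2 := by
  rw [damped, memLp_indicator_iff_restrict measurableSet_Ioi]
  exact memLp_halfLine_damped f hδ

theorem lintegral_damped_le (f : L2pos) {δ : ℝ} (hδ : 0 ≤ δ) :
    ∫⁻ y, ‖damped f δ y‖ₑ ^ 2 ≤ ∫⁻ y, ‖f y‖ₑ ^ 2 ∂halfLine := by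
  have : (fun y => ‖damped f δ y‖ₑ ^ 2) = (Ioi (0 : ℝ)).indicator
      fun y => ‖((Real.exp (-(δ * y)) * f y : ℝ) : ℂ)‖ₑ ^ 2 := by
    funext y
    by_cases hy : y ∈ Ioi (0 : ℝ) <;> simp [damped, hy]
  rw [this, lintegral_indicator measurableSet_Ioi]
  refine setLIntegral_mono' measurableSet_Ioi fun y hy => ?_
  gcongr
  rw [← ofReal_norm, ← ofReal_norm]
  refine ENNReal.ofReal_le_ofReal ?_
  rw [Complex.norm_real, norm_mul, Real.norm_of_nonneg (Real.exp_pos _).le]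
  refine mul_le_of_le_one_left (norm_nonneg _) (Real.exp_le_one_iff.2 ?_)
  have := mul_nonneg hδ (le_of_lt (mem_Ioi.1 hy))
  linarith

theorem halfLineTransform_eq (f : L2pos) (δ u : ℝ) : halfLineTransform f (contour δ u) =
    ∫ y : ℝ, Complex.exp (Complex.I * y * u) * damped f δ y := by
  rw [halfLineTransform, ← integral_indicator measurableSet_Ioi]
  congr 1
  funext y
  by_cases hy : y ∈ Ioi (0 : ℝ)
  · simp only [damped, indicator_of_mem hy, exp_contour_mul, mul_right_comm _ (y : ℂ)]
    push_cast
    ring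
  · simp only [damped, indicator_of_notMem hy, mul_zero]

/-- Plancherel for the damped function. The bound does not depend on `δ`, which allows `δ → 0`
later. -/
theorem lintegral_halfLineTransform_le (f : L2pos) {δ : ℝ} (hδ : 0 < δ) :
    ∫⁻ u : ℝ, ‖halfLineTransform f (contour δ u)‖ₑ ^ 2 ≤
      ENNReal.ofReal (2 * Real.pi) * ∫⁻ y, ‖f y‖ₑ ^ 2 ∂halfLine := by
  simp only [halfLineTransform_eq]
  rw [lintegral_exp_sq (integrable_damped f hδ) (memLp_damped f hδ.le)]
  exact mul_le_mul_right (lintegral_damped_le f hδ.le) _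

theorem aestronglyMeasurable_halfLineTransform (f : L2pos) (δ : ℝ) :
    AEStronglyMeasurable (fun u => halfLineTransform f (contour δ u)) := by
  unfold halfLineTransform
  refine AEStronglyMeasurable.integral_prod_right'
    (f := fun p : ℝ × ℝ => Complex.exp (Complex.I * contour δ p.1 * p.2) * (f p.2 : ℂ)) ?_
  refine (Continuous.aestronglyMeasurable (by unfold contour; fun_prop)).mul ?_
  exact (Complex.continuous_ofReal.comp_aestronglyMeasurable (Lp.aestronglyMeasurable f)).comp_snd

end PainleveHierarchy

/-! ### The Airy transform of a function on the half line: contraction and analyticity -/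

namespace PainleveHierarchy

/-- The integral `∫ exp(ik⁵/5 + ikz) (∫₀^∞ exp(iky) f(y) dy) dk` over the line `Im k = δ`. -/
noncomputable def airyTransform (f : L2pos) (δ : ℝ) (z : ℂ) : ℂ :=
  ∫ u : ℝ, airyPhase 0 z (contour δ u) * halfLineTransform f (contour δ u)

theorem airyPhase_add (z w k : ℂ) :
    airyPhase 0 (z + w) k = Complex.exp (Complex.I * k * w) * airyPhase 0 z k := by
  rw [airyPhase, airyPhase, pow_zero, one_mul, one_mul, ← Complex.exp_add]
  congr 1
  ring

theorem integrable_airyTransform (f : L2pos) (n : ℕ) {δ : ℝ} (hδ : 0 < δ) (z : ℂ) :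
    Integrable fun u : ℝ => airyPhase n z (contour δ u) * halfLineTransform f (contour δ u) :=
  (integrable_airyPhase n hδ z).mul_bdd (aestronglyMeasurable_halfLineTransform f δ)
    (ae_of_all _ (norm_halfLineTransform_le f δ))

theorem differentiable_airyTransform (f : L2pos) {δ : ℝ} (hδ : 0 < δ) :
    Differentiable ℂ (airyTransform f δ) := by
  intro z
  obtain ⟨C, hC⟩ := exists_bound_airyPhase 1 (a := δ) (b := δ) (X := ‖z‖ + 1) hδ
  set D := ∫ y, ‖Real.exp (-(δ * y)) * f y‖ ∂halfLine
  refine (hasDerivAt_integral_of_dominated_loc_of_deriv_le (Metric.ball_mem_nhds z one_pos)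
    (F' := fun z u => airyPhase 1 z (contour δ u) * halfLineTransform f (contour δ u))
    (bound := fun u => C * Real.exp (-(1 / 2) * u ^ 2) * D)
    (Eventually.of_forall fun w => (integrable_airyTransform f 0 hδ w).aestronglyMeasurable)
    (integrable_airyTransform f 0 hδ z) (integrable_airyTransform f 1 hδ z).aestronglyMeasurable
    (ae_of_all _ fun u w hw => ?_) ((integrable_gauss.const_mul C).mul_const D)
    (ae_of_all _ fun u w _ => (hasDerivAt_airyPhase 0 w _).mul_const _)).2.differentiableAt
  have : ‖w - z‖ < 1 := by simpa [dist_eq_norm] using hw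
  have hw' : ‖w‖ ≤ ‖z‖ + 1 := by
    calc ‖w‖ = ‖z + (w - z)‖ := by congr 1; ring
      _ ≤ ‖z‖ + ‖w - z‖ := norm_add_le _ _
      _ ≤ ‖z‖ + 1 := by linarith
  rw [norm_mul]
  have h1 := hC δ ⟨le_rfl, le_rfl⟩ w hw' u
  exact mul_le_mul h1 (norm_halfLineTransform_le f δ u) (norm_nonneg _) ((norm_nonneg _).trans h1)

/-- Fubini's theorem for the Airy transform of a function on the half line. -/
theorem airyTransform_ofReal (f : L2pos) {δ : ℝ} (hδ : 0 < δ) (x : ℝ) :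
    airyTransform f δ x =
      ((2 * Real.pi * inner ℝ (halfLineCurve isHigherAiry_Ai5 0 x) f : ℝ) : ℂ) := by
  have hi : Integrable (fun p : ℝ × ℝ => airyPhase 0 x (contour δ p.1) *
      (Complex.exp (Complex.I * contour δ p.1 * p.2) * (f p.2 : ℂ))) (volume.prod halfLine) := by
    refine ((integrable_airyPhase 0 hδ (x : ℂ)).norm.mul_prod (integrable_exp_mul f hδ).norm).mono'
      ?_ (ae_of_all _ fun p => ?_)
    · refine (Continuous.aestronglyMeasurable ?_).mul
        ((Continuous.aestronglyMeasurable (by unfold contour; fun_prop)).mul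
        (Complex.continuous_ofReal.comp_aestronglyMeasurable (Lp.aestronglyMeasurable f)).comp_snd)
      exact (continuous_airyPhase_contour 0 δ x).comp continuous_fst
    · simp only [norm_mul, norm_exp_contour_mul, Complex.norm_real]
      rw [Real.norm_of_nonneg (Real.exp_pos _).le]
  simp only [airyTransform, halfLineTransform, ← integral_const_mul]
  rw [integral_integral_swap hi, inner_halfLineCurve, ← integral_const_mul, ← integral_complex_ofReal]
  refine integral_congr_ae (ae_of_all _ fun y => ?_)
  have hpi : (Real.pi : ℂ) ≠ 0 := Complex.ofReal_ne_zero.2 Real.pi_ne_zero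
  have h1 := ofReal_Ai5 hδ (x + y)
  have h2 : ∫ u : ℝ, airyPhase 0 x (contour δ u) *
      (Complex.exp (Complex.I * contour δ u * y) * (f y : ℂ)) = airyInt 0 δ (x + y) * f y := by
    rw [airyInt, ← integral_mul_const]
    refine integral_congr_ae (ae_of_all _ fun u => ?_)
    simp only [airyPhase_add]
    ring
  simp only [h2, iteratedDeriv_zero]
  push_cast at h1 ⊢
  rw [h1]
  field_simp

/-- The contraction property, with an exponential weight. -/
theorem lintegral_exp_mul_inner_le (f : L2pos) (s : ℝ) {δ : ℝ} (hδ : 0 < δ) :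
    ∫⁻ r : ℝ, ENNReal.ofReal ((Real.exp (δ * r)
        * inner ℝ (halfLineCurve isHigherAiry_Ai5 0 (r + s)) f) ^ 2) ≤
      ENNReal.ofReal (Real.exp (2 * δ ^ 5 - δ * s) ^ 2) * ∫⁻ y, ‖f y‖ₑ ^ 2 ∂halfLine := by
  set h : ℝ → ℂ := fun u => airyPhase 0 s (contour δ u) * halfLineTransform f (contour δ u) with hh
  -- Completing the square, `-δu⁴ + 2δ³u² = -δ(u² - δ²)² + δ⁵`, so the exponent is at most `δ⁵ -
  -- δs`; the constant `2` is slack.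
  have hM : ∀ u, ‖airyPhase 0 s (contour δ u)‖ ≤ Real.exp (2 * δ ^ 5 - δ * s) := fun u => by
    rw [norm_airyPhase, pow_zero, one_mul, Complex.ofReal_re, Complex.ofReal_im]
    refine Real.exp_le_exp.2 ?_
    have h1 : 0 ≤ δ * (u ^ 2 - δ ^ 2) ^ 2 := by positivity
    have h2 : 0 ≤ δ ^ 5 := by positivity
    nlinarith
  have hhi : Integrable h := integrable_airyTransform f 0 hδ s
  set D := ∫ y, ‖Real.exp (-(δ * y)) * f y‖ ∂halfLine
  have hh2 : MemLp h 2 := by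
    refine (memLp_two_iff_integrable_sq_norm hhi.aestronglyMeasurable).2 ?_
    simp only [sq]
    refine hhi.norm.mul_bdd (c := Real.exp (2 * δ ^ 5 - δ * s) * D)
      hhi.norm.aestronglyMeasurable (ae_of_all _ fun u => ?_)
    rw [norm_norm, hh, norm_mul]
    exact mul_le_mul (hM u) (norm_halfLineTransform_le f δ u) (norm_nonneg _) (Real.exp_pos _).le
  have hpi := Real.pi_pos
  have hpl := lintegral_exp_sq hhi hh2
  have e1 : ∀ r : ℝ, ‖∫ u : ℝ, Complex.exp (Complex.I * u * r) * h u‖ₑ ^ 2 =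
      ENNReal.ofReal ((2 * Real.pi) ^ 2) * ENNReal.ofReal ((Real.exp (δ * r)
        * inner ℝ (halfLineCurve isHigherAiry_Ai5 0 (r + s)) f) ^ 2) := by
    intro r
    have h3 : ∫ u : ℝ, Complex.exp (Complex.I * u * r) * h u =
        ((Real.exp (δ * r) * (2 * Real.pi * inner ℝ (halfLineCurve isHigherAiry_Ai5 0 (r + s)) f)
          : ℝ) : ℂ) := by
      rw [Complex.ofReal_mul, ← airyTransform_ofReal f hδ, airyTransform, ← integral_const_mul]
      refine integral_congr_ae (ae_of_all _ fun u => ?_)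
      -- The weight `e^{δr}` undoes the shift of the contour, so that the transform becomes an
      -- ordinary Fourier integral in `u`.
      have h4 : Complex.exp (Complex.I * u * r) =
          (Real.exp (δ * r) : ℂ) * Complex.exp (Complex.I * contour δ u * r) := by
        rw [exp_contour_mul, mul_left_comm, ← Complex.ofReal_mul, ← Real.exp_add]
        simp
      simp only [hh, h4]
      rw [add_comm r s, Complex.ofReal_add, airyPhase_add]
      ring
    rw [h3, ← ofReal_norm, Complex.norm_real, ← ENNReal.ofReal_pow (norm_nonneg _),
      ← ENNReal.ofReal_mul (by positivity), Real.norm_eq_abs, sq_abs]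
    congr 1
    ring
  have e2 : ∫⁻ u, ‖h u‖ₑ ^ 2 ≤ ENNReal.ofReal (Real.exp (2 * δ ^ 5 - δ * s) ^ 2) *
      ∫⁻ u : ℝ, ‖halfLineTransform f (contour δ u)‖ₑ ^ 2 := by
    rw [← lintegral_const_mul' _ _ ENNReal.ofReal_ne_top]
    refine lintegral_mono fun u => ?_
    rw [hh, enorm_mul, mul_pow, ENNReal.ofReal_pow (Real.exp_pos _).le]
    gcongr
    rw [← ofReal_norm]
    exact ENNReal.ofReal_le_ofReal (hM u)
  simp only [e1] at hpl
  rw [lintegral_const_mul' _ _ ENNReal.ofReal_ne_top] at hpl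
  have hc : ENNReal.ofReal ((2 * Real.pi) ^ 2) ≠ 0 := by
    rw [ne_eq, ENNReal.ofReal_eq_zero, not_le]
    positivity
  rw [← ENNReal.mul_le_mul_iff_right hc ENNReal.ofReal_ne_top, hpl]
  calc ENNReal.ofReal (2 * Real.pi) * ∫⁻ u, ‖h u‖ₑ ^ 2
      ≤ ENNReal.ofReal (2 * Real.pi) * (ENNReal.ofReal (Real.exp (2 * δ ^ 5 - δ * s) ^ 2) *
        (ENNReal.ofReal (2 * Real.pi) * ∫⁻ y, ‖f y‖ₑ ^ 2 ∂halfLine)) := by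
          gcongr
          exact e2.trans (by gcongr; exact lintegral_halfLineTransform_le f hδ)
    _ = _ := by
          rw [ENNReal.ofReal_pow (p := 2 * Real.pi) (by positivity)]
          ring

/-- The Airy transform is a contraction. -/
theorem lintegral_inner_le (f : L2pos) (s : ℝ) :
    ∫⁻ r : ℝ, ENNReal.ofReal ((inner ℝ (halfLineCurve isHigherAiry_Ai5 0 (r + s)) f) ^ 2) ≤
      ∫⁻ y, ‖f y‖ₑ ^ 2 ∂halfLine := by
  set b : ℝ → ℝ := fun r => inner ℝ (halfLineCurve isHigherAiry_Ai5 0 (r + s)) f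
  have hb : Continuous b :=
    (((decayingCurve_halfLineCurve isHigherAiry_Ai5).continuous 0).comp
      (continuous_add_const s)).inner continuous_const
  -- Fatou's lemma along `δ = 1/(n+1)`: on the real line itself the integral defining `Ai₅` does not
  -- converge absolutely, whereas the constants `e^{2δ⁵ - δs}` tend to `1`.
  have hδ : Tendsto (fun n : ℕ => 1 / ((n : ℝ) + 1)) atTop (𝓝 0) := tendsto_one_div_add_atTop_nhds_zero_nat
  have hl : ∀ r, liminf (fun n : ℕ => ENNReal.ofReal ((Real.exp (1 / ((n : ℝ) + 1) * r) * b r) ^ 2))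
      atTop = ENNReal.ofReal (b r ^ 2) := fun r => by
    refine Tendsto.liminf_eq (ENNReal.tendsto_ofReal ?_)
    have h1 : Tendsto (fun n : ℕ => (Real.exp (1 / ((n : ℝ) + 1) * r) * b r) ^ 2) atTop
        (𝓝 ((Real.exp (0 * r) * b r) ^ 2)) :=
      ((Real.continuous_exp.tendsto _ |>.comp (hδ.mul_const r)).mul_const _).pow 2
    simpa using h1
  have h1 := lintegral_liminf_le (μ := volume) (u := atTop) (f := fun (n : ℕ) r =>
    ENNReal.ofReal ((Real.exp (1 / ((n : ℝ) + 1) * r) * b r) ^ 2)) (fun n => by fun_prop)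
  simp only [hl] at h1
  have h2 : Tendsto (fun n : ℕ => ENNReal.ofReal
      (Real.exp (2 * (1 / ((n : ℝ) + 1)) ^ 5 - 1 / ((n : ℝ) + 1) * s) ^ 2) *
        ∫⁻ y, ‖f y‖ₑ ^ 2 ∂halfLine) atTop (𝓝 (∫⁻ y, ‖f y‖ₑ ^ 2 ∂halfLine)) := by
    have h3 : Tendsto (fun n : ℕ =>
        Real.exp (2 * (1 / ((n : ℝ) + 1)) ^ 5 - 1 / ((n : ℝ) + 1) * s) ^ 2) atTop
        (𝓝 (Real.exp (2 * 0 ^ 5 - 0 * s) ^ 2)) :=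
      (Real.continuous_exp.tendsto _ |>.comp
        (((hδ.pow 5).const_mul 2).sub (hδ.mul_const s))).pow 2
    have h4 := ENNReal.Tendsto.mul_const (b := ∫⁻ y, ‖f y‖ₑ ^ 2 ∂halfLine)
      (ENNReal.tendsto_ofReal h3) (Or.inl (by simp))
    simpa using h4
  refine h1.trans ?_
  rw [← h2.liminf_eq]
  exact liminf_le_liminf (Eventually.of_forall fun n =>
    lintegral_exp_mul_inner_le f s Nat.one_div_pos_of_nat)

/-- If the Airy transform of `f` vanishes near `-∞` then it vanishes identically. -/
theorem inner_eq_zero_of_eqOn {f : L2pos} {s R : ℝ}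
    (h : ∀ r < R, inner ℝ (halfLineCurve isHigherAiry_Ai5 0 (r + s)) f = 0) (r : ℝ) :
    inner ℝ (halfLineCurve isHigherAiry_Ai5 0 (r + s)) f = 0 := by
  have han : AnalyticOnNhd ℂ (airyTransform f 1) univ :=
    (differentiable_airyTransform f one_pos).differentiableOn.analyticOnNhd isOpen_univ
  have hpi := Real.pi_pos
  have hfreq : ∃ᶠ z in 𝓝[≠] ((R - 1 + s : ℝ) : ℂ), airyTransform f 1 z = 0 := by
    have ht : Tendsto (fun x : ℝ => (x : ℂ)) (𝓝[≠] (R - 1 + s)) (𝓝[≠] ((R - 1 + s : ℝ) : ℂ)) :=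
      tendsto_nhdsWithin_of_tendsto_nhds_of_eventually_within _
        (Complex.continuous_ofReal.continuousAt.tendsto.mono_left nhdsWithin_le_nhds)
        (eventually_mem_nhdsWithin.mono fun x hx hx' => hx (Complex.ofReal_injective hx'))
    refine ht.frequently (Eventually.frequently ?_)
    filter_upwards [nhdsWithin_le_nhds (Iio_mem_nhds (show R - 1 + s < R + s by linarith))]
      with x hx
    have h1 := h (x - s) (by linarith [mem_Iio.1 hx])
    rw [sub_add_cancel] at h1
    rw [airyTransform_ofReal f one_pos, h1]
    simp
  have h0 := han.eqOn_zero_of_preconnected_of_frequently_eq_zero isPreconnected_univ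
    (mem_univ _) hfreq (mem_univ ((r + s : ℝ) : ℂ))
  rw [airyTransform_ofReal f one_pos, Pi.zero_apply, Complex.ofReal_eq_zero] at h0
  simpa [hpi.ne'] using h0

end PainleveHierarchy

/-! ### Invertibility for `Ai₅` -/

namespace PainleveHierarchy

/-- If multiplication by `√σ` maps the Airy transform of `f` to a vector of norm `‖f‖`, then the transform
vanishes. -/
theorem inner_eq_zero_of_norm_sq {σ : ℝ → ℝ} (hσ : IsAdmissible σ) (f : L2pos) (s : ℝ)
    (hf : ‖f‖ ^ 2 = ∫ r, σ r * inner ℝ (halfLineCurve isHigherAiry_Ai5 0 (r + s)) f ^ 2) (r : ℝ) :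
    inner ℝ (halfLineCurve isHigherAiry_Ai5 0 (r + s)) f = 0 := by
  set b : ℝ → ℝ := fun r => inner ℝ (halfLineCurve isHigherAiry_Ai5 0 (r + s)) f with hbdef
  have hb : Continuous b :=
    (((decayingCurve_halfLineCurve isHigherAiry_Ai5).continuous 0).comp
      (continuous_add_const s)).inner continuous_const
  have hfi : Integrable (fun y => f y ^ 2) halfLine := (Lp.memLp f).integrable_sq
  have hfe : ∫⁻ y, ‖f y‖ₑ ^ 2 ∂halfLine = ENNReal.ofReal (‖f‖ ^ 2) := by
    rw [L2pos_norm_sq, ofReal_integral_eq_lintegral_ofReal hfi (ae_of_all _ fun y => sq_nonneg _)]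
    refine lintegral_congr fun y => ?_
    rw [← ofReal_norm, ← ENNReal.ofReal_pow (norm_nonneg _), Real.norm_eq_abs, sq_abs]
  have hle := lintegral_inner_le f s
  rw [hfe] at hle
  have hbi : Integrable (fun r => b r ^ 2) := by
    refine ⟨(hb.pow 2).aestronglyMeasurable, ?_⟩
    rw [hasFiniteIntegral_iff_ofReal (ae_of_all _ fun r => sq_nonneg _)]
    exact hle.trans_lt ENNReal.ofReal_lt_top
  have hb1 : ∫ r, b r ^ 2 ≤ ‖f‖ ^ 2 := by
    rw [integral_eq_lintegral_of_nonneg_ae (ae_of_all _ fun r => sq_nonneg _)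
      (hb.pow 2).aestronglyMeasurable]
    exact ENNReal.toReal_le_of_le_ofReal (sq_nonneg _) hle
  have hσb : Integrable fun r => σ r * b r ^ 2 := by
    refine hbi.bdd_mul (c := 1) hσ.measurable.aestronglyMeasurable (ae_of_all _ fun r => ?_)
    rw [Real.norm_of_nonneg (hσ.nonneg r)]
    exact hσ.le_one r
  have hnn : ∀ r, 0 ≤ b r ^ 2 - σ r * b r ^ 2 := fun r => by
    nlinarith [hσ.le_one r, sq_nonneg (b r)]
  -- Here `‖f‖² = ∫ σ b² ≤ ∫ b² ≤ ‖f‖²` forces equality, so `(1 - σ) b²` vanishes almost everywhere.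
  have h0 : ∫ r, (b r ^ 2 - σ r * b r ^ 2) = 0 := by
    refine le_antisymm ?_ (integral_nonneg hnn)
    rw [integral_sub hbi hσb]
    linarith
  rw [integral_eq_zero_iff_of_nonneg hnn (hbi.sub hσb)] at h0
  -- Although `σ` may equal `1` on the right, it is below `1` near `-∞`; analyticity does the rest.
  obtain ⟨R, hR⟩ := (hσ.tendsto_atBot.eventually (gt_mem_nhds one_pos)).exists
  have hae : b =ᵐ[volume.restrict (Iio R)] fun _ => 0 := by
    refine (ae_restrict_iff' measurableSet_Iio).2 ?_
    filter_upwards [h0] with r hr hrR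
    have h1 : σ r < 1 := (hσ.mono (le_of_lt hrR)).trans_lt hR
    have h2 : (1 - σ r) * b r ^ 2 = 0 := by
      rw [Pi.zero_apply] at hr
      linarith
    rcases mul_eq_zero.1 h2 with h3 | h3
    · linarith
    · exact pow_eq_zero_iff two_ne_zero |>.1 h3
  have hon := Measure.eqOn_open_of_ae_eq hae isOpen_Iio hb.continuousOn continuousOn_const
  exact inner_eq_zero_of_eqOn (R := R) (fun r hr => hon hr) r

/-- A fixed vector `g = W* W g` satisfies `g = W* f` for `f = W g`, so `‖f‖² = ⟨W* f, g⟩ = ‖g‖²`,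
which is the extremal case excluded above unless `g = 0`. -/
theorem isUnit_opK2_Ai5 {σ : ℝ → ℝ} (hσ : IsAdmissible σ) (s : ℝ) :
    IsUnit (1 - opK2 Ai5 σ s) := by
  have hA := isHigherAiry_Ai5
  have h := sqrtWeightHilbertSchmidt_Ai5 hσ
  have hc := decayingCurve_airyCurve hA hσ h
  rw [isUnit_opK2_iff hA hσ h]
  refine isUnit_one_sub_of_injective (isCompactOperator_curveOp hc s) fun g hg => ?_
  set f := curveAdj hc 0 s g with hf
  have hBf : curveB hc 0 s f = g := by
    rw [hf, ← ContinuousLinearMap.comp_apply, curveB_comp_curveAdj, hg]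
  have hgb := coeFn_curveB_airyCurve hA hσ h 0 s f
  rw [hBf] at hgb
  have hnorm : ‖f‖ ^ 2 = ∫ r, σ r * inner ℝ (halfLineCurve hA 0 (r + s)) f ^ 2 := by
    rw [← real_inner_self_eq_norm_sq]
    nth_rw 2 [hf]
    rw [← inner_curveB, hBf, real_inner_self_eq_norm_sq, Lp_two_norm_sq,
      ← integral_weight hσ fun r => inner ℝ (halfLineCurve hA 0 (r + s)) f ^ 2]
    refine integral_congr_ae ?_
    filter_upwards [hgb] with r hr
    rw [hr]
  have hz := inner_eq_zero_of_norm_sq hσ f s hnorm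
  refine (Lp.eq_zero_iff_ae_eq_zero).2 ?_
  filter_upwards [hgb] with r hr
  rw [hr, hz r, Pi.zero_apply]

end PainleveHierarchy

open PainleveHierarchy in
theorem mainTheorem7 :
    -- the higher-order Airy function `Ai₅`, which solves `A'''' = - x A`
    (IsHigherAiry (-1) Ai5 ∧
      ∀ (σ : ℝ → ℝ) (hσ : IsAdmissible σ),
        SqrtWeightHilbertSchmidt Ai5 σ ∧
        (∀ s : ℝ, K2WellDefined Ai5 σ s ∧ IsUnit (1 - opK2 Ai5 σ s) ∧
          SecondMemberAt (-1) Ai5 hσ.mono s ∧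
          (dσ hσ.mono = Measure.dirac 0 →
            PainleveIISecondMemberAt (-1) (fun s' => q0 Ai5 σ s' 0) s)) ∧
        BoundaryBehaviour Ai5 σ) ∧
    -- any decaying solution of `A'''' = ± x A`, wherever the resolvent exists
    (∀ (ε : ℝ), (ε = 1 ∨ ε = -1) → ∀ (A : ℝ → ℝ), IsHigherAiry ε A →
      ∀ (σ : ℝ → ℝ) (hσ : IsAdmissible σ), SqrtWeightHilbertSchmidt A σ →
        (∀ s : ℝ, K2WellDefined A σ s) ∧
        (∀ s : ℝ, IsUnit (1 - opK2 A σ s) →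
          SecondMemberAt ε A hσ.mono s ∧
          (dσ hσ.mono = Measure.dirac 0 →
            PainleveIISecondMemberAt ε (fun s' => q0 A σ s' 0) s)) ∧
        (∀ᶠ s in atTop, IsUnit (1 - opK2 A σ s)) ∧
        BoundaryBehaviour A σ ∧
        (ε = 1 → ∀ t : ℝ, (fun s => q0 A σ s t) ~[atTop] (fun s => A (s + t)))) := by
  refine ⟨⟨isHigherAiry_Ai5, fun σ hσ => ?_⟩, fun ε _ A hA σ hσ h => ?_⟩
  · have hA := isHigherAiry_Ai5
    have h := sqrtWeightHilbertSchmidt_Ai5 hσ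
    exact ⟨h, fun s => ⟨k2WellDefined hA hσ h s, isUnit_opK2_Ai5 hσ s,
      secondMemberAt hA hσ h (isUnit_opK2_Ai5 hσ s),
      painleveIISecondMemberAt hA hσ h (isUnit_opK2_Ai5 hσ s)⟩, boundaryBehaviour hA hσ h⟩
  · refine ⟨k2WellDefined hA hσ h, fun s hs => ⟨secondMemberAt hA hσ h hs,
      painleveIISecondMemberAt hA hσ h hs⟩, eventually_isUnit hA hσ h, boundaryBehaviour hA hσ h,
      fun hε => ?_⟩
    subst hε
    exact isEquivalent_of_positive hA (boundaryBehaviour hA hσ h)
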